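/- Let $G=(V,E)$ be a finite simple undirected graph with $n=|V|$ nodes and $m=|E|$ links, where every link $e$ has a real capacity $c(e)\ge 0$ and a real weight $\omega(e)\ge 0$, and let $s,w,t\in V$ (not necessarily distinct). A \emph{route} from $s$ via $w$ to $t$ is a walk from $s$ to $w$ followed by a walk from $w$ to $t$. It is \emph{feasible} if, for every link $e$, the total number of times the two walks traverse $e$, in either direction, is at most $c(e)$. Its \emph{length} is the sum of the weights of the traversed links, counted with multiplicity. There is a deterministic algorithm that, given $G$ (as a list of its links with their capacities and weights) and $s,w,t$, outputs a feasible route from $s$ via $w$ to $t$ of minimum length among all feasible routes, or reports that no feasible route exists. For $m\ge 1$ its running time is \[ O\bigl(m \log_{1+m/n} n\bigr). \] Here running time is the number of steps on a random access machine with words of $O(\log(n+m))$ bits, on which addition, truncated subtraction, multiplication, integer division and comparison of words, addition, subtraction and comparison of real numbers, and (indirect) memory accesses take one step each. -/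

import Mathlib

open scoped NNReal

/-! ## Waypoint routing on undirected networks -/

/-- An undirected (simple) graph with non-negative link capacities and link weights.
Only the values on links of the graph matter. -/
structure Network (V : Type) where
  graph : SimpleGraph V
  cap : Sym2 V → ℝ≥0
  weight : Sym2 V → ℝ≥0

/-- A route from `s` via `w` to `t`: a walk from `s` to `w` followed by a walk from `w` to `t`.
Nodes and links may be repeated. -/
structure Route {V : Type} (N : Network V) (s w t : V) where
  first : N.graph.Walk s w
  second : N.graph.Walk w t

namespace Route

variable {V : Type} {N : Network V} {s w t : V}

/-- The links traversed by the route, with repetitions. -/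
def links (R : Route N s w t) : List (Sym2 V) :=
  R.first.edges ++ R.second.edges

/-- The flow has demand one: every traversal of a link, in either direction and on either segment,
uses one unit of the capacity of that link. -/
def Feasible [DecidableEq V] (R : Route N s w t) : Prop :=
  ∀ e ∈ N.graph.edgeSet, (R.links.count e : ℝ≥0) ≤ N.cap e

/-- The total weight of the route, repeated links being counted with repetition. -/
noncomputable def length (R : Route N s w t) : ℝ≥0 :=
  (R.links.map N.weight).sum

/-- A feasible route of minimum length among all feasible routes. -/
def IsShortest [DecidableEq V] (R : Route N s w t) : Prop :=
  R.Feasible ∧ ∀ R' : Route N s w t, R'.Feasible → R.length ≤ R'.length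

end Route

/-! ## The machine model

A random access machine with words (natural numbers below a bound `B`) and real numbers.
A program uses finitely many registers and arrays of each of the two kinds, and has indirect
addressing. Words can be added, subtracted (truncated at zero), multiplied, divided (rounding down,
with `x / 0 = 0`) and compared; real numbers can only be added, subtracted and compared, and there
is no conversion between words and reals. Every operation costs one step. If a word operation
yields a value that is not below `B`, the program has no execution. -/

namespace RAM

/-- The contents of the word registers, real registers, word arrays and real arrays. -/
structure State where
  nreg : ℕ → ℕ
  rreg : ℕ → ℝ
  narr : ℕ → ℕ → ℕ
  rarr : ℕ → ℕ → ℝ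

/-- Word expressions; `read a i` is the entry at index `i` of the word array number `a`. -/
inductive NExpr where
  | lit (k : ℕ)
  | reg (x : ℕ)
  | read (a : ℕ) (i : NExpr)
  | add (e f : NExpr)
  | sub (e f : NExpr)
  | mul (e f : NExpr)
  | div (e f : NExpr)

/-- Real expressions; `read a i` is the entry at index `i` of the real array number `a`. -/
inductive RExpr where
  | zero
  | one
  | reg (x : ℕ)
  | read (a : ℕ) (i : NExpr)
  | add (e f : RExpr)
  | sub (e f : RExpr)

/-- Tests. -/
inductive BExpr where
  | nle (e f : NExpr)
  | rle (e f : RExpr)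
  | not (b : BExpr)
  | and (b c : BExpr)

/-- Programs. -/
inductive Cmd where
  | skip
  | setN (x : ℕ) (e : NExpr)
  | setR (x : ℕ) (e : RExpr)
  | storeN (a : ℕ) (i e : NExpr)
  | storeR (a : ℕ) (i : NExpr) (e : RExpr)
  | seq (P Q : Cmd)
  | ite (b : BExpr) (P Q : Cmd)
  | loop (b : BExpr) (P : Cmd)

namespace NExpr

def eval (σ : State) : NExpr → ℕ
  | lit k => k
  | reg x => σ.nreg x
  | read a i => σ.narr a (i.eval σ)
  | add e f => e.eval σ + f.eval σ
  | sub e f => e.eval σ - f.eval σ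
  | mul e f => e.eval σ * f.eval σ
  | div e f => e.eval σ / f.eval σ

/-- The values of the expression and of all its subexpressions fit into a word. -/
def Fits (B : ℕ) (σ : State) : NExpr → Prop
  | lit k => k < B
  | reg x => σ.nreg x < B
  | read a i => i.Fits B σ ∧ σ.narr a (i.eval σ) < B
  | add e f => e.Fits B σ ∧ f.Fits B σ ∧ e.eval σ + f.eval σ < B
  | sub e f => e.Fits B σ ∧ f.Fits B σ
  | mul e f => e.Fits B σ ∧ f.Fits B σ ∧ e.eval σ * f.eval σ < B
  | div e f => e.Fits B σ ∧ f.Fits B σ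

def cost : NExpr → ℕ
  | lit _ => 1
  | reg _ => 1
  | read _ i => i.cost + 1
  | add e f => e.cost + f.cost + 1
  | sub e f => e.cost + f.cost + 1
  | mul e f => e.cost + f.cost + 1
  | div e f => e.cost + f.cost + 1

end NExpr

namespace RExpr

noncomputable def eval (σ : State) : RExpr → ℝ
  | zero => 0
  | one => 1
  | reg x => σ.rreg x
  | read a i => σ.rarr a (i.eval σ)
  | add e f => e.eval σ + f.eval σ
  | sub e f => e.eval σ - f.eval σ

def Fits (B : ℕ) (σ : State) : RExpr → Prop
  | zero => True
  | one => True
  | reg _ => True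
  | read _ i => i.Fits B σ
  | add e f => e.Fits B σ ∧ f.Fits B σ
  | sub e f => e.Fits B σ ∧ f.Fits B σ

def cost : RExpr → ℕ
  | zero => 1
  | one => 1
  | reg _ => 1
  | read _ i => i.cost + 1
  | add e f => e.cost + f.cost + 1
  | sub e f => e.cost + f.cost + 1

end RExpr

namespace BExpr

def Holds (σ : State) : BExpr → Prop
  | nle e f => e.eval σ ≤ f.eval σ
  | rle e f => e.eval σ ≤ f.eval σ
  | not b => ¬ b.Holds σ
  | and b c => b.Holds σ ∧ c.Holds σ

def Fits (B : ℕ) (σ : State) : BExpr → Prop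
  | nle e f => e.Fits B σ ∧ f.Fits B σ
  | rle e f => e.Fits B σ ∧ f.Fits B σ
  | not b => b.Fits B σ
  | and b c => b.Fits B σ ∧ c.Fits B σ

def cost : BExpr → ℕ
  | nle e f => e.cost + f.cost + 1
  | rle e f => e.cost + f.cost + 1
  | not b => b.cost + 1
  | and b c => b.cost + c.cost + 1

end BExpr

namespace State

def setN (σ : State) (x v : ℕ) : State :=
  { σ with nreg := Function.update σ.nreg x v }

noncomputable def setR (σ : State) (x : ℕ) (v : ℝ) : State :=
  { σ with rreg := Function.update σ.rreg x v }

def storeN (σ : State) (a i v : ℕ) : State :=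
  { σ with narr := Function.update σ.narr a (Function.update (σ.narr a) i v) }

noncomputable def storeR (σ : State) (a i : ℕ) (v : ℝ) : State :=
  { σ with rarr := Function.update σ.rarr a (Function.update (σ.rarr a) i v) }

end State

/-- `Exec B P σ T τ`: with words below `B`, the program `P` started in the state `σ` halts in the
state `τ` after exactly `T` steps. -/
inductive Exec (B : ℕ) : Cmd → State → ℕ → State → Prop where
  | skip (σ : State) : Exec B .skip σ 1 σ
  | setN (σ : State) (x : ℕ) (e : NExpr) (he : e.Fits B σ) :
      Exec B (.setN x e) σ (e.cost + 1) (σ.setN x (e.eval σ))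
  | setR (σ : State) (x : ℕ) (e : RExpr) (he : e.Fits B σ) :
      Exec B (.setR x e) σ (e.cost + 1) (σ.setR x (e.eval σ))
  | storeN (σ : State) (a : ℕ) (i e : NExpr) (hi : i.Fits B σ) (he : e.Fits B σ) :
      Exec B (.storeN a i e) σ (i.cost + e.cost + 1) (σ.storeN a (i.eval σ) (e.eval σ))
  | storeR (σ : State) (a : ℕ) (i : NExpr) (e : RExpr) (hi : i.Fits B σ) (he : e.Fits B σ) :
      Exec B (.storeR a i e) σ (i.cost + e.cost + 1) (σ.storeR a (i.eval σ) (e.eval σ))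
  | seq {P Q : Cmd} {σ τ υ : State} {T U : ℕ} (hP : Exec B P σ T τ) (hQ : Exec B Q τ U υ) :
      Exec B (.seq P Q) σ (T + U) υ
  | ite_true {b : BExpr} {P Q : Cmd} {σ τ : State} {T : ℕ} (hf : b.Fits B σ) (hb : b.Holds σ)
      (hP : Exec B P σ T τ) : Exec B (.ite b P Q) σ (b.cost + 1 + T) τ
  | ite_false {b : BExpr} {P Q : Cmd} {σ τ : State} {T : ℕ} (hf : b.Fits B σ) (hb : ¬ b.Holds σ)
      (hQ : Exec B Q σ T τ) : Exec B (.ite b P Q) σ (b.cost + 1 + T) τ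
  | loop_true {b : BExpr} {P : Cmd} {σ τ υ : State} {T U : ℕ} (hf : b.Fits B σ) (hb : b.Holds σ)
      (hP : Exec B P σ T τ) (hL : Exec B (.loop b P) τ U υ) :
      Exec B (.loop b P) σ (b.cost + 1 + T + U) υ
  | loop_false {b : BExpr} {P : Cmd} {σ : State} (hf : b.Fits B σ) (hb : ¬ b.Holds σ) :
      Exec B (.loop b P) σ (b.cost + 1) σ

end RAM

/-! ## Input and output conventions -/

/-- `ends` lists every link of the network exactly once, in an arbitrary order and with the two
ends of each link in an arbitrary order. In particular `m` is the number of links. -/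
structure IsLinkList {V : Type} (N : Network V) {m : ℕ} (ends : Fin m → V × V) : Prop where
  injective : Function.Injective fun i => s((ends i).1, (ends i).2)
  range_eq : Set.range (fun i => s((ends i).1, (ends i).2)) = N.graph.edgeSet

/-- The initial state. Word registers `0`-`4` hold `n`, `m`, `s`, `w`, `t`; at index `i < m` the
word arrays `0` and `1` hold the two ends, and the real arrays `0` and `1` the capacity and the
weight, of the `i`-th link. All the rest of the memory is zero. -/
noncomputable def inputState {n m : ℕ} (N : Network (Fin n)) (ends : Fin m → Fin n × Fin n)
    (s w t : Fin n) : RAM.State where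
  nreg x := match x with
    | 0 => n
    | 1 => m
    | 2 => s
    | 3 => w
    | 4 => t
    | _ => 0
  rreg _ := 0
  narr a i := if h : i < m then
      match a with
      | 0 => (ends ⟨i, h⟩).1
      | 1 => (ends ⟨i, h⟩).2
      | _ => 0
    else 0
  rarr a i := if h : i < m then
      match a with
      | 0 => N.cap s((ends ⟨i, h⟩).1, (ends ⟨i, h⟩).2)
      | 1 => N.weight s((ends ⟨i, h⟩).1, (ends ⟨i, h⟩).2)
      | _ => 0
    else 0

/-- The final state answers "no route": word register `5` holds `0`. -/
def ReportsInfeasible (σ : RAM.State) : Prop :=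
  σ.nreg 5 = 0

/-- The final state holds the route `R`: word register `5` holds `1`, word registers `6` and `7`
hold the numbers `p` and `q` of links of the two segments of `R`, and the word array `2` holds at
the indices `0, …, p + q` the nodes in the order in which `R` visits them. -/
def ReportsRoute {n : ℕ} {N : Network (Fin n)} {s w t : Fin n} (σ : RAM.State)
    (R : Route N s w t) : Prop :=
  σ.nreg 5 = 1 ∧ σ.nreg 6 = R.first.length ∧ σ.nreg 7 = R.second.length ∧
    (∀ i ≤ R.first.length, σ.narr 2 i = (R.first.getVert i : ℕ)) ∧
    ∀ i ≤ R.second.length, σ.narr 2 (R.first.length + i) = (R.second.getVert i : ℕ)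

/-- The answer to the shortest waypoint routing problem in the final state is correct. -/
def SolvesShortestRoute {n : ℕ} (N : Network (Fin n)) (s w t : Fin n) (σ : RAM.State) : Prop :=
  (∃ R : Route N s w t, R.IsShortest ∧ ReportsRoute σ R) ∨
    ((¬ ∃ R : Route N s w t, R.Feasible) ∧ ReportsInfeasible σ)

/-! Reversing the first segment of a route gives two walks that leave `w`, one ending in `s` and one
in `t`. Counting traversals turns a feasible route into an integral flow of two units out of `w`,
one to `s` and one to `t`, where the two directions of a link share its capacity and the cost of the
flow is the length of the route. Conversely, following such a flow greedily yields a route and a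
leftover circulation, whose weight is nonnegative. So a shortest route is a minimum-cost flow of
value two, and two rounds of successive shortest paths find it.

Conservation is used in dual form: `flowSum` of the flow against every potential `φ` equals `(φ s -
φ w) + (φ t - φ w)`, which needs no case distinction when `s`, `w`, `t` coincide. Optimality is
certified by a potential for which the flow minimises the reduced cost on each single link
(`PairOpt`). For a feasible flow this is equivalent to nonnegative reduced costs of the residual
arcs (`pairOpt_of_redCost_nonneg`, `redCost_nonneg`), and summing it over the links bounds the cost
of every competitor (`cost_le_of_pairOpt`).

A round runs Dijkstra's algorithm from `w` on the residual arcs. Adding the distances, capped at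
that of the target, to the potential makes the arcs of the tree path to the target have reduced cost
zero, so a unit pushed along them preserves optimality (`augment_runs`). If the target is not
reached, the reached nodes form a cut that excludes every feasible route
(`not_feasible_of_unreachable`). After two rounds, a walk against the flow from `s` can only get
stuck in `w`, and a walk along the remaining flow from `w` only in `t` (`extract_runs`); the two
form a shortest route by `exists_isShortest`.

The priority queue is a tournament of arity `d`: decreasing a key takes O(log_d n) steps and
deletion O(d log_d n), so a search takes O((n d + m) log_d n). The choice `d = m / n + 2` makes `n
d` of order `n + m`, and `add_mul_natLog_le` compares the result with the claimed bound. Programs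
are verified in a logic whose judgement `Runs` carries a step bound and a postcondition. -/

namespace RAM

/-! ## A program logic with running times -/

namespace Cmd

/-- Whether the program may write to the word register `x`. -/
def writesN (x : ℕ) : Cmd → Bool
  | setN y _ => x == y
  | seq P Q => P.writesN x || Q.writesN x
  | ite _ P Q => P.writesN x || Q.writesN x
  | loop _ P => P.writesN x
  | _ => false

/-- Whether the program may write to the word array `a`. -/
def storesN (a : ℕ) : Cmd → Bool
  | storeN b _ _ => a == b
  | seq P Q => P.storesN a || Q.storesN a
  | ite _ P Q => P.storesN a || Q.storesN a
  | loop _ P => P.storesN a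
  | _ => false

/-- Whether the program may write to the real array `a`. -/
def storesR (a : ℕ) : Cmd → Bool
  | storeR b _ _ => a == b
  | seq P Q => P.storesR a || Q.storesR a
  | ite _ P Q => P.storesR a || Q.storesR a
  | loop _ P => P.storesR a
  | _ => false

/-- An upper bound for the running time of a program without loops. -/
def maxCost : Cmd → ℕ
  | skip => 1
  | setN _ e => e.cost + 1
  | setR _ e => e.cost + 1
  | storeN _ i e => i.cost + e.cost + 1
  | storeR _ i e => i.cost + e.cost + 1
  | seq P Q => P.maxCost + Q.maxCost
  | ite b P Q => b.cost + 1 + (P.maxCost + Q.maxCost)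
  | loop _ _ => 0

/-- The weakest precondition for the program, which must be free of loops, to run without overflow
and to establish `Q`. -/
def wp (B : ℕ) : Cmd → (State → Prop) → State → Prop
  | skip, Q, σ => Q σ
  | setN x e, Q, σ => e.Fits B σ ∧ Q (σ.setN x (e.eval σ))
  | setR x e, Q, σ => e.Fits B σ ∧ Q (σ.setR x (e.eval σ))
  | storeN a i e, Q, σ => i.Fits B σ ∧ e.Fits B σ ∧ Q (σ.storeN a (i.eval σ) (e.eval σ))
  | storeR a i e, Q, σ => i.Fits B σ ∧ e.Fits B σ ∧ Q (σ.storeR a (i.eval σ) (e.eval σ))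
  | seq P R, Q, σ => P.wp B (fun τ => R.wp B Q τ) σ
  | ite b P R, Q, σ => b.Fits B σ ∧ (b.Holds σ → P.wp B Q σ) ∧ (¬ b.Holds σ → R.wp B Q σ)
  | loop _ _, _, _ => False

end Cmd

/-- The memory which `P` does not write to is the same in `σ` and `τ`. -/
structure Frame (P : Cmd) (σ τ : State) : Prop where
  nreg : ∀ x, P.writesN x = false → τ.nreg x = σ.nreg x
  narr : ∀ a, P.storesN a = false → τ.narr a = σ.narr a
  rarr : ∀ a, P.storesR a = false → τ.rarr a = σ.rarr a

theorem Frame.refl (P : Cmd) (σ : State) : Frame P σ σ :=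
  ⟨fun _ _ => rfl, fun _ _ => rfl, fun _ _ => rfl⟩

theorem Frame.trans {P : Cmd} {σ τ υ : State} (h : Frame P σ τ) (h' : Frame P τ υ) :
    Frame P σ υ :=
  ⟨fun x hx => (h'.nreg x hx).trans (h.nreg x hx), fun x hx => (h'.narr x hx).trans (h.narr x hx),
    fun x hx => (h'.rarr x hx).trans (h.rarr x hx)⟩

theorem Frame.mono {P Q : Cmd} {σ τ : State} (h : Frame P σ τ)
    (hN : ∀ x, Q.writesN x = false → P.writesN x = false)
    (hA : ∀ x, Q.storesN x = false → P.storesN x = false)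
    (hR : ∀ x, Q.storesR x = false → P.storesR x = false) : Frame Q σ τ :=
  ⟨fun x hx => h.nreg x (hN x hx), fun x hx => h.narr x (hA x hx), fun x hx => h.rarr x (hR x hx)⟩

/-- This lets specifications mention only what changes: whether a program can write somewhere is a
Boolean computed from its text, so the side conditions are later discharged by `rfl`. -/
theorem Exec.frame {B : ℕ} {P : Cmd} {σ τ : State} {T : ℕ} (h : Exec B P σ T τ) :
    Frame P σ τ := by
  induction h with
  | skip σ => exact Frame.refl _ _
  | setN σ x e he =>
    refine ⟨fun y hy => ?_, fun _ _ => rfl, fun _ _ => rfl⟩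
    simp only [Cmd.writesN, beq_eq_false_iff_ne] at hy
    simp [State.setN, Function.update_of_ne hy]
  | setR σ x e he => exact ⟨fun _ _ => rfl, fun _ _ => rfl, fun _ _ => rfl⟩
  | storeN σ a i e hi he =>
    refine ⟨fun _ _ => rfl, fun y hy => ?_, fun _ _ => rfl⟩
    simp only [Cmd.storesN, beq_eq_false_iff_ne] at hy
    simp [State.storeN, Function.update_of_ne hy]
  | storeR σ a i e hi he =>
    refine ⟨fun _ _ => rfl, fun _ _ => rfl, fun y hy => ?_⟩
    simp only [Cmd.storesR, beq_eq_false_iff_ne] at hy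
    simp [State.storeR, Function.update_of_ne hy]
  | seq _ _ ih ih' =>
    refine (ih.mono ?_ ?_ ?_).trans (ih'.mono ?_ ?_ ?_) <;>
      simp +contextual [Cmd.writesN, Cmd.storesN, Cmd.storesR]
  | ite_true _ _ _ ih =>
    refine ih.mono ?_ ?_ ?_ <;> simp +contextual [Cmd.writesN, Cmd.storesN, Cmd.storesR]
  | ite_false _ _ _ ih =>
    refine ih.mono ?_ ?_ ?_ <;> simp +contextual [Cmd.writesN, Cmd.storesN, Cmd.storesR]
  | loop_true _ _ _ _ ih ih' =>
    refine (ih.mono ?_ ?_ ?_).trans ih' <;>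
      simp +contextual [Cmd.writesN, Cmd.storesN, Cmd.storesR]
  | loop_false _ _ => exact Frame.refl _ _

/-- Started in `σ`, the program halts within `T` steps in a state which satisfies `Q`. -/
def Runs (B : ℕ) (P : Cmd) (σ : State) (T : ℕ) (Q : State → Prop) : Prop :=
  ∃ T' ≤ T, ∃ τ, Exec B P σ T' τ ∧ Q τ

namespace Runs

variable {B : ℕ} {P P' : Cmd} {b : BExpr} {σ : State} {T T' : ℕ} {Q Q' : State → Prop}

theorem mono (h : Runs B P σ T Q) (hT : T ≤ T') (hQ : ∀ τ, Frame P σ τ → Q τ → Q' τ) :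
    Runs B P σ T' Q' := by
  obtain ⟨U, hU, τ, he, hq⟩ := h
  exact ⟨U, hU.trans hT, τ, he, hQ τ he.frame hq⟩

theorem seq (h : Runs B P σ T Q) (h' : ∀ τ, Frame P σ τ → Q τ → Runs B P' τ T' Q') :
    Runs B (.seq P P') σ (T + T') Q' := by
  obtain ⟨U, hU, τ, he, hq⟩ := h
  obtain ⟨U', hU', υ, he', hq'⟩ := h' τ he.frame hq
  exact ⟨U + U', add_le_add hU hU', υ, he.seq he', hq'⟩

/-- Loop-free code is handled by unfolding `wp` and evaluating `maxCost`. The latter adds both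
branches of a conditional, so one bound serves either outcome. -/
theorem of_wp (h : P.wp B Q σ) : Runs B P σ P.maxCost Q := by
  induction P generalizing σ Q with
  | skip => exact ⟨_, le_rfl, _, .skip σ, h⟩
  | setN x e => exact ⟨_, le_rfl, _, .setN σ x e h.1, h.2⟩
  | setR x e => exact ⟨_, le_rfl, _, .setR σ x e h.1, h.2⟩
  | storeN a i e => exact ⟨_, le_rfl, _, .storeN σ a i e h.1 h.2.1, h.2.2⟩
  | storeR a i e => exact ⟨_, le_rfl, _, .storeR σ a i e h.1 h.2.1, h.2.2⟩
  | seq P R ih ih' => exact (ih h).seq fun τ _ hτ => ih' hτ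
  | ite b P R ih ih' =>
    by_cases hb : b.Holds σ
    · obtain ⟨U, hU, τ, he, hq⟩ := ih (h.2.1 hb)
      exact ⟨_, by simp only [Cmd.maxCost]; omega, τ, .ite_true h.1 hb he, hq⟩
    · obtain ⟨U, hU, τ, he, hq⟩ := ih' (h.2.2 hb)
      exact ⟨_, by simp only [Cmd.maxCost]; omega, τ, .ite_false h.1 hb he, hq⟩
  | loop b P => exact h.elim

theorem ite (hf : b.Fits B σ) (h : b.Holds σ → Runs B P σ T Q)
    (h' : ¬ b.Holds σ → Runs B P' σ T Q) : Runs B (.ite b P P') σ (b.cost + 1 + T) Q := by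
  by_cases hb : b.Holds σ
  · obtain ⟨U, hU, τ, he, hq⟩ := h hb
    exact ⟨_, by omega, τ, .ite_true hf hb he, hq⟩
  · obtain ⟨U, hU, τ, he, hq⟩ := h' hb
    exact ⟨_, by omega, τ, .ite_false hf hb he, hq⟩

/-- The loop rule: `I k τ` is an invariant, which includes that `k` further steps suffice. -/
theorem loop (I : ℕ → State → Prop)
    (hI : ∀ k τ, Frame P σ τ → I k τ → b.Fits B τ ∧
      (b.Holds τ → ∃ c, Runs B P τ c fun υ => ∃ k', b.cost + 1 + c + k' ≤ k ∧ I k' υ) ∧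
      (¬ b.Holds τ → Q τ))
    {k : ℕ} (h : I k σ) : Runs B (.loop b P) σ (k + (b.cost + 1)) Q := by
  suffices H : ∀ k τ, Frame P σ τ → I k τ → Runs B (.loop b P) τ (k + (b.cost + 1)) Q from
    H k σ (Frame.refl _ _) h
  intro k
  induction k using Nat.strong_induction_on with
  | _ k ih =>
    intro τ hF hτ
    obtain ⟨hf, ht, hq⟩ := hI k τ hF hτ
    by_cases hb : b.Holds τ
    · obtain ⟨c, U, hU, υ, he, k', hk, hυ⟩ := ht hb
      obtain ⟨U', hU', ρ, he', hq'⟩ := ih k' (by omega) υ (hF.trans he.frame) hυ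
      exact ⟨_, by omega, ρ, .loop_true hf hb he he', hq'⟩
    · exact ⟨_, by omega, τ, .loop_false hf hb, hq hb⟩

/-- The loop rule for at most `k` rounds of at most `c` steps each. -/
theorem loop_const (I : ℕ → State → Prop) (c : ℕ)
    (hI : ∀ k τ, Frame P σ τ → I k τ → b.Fits B τ ∧
      (b.Holds τ → Runs B P τ c fun υ => ∃ k', k' + 1 ≤ k ∧ I k' υ) ∧
      (¬ b.Holds τ → Q τ))
    {k : ℕ} (h : I k σ) :
    Runs B (.loop b P) σ (k * (b.cost + 1 + c) + (b.cost + 1)) Q := by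
  refine loop (fun j τ => ∃ i, i * (b.cost + 1 + c) = j ∧ I i τ) ?_ ⟨k, rfl, h⟩
  rintro _ τ hF ⟨i, rfl, hi⟩
  obtain ⟨hf, ht, hq⟩ := hI i τ hF hi
  refine ⟨hf, fun hb => ⟨c, (ht hb).mono le_rfl ?_⟩, hq⟩
  rintro υ - ⟨k', hk', h'⟩
  refine ⟨_, ?_, k', rfl, h'⟩
  calc b.cost + 1 + c + k' * (b.cost + 1 + c) = (k' + 1) * (b.cost + 1 + c) := by ring
    _ ≤ i * (b.cost + 1 + c) := Nat.mul_le_mul_right _ hk'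

end Runs

/-! ### Symbolic execution -/

namespace State

variable (σ : State) (x y a i v : ℕ) (r : ℝ)

@[simp] theorem setN_nreg : (σ.setN x v).nreg y = if y = x then v else σ.nreg y := by
  simp [setN, Function.update_apply]
@[simp] theorem setN_rreg : (σ.setN x v).rreg = σ.rreg := rfl
@[simp] theorem setN_narr : (σ.setN x v).narr = σ.narr := rfl
@[simp] theorem setN_rarr : (σ.setN x v).rarr = σ.rarr := rfl
@[simp] theorem setR_nreg : (σ.setR x r).nreg = σ.nreg := rfl
@[simp] theorem setR_rreg : (σ.setR x r).rreg y = if y = x then r else σ.rreg y := by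
  simp [setR, Function.update_apply]
@[simp] theorem setR_narr : (σ.setR x r).narr = σ.narr := rfl
@[simp] theorem setR_rarr : (σ.setR x r).rarr = σ.rarr := rfl
@[simp] theorem storeN_nreg : (σ.storeN a i v).nreg = σ.nreg := rfl
@[simp] theorem storeN_rreg : (σ.storeN a i v).rreg = σ.rreg := rfl
@[simp] theorem storeN_narr : (σ.storeN a i v).narr y =
    if y = a then Function.update (σ.narr a) i v else σ.narr y := by
  simp [storeN, Function.update_apply]
@[simp] theorem storeN_rarr : (σ.storeN a i v).rarr = σ.rarr := rfl
@[simp] theorem storeR_nreg : (σ.storeR a i r).nreg = σ.nreg := rfl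
@[simp] theorem storeR_rreg : (σ.storeR a i r).rreg = σ.rreg := rfl
@[simp] theorem storeR_narr : (σ.storeR a i r).narr = σ.narr := rfl
@[simp] theorem storeR_rarr : (σ.storeR a i r).rarr y =
    if y = a then Function.update (σ.rarr a) i r else σ.rarr y := by
  simp [storeR, Function.update_apply]

end State

attribute [simp] NExpr.eval NExpr.Fits RExpr.eval RExpr.Fits BExpr.Holds BExpr.Fits Cmd.wp

/-! ## The priority queue

The queue is a tournament on the nodes `0, …, n - 1`, arranged as a tree in which `x / d` is the
parent of `x`. Word array `12` holds `0` at the nodes in the queue, real array `3` the keys, and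
word array `14` holds at `x` a node with least key among the nodes below `x`. -/

/-- `y` is `x` or one of its ancestors. -/
def Anc (d y x : ℕ) : Prop := ∃ j, x / d ^ j = y

theorem Anc.refl (d x : ℕ) : Anc d x x := ⟨0, by simp⟩

theorem Anc.eq_or {d y x : ℕ} (h : Anc d y x) : y = x ∨ Anc d y (x / d) := by
  obtain ⟨j, hj⟩ := h
  cases j with
  | zero => left; simpa using hj.symm
  | succ j => right; exact ⟨j, by rw [← hj, pow_succ', Nat.div_div_eq_div_mul]⟩

theorem Anc.parent {d y x : ℕ} (h : Anc d y x) : Anc d (y / d) x := by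
  obtain ⟨j, hj⟩ := h
  exact ⟨j + 1, by rw [pow_succ, ← Nat.div_div_eq_div_mul, hj]⟩

theorem Anc.zero {d y : ℕ} (h : Anc d y 0) : y = 0 := by
  obtain ⟨j, hj⟩ := h
  simpa using hj.symm

/-- The key of a node, infinite if the node is not in the queue. -/
noncomputable def key (q : ℕ → ℕ) (dist : ℕ → ℝ) (v : ℕ) : WithTop ℝ :=
  if q v = 0 then (dist v : WithTop ℝ) else ⊤

/-- The tournament is valid, except possibly at the nodes in `X`. -/
structure Tour (n d : ℕ) (q : ℕ → ℕ) (dist : ℕ → ℝ) (best : ℕ → ℕ) (X : ℕ → Prop) : Prop where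
  lt : ∀ x < n, best x < n
  anc : ∀ x < n, Anc d x (best x)
  own : ∀ x < n, ¬ X x → key q dist (best x) ≤ key q dist x
  child : ∀ c < n, ¬ X (c / d) → key q dist (best (c / d)) ≤ key q dist (best c)

/-- The winner at position `v` beats `v` itself, and winners only improve on the way from `v`
through `v / d` up to the root. -/
theorem Tour.root_le {n d : ℕ} {q : ℕ → ℕ} {dist : ℕ → ℝ} {best : ℕ → ℕ} (hd : 2 ≤ d)
    (h : Tour n d q dist best fun _ => False) {v : ℕ} (hv : v < n) :
    key q dist (best 0) ≤ key q dist v := by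
  refine le_trans ?_ (h.own v hv id)
  induction v using Nat.strong_induction_on with
  | _ v ih =>
    rcases Nat.eq_zero_or_pos v with rfl | hpos
    · exact le_rfl
    · have hlt : v / d < v := Nat.div_lt_self hpos (by omega)
      exact (ih _ hlt (hlt.trans hv)).trans (h.child v hv id)

theorem Tour.mono {n d : ℕ} {q : ℕ → ℕ} {dist : ℕ → ℝ} {best : ℕ → ℕ} {X Y : ℕ → Prop}
    (h : Tour n d q dist best X) (hXY : ∀ y, X y → Y y) : Tour n d q dist best Y :=
  ⟨h.lt, h.anc, fun x hx hX => h.own x hx fun h' => hX (hXY _ h'),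
    fun x hx hX => h.child x hx fun hx => hX (hXY _ hx)⟩

/-- After `v` is removed, the tournament is valid except at the ancestors of `v`. -/
theorem Tour.remove {n d : ℕ} {q : ℕ → ℕ} {dist : ℕ → ℝ} {best : ℕ → ℕ}
    (h : Tour n d q dist best fun _ => False) (v : ℕ) :
    Tour n d (Function.update q v 1) dist best (Anc d · v) := by
  have hk : ∀ x, x ≠ v → key (Function.update q v 1) dist x = key q dist x := fun x hx => by
    simp [key, Function.update_of_ne hx]
  -- A winner lies below its position, so `v` wins only at its own ancestors; elsewhere the removal
  -- changes no key that matters.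
  have hb : ∀ x < n, ¬ Anc d x v → best x ≠ v := fun x hx hX e => hX (e ▸ h.anc x hx)
  refine ⟨h.lt, h.anc, fun x hx hX => ?_, fun c hc hX => ?_⟩
  · rw [hk _ (hb x hx hX), hk x fun e => hX (e ▸ Anc.refl _ _)]
    exact h.own x hx id
  · have hc' : ¬ Anc d c v := fun e => hX e.parent
    rw [hk _ (hb c hc hc'), hk _ (hb _ ((Nat.div_le_self _ _).trans_lt hc) hX)]
    exact h.child c hc id

/-- One step of a climb: correcting the winner at `x` leaves only the ancestors of the parent in
doubt. The root is its own parent, as `0 / d = 0`; hence `c ≠ x` among the children, and hence `y ≠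
x`, which at `x = 0` leaves nothing in doubt. -/
theorem Tour.setBest {n d : ℕ} {q : ℕ → ℕ} {dist : ℕ → ℝ} {best : ℕ → ℕ} {x b : ℕ}
    (h : Tour n d q dist best (Anc d · x)) (hb : b < n) (hxb : Anc d x b)
    (hown : key q dist b ≤ key q dist x)
    (hchild : ∀ c < n, c ≠ x → c / d = x → key q dist b ≤ key q dist (best c)) :
    Tour n d q dist (Function.update best x b) fun y => y ≠ x ∧ Anc d y (x / d) := by
  have hX : ∀ y, y ≠ x → ¬ (y ≠ x ∧ Anc d y (x / d)) → ¬ Anc d y x := fun y hy hn ha =>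
    hn ⟨hy, ha.eq_or.resolve_left hy⟩
  refine ⟨fun y hy => ?_, fun y hy => ?_, fun y hy hn => ?_, fun c hc hn => ?_⟩
  · by_cases e : y = x
    · simpa [e] using hb
    · simpa [e] using h.lt y hy
  · by_cases e : y = x
    · simpa [e] using hxb
    · simpa [e] using h.anc y hy
  · by_cases e : y = x
    · simpa [e] using hown
    · simpa [e] using h.own y hy (hX y e hn)
  · by_cases e : c / d = x
    · by_cases e' : c = x
      · subst e'; rw [e]
      · simpa [e, e'] using hchild c hc e' e
    · have hn' := hX _ e hn
      have e' : c ≠ x := by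
        rintro rfl
        exact hn' (Anc.refl _ _).parent
      simpa [e, e'] using h.child c hc hn'

/-- The state of the tournament while the key of `v` has decreased and only the ancestors of `v`
below `x` have been updated. -/
structure TourDecrease (n d : ℕ) (q : ℕ → ℕ) (dist : ℕ → ℝ) (best : ℕ → ℕ) (v x : ℕ) : Prop where
  tour : Tour n d q dist best (Anc d · x)
  own : ∀ y < n, y ≠ v → key q dist (best y) ≤ key q dist y
  child : ∀ c < n, best c ≠ v → key q dist (best (c / d)) ≤ key q dist (best c)

/-- An inequality between keys can fail only if its right-hand side is the key of `v`, and this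
happens only at ancestors of `v`. Insertion is the case in which the old key is `⊤`. -/
theorem Tour.decrease {n d : ℕ} {q : ℕ → ℕ} {dist : ℕ → ℝ} {best : ℕ → ℕ}
    (h : Tour n d q dist best fun _ => False) (v : ℕ) (r : ℝ)
    (hr : (r : WithTop ℝ) ≤ key q dist v) :
    TourDecrease n d (Function.update q v 0) (Function.update dist v r) best v v := by
  set q' := Function.update q v 0
  set dist' := Function.update dist v r
  have hk : ∀ x, x ≠ v → key q' dist' x = key q dist x := fun x hx => by
    simp [key, q', dist', Function.update_of_ne hx]
  have hv : key q' dist' v = r := by simp [key, q', dist']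
  have hle : ∀ x, key q' dist' x ≤ key q dist x := fun x => by
    by_cases e : x = v
    · rw [e, hv]; exact hr
    · exact (hk x e).le
  have hown : ∀ y < n, y ≠ v → key q' dist' (best y) ≤ key q' dist' y := fun y hy e =>
    (hle _).trans ((h.own y hy id).trans (hk y e).ge)
  have hchild : ∀ c < n, best c ≠ v → key q' dist' (best (c / d)) ≤ key q' dist' (best c) :=
    fun c hc e => (hle _).trans ((h.child c hc id).trans (hk _ e).ge)
  refine ⟨⟨h.lt, h.anc, fun x hx hX => ?_, fun c hc hX => ?_⟩, hown, hchild⟩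
  · exact hown x hx fun e => hX (e ▸ Anc.refl _ _)
  · exact hchild c hc fun e => hX (Anc.parent (e ▸ h.anc c hc))

/-- After a decrease the winner at an ancestor of `v` is the old one or `v`, so the children need
not be inspected: a decrease costs one comparison per level. -/
theorem TourDecrease.setBest {n d : ℕ} {q : ℕ → ℕ} {dist : ℕ → ℝ} {best : ℕ → ℕ} {v x b : ℕ}
    (h : TourDecrease n d q dist best v x) (hx : x < n) (hv : v < n) (hxv : Anc d x v)
    (hb : b = v ∧ key q dist v ≤ key q dist (best x) ∨
      b = best x ∧ key q dist (best x) ≤ key q dist v) :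
    Tour n d q dist (Function.update best x b) (fun y => y ≠ x ∧ Anc d y (x / d)) ∧
    TourDecrease n d q dist (Function.update best x b) v (x / d) := by
  have hbv : key q dist b ≤ key q dist v := by
    rcases hb with ⟨rfl, -⟩ | ⟨rfl, hb⟩
    exacts [le_rfl, hb]
  have hbx : key q dist b ≤ key q dist (best x) := by
    rcases hb with ⟨rfl, hb⟩ | ⟨rfl, hb⟩
    exacts [hb, le_rfl]
  have hbn : b < n := by
    rcases hb with ⟨rfl, -⟩ | ⟨rfl, -⟩
    exacts [hv, h.tour.lt x hx]
  have hxb : Anc d x b := by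
    rcases hb with ⟨rfl, -⟩ | ⟨rfl, -⟩
    exacts [hxv, h.tour.anc x hx]
  have hown : key q dist b ≤ key q dist x := by
    by_cases e : x = v
    · rw [e]; exact hbv
    · exact hbx.trans (h.own x hx e)
  have hT := h.tour.setBest hbn hxb hown (fun c hc _ e => by
    by_cases e' : best c = v
    · rw [e']; exact hbv
    · exact hbx.trans (e ▸ h.child c hc e'))
  refine ⟨hT, hT.mono fun y hy => hy.2, fun y hy e => ?_, fun c hc e => ?_⟩
  · by_cases e' : y = x
    · simpa [e'] using hown
    · simpa [e'] using h.own y hy e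
  · have hle : ∀ y, key q dist (Function.update best x b y) ≤ key q dist (best y) := fun y => by
      by_cases e : y = x
      · simpa [e] using hbx
      · simp [e]
    by_cases e' : c = x
    · subst e'
      simp only [Function.update_self] at e
      have hb' : b = best c := by
        rcases hb with ⟨rfl, -⟩ | ⟨rfl, -⟩
        exacts [absurd rfl e, rfl]
      rw [Function.update_self]
      subst hb'
      exact (hle _).trans (h.child c hc e)
    · rw [Function.update_of_ne e'] at e ⊢
      exact (hle _).trans (h.child c hc e)

/-- Tests whether the key of `x` is at most that of `y`. -/
def keyLe (x y : NExpr) : BExpr :=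
  .not (.and (.nle (.read 12 y) (.lit 0))
    (.not (.and (.nle (.read 12 x) (.lit 0)) (.rle (.read 3 x) (.read 3 y)))))

theorem keyLe_holds (σ : State) (x y : NExpr) : (keyLe x y).Holds σ ↔
    key (σ.narr 12) (σ.rarr 3) (x.eval σ) ≤ key (σ.narr 12) (σ.rarr 3) (y.eval σ) := by
  simp only [keyLe, BExpr.Holds, NExpr.eval, RExpr.eval, key, Nat.le_zero]
  split_ifs <;> simp [*]

/-- Enters the node in register `13` into the tournament at the node in register `14`. -/
def bubbleStep : Cmd :=
  .ite (keyLe (.reg 13) (.read 14 (.reg 14))) (.storeN 14 (.reg 14) (.reg 13)) .skip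

/-- Restores the tournament after the key of the node in register `13` has decreased. -/
def bubble : Cmd :=
  .seq (.setN 14 (.reg 13)) <|
  .seq (.loop (.nle (.lit 1) (.reg 14)) (.seq bubbleStep (.setN 14 (.div (.reg 14) (.reg 9)))))
    bubbleStep

/-- Recomputes the winner at the node in register `14`. -/
def rebuildStep : Cmd :=
  .seq (.setN 16 (.reg 14)) <|
  .seq (.setN 15 (.mul (.reg 9) (.reg 14))) <|
  .seq (.loop (.and (.nle (.add (.reg 15) (.lit 1)) (.add (.mul (.reg 9) (.reg 14)) (.reg 9)))
        (.nle (.add (.reg 15) (.lit 1)) (.reg 0)))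
      (.seq (.ite (keyLe (.read 14 (.reg 15)) (.reg 16)) (.setN 16 (.read 14 (.reg 15))) .skip)
        (.setN 15 (.add (.reg 15) (.lit 1)))))
    (.storeN 14 (.reg 14) (.reg 16))

/-- Restores the tournament after the node in register `11` has left the queue. -/
def rebuild : Cmd :=
  .seq (.setN 14 (.reg 11)) <|
  .seq (.loop (.nle (.lit 1) (.reg 14)) (.seq rebuildStep (.setN 14 (.div (.reg 14) (.reg 9)))))
    rebuildStep

/-- The registers `0` and `9` hold the number of nodes and the arity of the tournament, and words
are large enough. -/
structure QueueRegs (B n d : ℕ) (σ : State) : Prop where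
  n_eq : σ.nreg 0 = n
  d_eq : σ.nreg 9 = d
  two_le : 2 ≤ d
  lt : n + d * n + d + 2 < B
  q_le : ∀ v < n, σ.narr 12 v ≤ 1

theorem QueueRegs.of_frame {B n d : ℕ} {P : Cmd} {σ τ : State} (h : QueueRegs B n d σ)
    (hF : Frame P σ τ) (h0 : P.writesN 0 = false) (h9 : P.writesN 9 = false)
    (h12 : P.storesN 12 = false) : QueueRegs B n d τ :=
  ⟨(hF.nreg _ h0).trans h.n_eq, (hF.nreg _ h9).trans h.d_eq, h.two_le, h.lt, by
    rw [hF.narr _ h12]; exact h.q_le⟩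

/-! ### Correctness and cost of the queue operations -/

theorem keyLe_fits {B n d : ℕ} {σ : State} (h : QueueRegs B n d σ) {x y : NExpr}
    (hx : x.Fits B σ) (hy : y.Fits B σ) (hxn : x.eval σ < n) (hyn : y.eval σ < n) :
    (keyLe x y).Fits B σ := by
  have h1 := h.q_le _ hxn
  have h2 := h.q_le _ hyn
  have h3 := h.lt
  simp only [keyLe, BExpr.Fits, NExpr.Fits, RExpr.Fits]
  refine ⟨⟨⟨hy, ?_⟩, ?_⟩, ⟨⟨hx, ?_⟩, ?_⟩, hx, hy⟩ <;> omega

theorem bubbleStep_runs {B n d v x : ℕ} {σ : State} (hq : QueueRegs B n d σ) (hv : v < n)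
    (hx : x < n) (h13 : σ.nreg 13 = v) (h14 : σ.nreg 14 = x) (hxv : Anc d x v)
    (h : TourDecrease n d (σ.narr 12) (σ.rarr 3) (σ.narr 14) v x) :
    Runs B bubbleStep σ bubbleStep.maxCost fun τ =>
      Tour n d (σ.narr 12) (σ.rarr 3) (τ.narr 14) (fun y => y ≠ x ∧ Anc d y (x / d)) ∧
      TourDecrease n d (σ.narr 12) (σ.rarr 3) (τ.narr 14) v (x / d) := by
  have hlt := hq.lt
  have hbx := h.tour.lt x hx
  apply Runs.of_wp
  simp only [bubbleStep, Cmd.wp, keyLe_holds, NExpr.eval, NExpr.Fits, State.storeN_narr, if_true,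
    h13, h14]
  refine ⟨keyLe_fits hq (by simp; omega) (by simp [h14]; omega) (by simpa [h13])
    (by simpa [h14]), fun hle => ⟨by omega, by omega, ?_⟩, fun hle => ?_⟩
  · exact h.setBest hx hv hxv (.inl ⟨rfl, hle⟩)
  · simpa using h.setBest hx hv hxv (.inr ⟨rfl, (not_le.1 hle).le⟩)

/-- The number of steps to climb to the root of the tournament. -/
def height (d n : ℕ) : ℕ := Nat.log d n + 1

theorem bubble_runs {B n d v : ℕ} {σ : State} (hq : QueueRegs B n d σ) (hv : v < n)
    (h13 : σ.nreg 13 = v) (h : TourDecrease n d (σ.narr 12) (σ.rarr 3) (σ.narr 14) v v) :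
    Runs B bubble σ (100 * (height d n + 1)) fun τ =>
      Tour n d (σ.narr 12) (σ.rarr 3) (τ.narr 14) fun _ => False := by
  have hlt := hq.lt
  have hd := hq.two_le
  have hlog : v < d ^ height d n := hv.trans (Nat.lt_pow_succ_log_self (by omega) n)
  refine Runs.mono (Runs.seq (Runs.of_wp (Q := fun τ => τ = σ.setN 14 v) ?_) fun τ hF hτ =>
    -- A position below `d ^ k` reaches the root after at most `k` divisions by `d`; this bounds the
    -- remaining rounds.
    Runs.seq (Runs.loop_const (fun k τ => τ.nreg 14 < d ^ k ∧ τ.nreg 14 < n ∧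
        Anc d (τ.nreg 14) v ∧
        TourDecrease n d (σ.narr 12) (σ.rarr 3) (τ.narr 14) v (τ.nreg 14))
      (Q := fun τ => τ.nreg 14 = 0 ∧ TourDecrease n d (σ.narr 12) (σ.rarr 3) (τ.narr 14) v 0)
      (bubbleStep.maxCost + 4) (k := height d n) ?_ ?_)
      (Q' := fun τ => Tour n d (σ.narr 12) (σ.rarr 3) (τ.narr 14) fun _ => False)
      (T' := bubbleStep.maxCost) ?_) ?_ ?_
  · simp [h13]; omega
  · rintro k ρ hρ ⟨hk, hn, ha, hT⟩
    subst hτ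
    have e12 : ρ.narr 12 = σ.narr 12 := by rw [hρ.narr 12 rfl]; rfl
    have e3 : ρ.rarr 3 = σ.rarr 3 := by rw [hρ.rarr 3 rfl]; rfl
    have hqρ : QueueRegs B n d ρ :=
      (hq.of_frame (hF) rfl rfl rfl).of_frame hρ rfl rfl rfl
    refine ⟨by simp; omega, fun hb => ?_, fun hb => ?_⟩
    · simp only [BExpr.Holds, NExpr.eval] at hb
      refine Runs.mono (Runs.seq (bubbleStep_runs hqρ hv hn ?_ rfl ha (by rwa [e12, e3]))
        (T' := 4) (Q' := fun τ => ∃ k', k' + 1 ≤ k ∧ τ.nreg 14 < d ^ k' ∧ τ.nreg 14 < n ∧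
        Anc d (τ.nreg 14) v ∧
        TourDecrease n d (σ.narr 12) (σ.rarr 3) (τ.narr 14) v (τ.nreg 14))
        fun υ hυ ⟨_, hT'⟩ => Runs.of_wp ?_) le_rfl (fun _ _ h => h)
      · rw [hρ.nreg 13 rfl]; simpa using h13
      · have e14 : υ.nreg 14 = ρ.nreg 14 := hυ.nreg 14 rfl
        have e9 : υ.nreg 9 = d := by rw [hυ.nreg 9 rfl]; exact hqρ.d_eq
        obtain ⟨k, rfl⟩ : ∃ j, k = j + 1 := by
          cases k with
          | zero => simp at hk; omega
          | succ j => exact ⟨j, rfl⟩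
        simp only [Cmd.wp, NExpr.Fits, NExpr.eval, e14, e9, State.setN_nreg, if_true,
          State.setN_narr]
        refine ⟨⟨by omega, by omega⟩, k, le_rfl, ?_, ?_, ha.parent, ?_⟩
        · rw [Nat.div_lt_iff_lt_mul (by omega)]; rwa [pow_succ] at hk
        · exact (Nat.div_le_self _ _).trans_lt hn
        · rwa [e12, e3] at hT'
    · simp only [BExpr.Holds, NExpr.eval] at hb
      have h0 : ρ.nreg 14 = 0 := by omega
      exact ⟨h0, by rwa [h0] at hT⟩
  · subst hτ
    exact ⟨by simpa using hlog, by simpa using hv, by simpa using Anc.refl _ _, by simpa using h⟩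
  · rintro ρ hρ ⟨h0, hT⟩
    subst hτ
    have e12 : ρ.narr 12 = σ.narr 12 := by rw [hρ.narr 12 rfl]; rfl
    have e3 : ρ.rarr 3 = σ.rarr 3 := by rw [hρ.rarr 3 rfl]; rfl
    have hqρ : QueueRegs B n d ρ :=
      (hq.of_frame (hF) rfl rfl rfl).of_frame hρ rfl rfl rfl
    -- The loop stops on arrival at the root, which is treated by the separate last step.
    have hz : Anc d 0 v := ⟨height d n, Nat.div_eq_of_lt hlog⟩
    refine (bubbleStep_runs hqρ hv (by omega) ?_ h0 hz (by rwa [e12, e3])).mono le_rfl ?_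
    · rw [hρ.nreg 13 rfl]; simpa using h13
    · rintro υ - ⟨hT', -⟩
      rw [e12, e3] at hT'
      exact hT'.mono fun y hy => hy.1 (Anc.zero (by simpa using hy.2))
  · simp only [bubbleStep, keyLe, Cmd.maxCost, BExpr.cost, NExpr.cost, RExpr.cost]
    omega
  · exact fun _ _ h => h

theorem rebuildStep_runs {B n d x : ℕ} {σ : State} (hq : QueueRegs B n d σ)
    (hx : x < n) (h14 : σ.nreg 14 = x)
    (h : Tour n d (σ.narr 12) (σ.rarr 3) (σ.narr 14) (Anc d · x)) :
    Runs B rebuildStep σ (100 * (d + 1)) fun τ =>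
      Tour n d (σ.narr 12) (σ.rarr 3) (τ.narr 14) fun y => y ≠ x ∧ Anc d y (x / d) := by
  have hlt := hq.lt
  have hd := hq.two_le
  have hdx : d * x ≤ d * n := Nat.mul_le_mul_left _ hx.le
  have e0 := hq.n_eq
  have e9 := hq.d_eq
  refine Runs.mono (Runs.seq (Runs.of_wp (Q := fun τ => τ = σ.setN 16 x) ?_) fun τ hF hτ =>
    Runs.seq (Runs.of_wp (Q := fun τ => τ = (σ.setN 16 x).setN 15 (d * x)) ?_) fun τ' hF' hτ' =>
    -- The children of `x` are the positions from `d * x` to `d * x + d - 1`. For `x = 0` this range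
    -- contains `0` itself, whose outdated winner is merely one more candidate with its current key.
    Runs.seq (Runs.loop_const (fun k ρ => ∃ c b, ρ.nreg 15 = c ∧ ρ.nreg 16 = b ∧
        c + k = d * x + d ∧ d * x ≤ c ∧ b < n ∧ Anc d x b ∧
        key (σ.narr 12) (σ.rarr 3) b ≤ key (σ.narr 12) (σ.rarr 3) x ∧
        ∀ c' < c, d * x ≤ c' → c' < n →
          key (σ.narr 12) (σ.rarr 3) b ≤ key (σ.narr 12) (σ.rarr 3) (σ.narr 14 c'))
      (Q := fun ρ => ∃ b, ρ.nreg 16 = b ∧ b < n ∧ Anc d x b ∧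
        key (σ.narr 12) (σ.rarr 3) b ≤ key (σ.narr 12) (σ.rarr 3) x ∧
        ∀ c' < n, c' / d = x →
          key (σ.narr 12) (σ.rarr 3) b ≤ key (σ.narr 12) (σ.rarr 3) (σ.narr 14 c'))
      40 (k := d) ?_ ?_) (T' := 3) (Q' := fun τ =>
      Tour n d (σ.narr 12) (σ.rarr 3) (τ.narr 14) fun y => y ≠ x ∧ Anc d y (x / d)) ?_) ?_ ?_
  · simp [h14]; omega
  · subst hτ; simp [h14, e9]; omega
  · rintro k ρ hρ ⟨c, b, hc, hb, hck, hcl, hbn, hxb, hbx, hbc⟩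
    subst hτ'
    have e12 : ρ.narr 12 = σ.narr 12 := by rw [hρ.narr 12 rfl]; rfl
    have e14 : ρ.narr 14 = σ.narr 14 := by rw [hρ.narr 14 rfl]; rfl
    have e3 : ρ.rarr 3 = σ.rarr 3 := by rw [hρ.rarr 3 rfl]; rfl
    have r0 : ρ.nreg 0 = n := by rw [hρ.nreg 0 rfl]; simpa using e0
    have r9 : ρ.nreg 9 = d := by rw [hρ.nreg 9 rfl]; simpa using e9
    have r14 : ρ.nreg 14 = x := by rw [hρ.nreg 14 rfl]; simpa using h14
    have hqρ : QueueRegs B n d ρ := ⟨r0, r9, hd, hlt, by rw [e12]; exact hq.q_le⟩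
    refine ⟨?_, fun hh => ?_, fun hh => ?_⟩
    · simp [r0, r9, r14, hc]; omega
    · simp only [BExpr.Holds, NExpr.eval, r0, r9, r14, hc] at hh
      have hcn : c < n := hh.2
      have hcd : c < d * x + d := hh.1
      have hlt14 := h.lt c hcn
      have hdiv : c / d = x := by
        rw [Nat.div_eq_iff (by omega), mul_comm x d]; omega
      refine (Runs.of_wp (P := Cmd.seq _ _) ?_).mono (Q := fun υ => _)
        (show Cmd.maxCost _ ≤ 40 by decide) (fun _ _ h => h)
      simp only [Cmd.wp, keyLe_holds, NExpr.eval, NExpr.Fits, State.setN_nreg, hc, hb, e12, e14,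
        e3]
      refine ⟨keyLe_fits hqρ ?_ ?_ ?_ ?_, fun hle => ⟨⟨?_, ?_⟩, ⟨?_, ?_, ?_⟩, ?_⟩,
        fun hle => ⟨⟨?_, ?_, ?_⟩, ?_⟩⟩
      · simp [hc, e14]; omega
      · simp [hb]; omega
      · simpa [hc, e14]
      · simpa [hb]
      · omega
      · omega
      · simp; omega
      · omega
      · simp; omega
      · refine ⟨k - 1, by omega, c + 1, σ.narr 14 c, by simp, by simp, by omega, by omega, hlt14,
          hdiv ▸ (h.anc c hcn).parent, hle.trans hbx, fun c' h1 h2 h3 => ?_⟩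
        rcases Nat.lt_succ_iff_lt_or_eq.1 h1 with h1 | rfl
        · exact hle.trans (hbc c' h1 h2 h3)
        · exact le_rfl
      · omega
      · omega
      · omega
      · refine ⟨k - 1, by omega, c + 1, b, by simp, by simp, by omega, by omega, hbn,
          hxb, hbx, fun c' h1 h2 h3 => ?_⟩
        rcases Nat.lt_succ_iff_lt_or_eq.1 h1 with h1 | rfl
        · exact hbc c' h1 h2 h3
        · exact (not_le.1 hle).le
    · simp only [BExpr.Holds, NExpr.eval, r0, r9, r14, hc] at hh
      refine ⟨b, hb, hbn, hxb, hbx, fun c' h1 h2 => hbc c' ?_ ?_ h1⟩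
      · rw [Nat.div_eq_iff (by omega), mul_comm x d] at h2; omega
      · rw [Nat.div_eq_iff (by omega), mul_comm x d] at h2; omega
  · subst hτ'
    exact ⟨d * x, x, by simp, by simp, rfl, le_rfl, hx, Anc.refl _ _, le_rfl,
      fun c' h1 h2 => by omega⟩
  · rintro ρ hρ ⟨b, hb, hbn, hxb, hbx, hbc⟩
    subst hτ'
    have e14 : ρ.narr 14 = σ.narr 14 := by rw [hρ.narr 14 rfl]; rfl
    have r14 : ρ.nreg 14 = x := by rw [hρ.nreg 14 rfl]; simpa using h14
    refine Runs.of_wp ?_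
    simp only [Cmd.wp, NExpr.Fits, NExpr.eval, r14, hb, State.storeN_narr, if_true, e14]
    exact ⟨by omega, by omega, h.setBest hbn hxb hbx fun c hc _ => hbc c hc⟩
  · simp only [Cmd.maxCost, BExpr.cost, NExpr.cost]
    omega
  · exact fun _ _ h => h

theorem rebuild_runs {B n d u : ℕ} {σ : State} (hq : QueueRegs B n d σ) (hu : u < n)
    (h11 : σ.nreg 11 = u) (h : Tour n d (σ.narr 12) (σ.rarr 3) (σ.narr 14) (Anc d · u)) :
    Runs B rebuild σ (200 * (d + 1) * (height d n + 1)) fun τ =>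
      Tour n d (σ.narr 12) (σ.rarr 3) (τ.narr 14) fun _ => False := by
  have hlt := hq.lt
  have hd := hq.two_le
  have hlog : u < d ^ height d n := hu.trans (Nat.lt_pow_succ_log_self (by omega) n)
  refine Runs.mono (Runs.seq (Runs.of_wp (Q := fun τ => τ = σ.setN 14 u) ?_) fun τ hF hτ =>
    Runs.seq (Runs.loop_const (fun k τ => τ.nreg 14 < d ^ k ∧ τ.nreg 14 < n ∧
        Tour n d (σ.narr 12) (σ.rarr 3) (τ.narr 14) (Anc d · (τ.nreg 14)))
      (Q := fun τ => τ.nreg 14 = 0 ∧ Tour n d (σ.narr 12) (σ.rarr 3) (τ.narr 14) (Anc d · 0))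
      (100 * (d + 1) + 4) (k := height d n) ?_ ?_)
      (Q' := fun τ => Tour n d (σ.narr 12) (σ.rarr 3) (τ.narr 14) fun _ => False)
      (T' := 100 * (d + 1)) ?_) ?_ ?_
  · simp [h11]; omega
  · rintro k ρ hρ ⟨hk, hn, hT⟩
    subst hτ
    have e12 : ρ.narr 12 = σ.narr 12 := by rw [hρ.narr 12 rfl]; rfl
    have e3 : ρ.rarr 3 = σ.rarr 3 := by rw [hρ.rarr 3 rfl]; rfl
    have hqρ : QueueRegs B n d ρ :=
      (hq.of_frame (hF) rfl rfl rfl).of_frame hρ rfl rfl rfl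
    refine ⟨by simp; omega, fun hb => ?_, fun hb => ?_⟩
    · simp only [BExpr.Holds, NExpr.eval] at hb
      refine Runs.mono (Runs.seq (rebuildStep_runs hqρ hn rfl (by rwa [e12, e3]))
        (T' := 4) (Q' := fun τ => ∃ k', k' + 1 ≤ k ∧ τ.nreg 14 < d ^ k' ∧ τ.nreg 14 < n ∧
        Tour n d (σ.narr 12) (σ.rarr 3) (τ.narr 14) (Anc d · (τ.nreg 14)))
        fun υ hυ hT' => Runs.of_wp ?_) le_rfl (fun _ _ h => h)
      have e14 : υ.nreg 14 = ρ.nreg 14 := hυ.nreg 14 rfl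
      have e9 : υ.nreg 9 = d := by rw [hυ.nreg 9 rfl]; exact hqρ.d_eq
      obtain ⟨k, rfl⟩ : ∃ j, k = j + 1 := by
        cases k with
        | zero => simp at hk; omega
        | succ j => exact ⟨j, rfl⟩
      simp only [Cmd.wp, NExpr.Fits, NExpr.eval, e14, e9, State.setN_nreg, if_true,
        State.setN_narr]
      refine ⟨⟨by omega, by omega⟩, k, le_rfl, ?_, ?_, ?_⟩
      · rw [Nat.div_lt_iff_lt_mul (by omega)]; rwa [pow_succ] at hk
      · exact (Nat.div_le_self _ _).trans_lt hn
      · rw [e12, e3] at hT'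
        exact hT'.mono fun y hy => hy.2
    · simp only [BExpr.Holds, NExpr.eval] at hb
      have h0 : ρ.nreg 14 = 0 := by omega
      exact ⟨h0, by rwa [h0] at hT⟩
  · subst hτ
    exact ⟨by simpa using hlog, by simpa using hu, by simpa using h⟩
  · rintro ρ hρ ⟨h0, hT⟩
    subst hτ
    have e12 : ρ.narr 12 = σ.narr 12 := by rw [hρ.narr 12 rfl]; rfl
    have e3 : ρ.rarr 3 = σ.rarr 3 := by rw [hρ.rarr 3 rfl]; rfl
    have hqρ : QueueRegs B n d ρ :=
      (hq.of_frame (hF) rfl rfl rfl).of_frame hρ rfl rfl rfl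
    refine (rebuildStep_runs hqρ (by omega) h0 (by rwa [e12, e3])).mono le_rfl ?_
    rintro υ - hT'
    rw [e12, e3] at hT'
    exact hT'.mono fun y hy => hy.1 (Anc.zero (by simpa using hy.2))
  · simp only [Cmd.maxCost, BExpr.cost, NExpr.cost]
    nlinarith
  · exact fun _ _ h => h

/-! ## Shortest paths -/

/-- One more than the last arc before `k` with tail `v`, or `0` if there is none. The arcs with a
given tail form a linked list in this way. -/
def lastArc (tl : ℕ → ℕ) (v : ℕ) : ℕ → ℕ
  | 0 => 0
  | k + 1 => if tl k = v then k + 1 else lastArc tl v k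

theorem lastArc_le (tl : ℕ → ℕ) (v k : ℕ) : lastArc tl v k ≤ k := by
  induction k with
  | zero => exact le_rfl
  | succ k ih => simp only [lastArc]; split_ifs <;> omega

theorem tl_of_lastArc {tl : ℕ → ℕ} {v k p : ℕ} (h : lastArc tl v k = p + 1) : tl p = v := by
  induction k with
  | zero => simp [lastArc] at h
  | succ k ih =>
    simp only [lastArc] at h
    split_ifs at h with hk
    · obtain rfl : k = p := by omega
      exact hk
    · exact ih h

theorem tl_ne_of_lastArc_le {tl : ℕ → ℕ} {v k a : ℕ} (ha : a < k) (h : lastArc tl v k ≤ a) :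
    tl a ≠ v := by
  induction k with
  | zero => omega
  | succ k ih =>
    simp only [lastArc] at h
    split_ifs at h with hk
    · omega
    · rcases Nat.lt_succ_iff_lt_or_eq.1 ha with ha | rfl
      · exact ih ha h
      · exact hk

/-- The number of arcs before `p` with tail `u`. -/
def numArcs (tl : ℕ → ℕ) (u p : ℕ) : ℕ := ((Finset.range p).filter fun a => tl a = u).card

theorem numArcs_mono (tl : ℕ → ℕ) (u : ℕ) {p p' : ℕ} (h : p ≤ p') :
    numArcs tl u p ≤ numArcs tl u p' :=
  Finset.card_le_card (Finset.filter_subset_filter _ (Finset.range_subset_range.2 h))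

/-- Each step along the linked list uses up at least one arc with tail `u`; this measure bounds the
length of a scan. -/
theorem numArcs_lastArc {tl : ℕ → ℕ} {u p : ℕ} (h : tl p = u) :
    numArcs tl u (lastArc tl u p) + 1 ≤ numArcs tl u (p + 1) := by
  have h1 : numArcs tl u (p + 1) = numArcs tl u p + 1 := by
    simp [numArcs, Finset.range_add_one, Finset.filter_insert, h]
  have := numArcs_mono tl u (lastArc_le tl u p)
  omega

/-- The invariant of Dijkstra's algorithm from `w`: the nodes in `S` are settled, and the arcs in
`Done` have been relaxed. `par v` is `0` as long as `v` has not been reached, and otherwise one more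
than the arc by which it is reached; `ord` is the order in which nodes have been settled. -/
structure DijInv (n A w : ℕ) (tl hd : ℕ → ℕ) (av : ℕ → Prop) (c : ℕ → ℝ) (q par : ℕ → ℕ)
    (dist : ℕ → ℝ) (S : Finset ℕ) (Done : ℕ → Prop) (ord : ℕ → ℕ) (μ : ℝ) : Prop where
  sub : ∀ v ∈ S, v < n
  par_w : par w = A + 1
  dist_w : dist w = 0
  par_le : ∀ v < n, par v ≤ A + 1
  tree : ∀ v < n, v ≠ w → par v ≠ 0 → ∃ a < A, par v = a + 1 ∧ av a ∧ hd a = v ∧ tl a ∈ S ∧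
    dist v = dist (tl a) + c a ∧ (v ∈ S → ord (tl a) < ord v)
  ord_lt : ∀ v ∈ S, ord v < S.card
  done_tl : ∀ a < A, Done a → tl a ∈ S
  done : ∀ a < A, Done a → av a → par (hd a) ≠ 0 ∧ dist (hd a) ≤ dist (tl a) + c a
  active : ∀ v < n, q v = 0 ↔ par v ≠ 0 ∧ v ∉ S
  q_le : ∀ v < n, q v ≤ 1
  settled : ∀ v ∈ S, par v ≠ 0
  nonneg : 0 ≤ μ
  le_mu : ∀ v ∈ S, dist v ≤ μ
  mu_le : ∀ v < n, q v = 0 → μ ≤ dist v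

namespace DijInv

variable {n A w : ℕ} {tl hd : ℕ → ℕ} {av : ℕ → Prop} {c : ℕ → ℝ} {q par : ℕ → ℕ}
  {dist : ℕ → ℝ} {S : Finset ℕ} {Done Done' : ℕ → Prop} {ord : ℕ → ℕ} {μ : ℝ}

/-- The extracted minimum becomes the new threshold `μ`. Its number `S.card` exceeds all earlier
ones, so `ord` increases along tree arcs between settled nodes; distances could not play this role,
because arcs of cost zero occur. -/
theorem settle (h : DijInv n A w tl hd av c q par dist S Done ord μ) {u : ℕ} (hu : u < n)
    (hq : q u = 0) (hmin : ∀ v < n, q v = 0 → dist u ≤ dist v) :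
    DijInv n A w tl hd av c (Function.update q u 1) par dist (insert u S) Done
      (Function.update ord u S.card) (dist u) := by
  obtain ⟨hpu, huS⟩ := (h.active u hu).1 hq
  have hne : ∀ v ∈ S, v ≠ u := fun v hv e => huS (e ▸ hv)
  refine ⟨?_, h.par_w, h.dist_w, h.par_le, ?_, ?_, ?_, h.done, ?_, ?_, ?_, ?_, ?_, ?_⟩
  · intro v hv
    rcases Finset.mem_insert.1 hv with rfl | hv
    exacts [hu, h.sub v hv]
  · intro v hv hvw hpv
    obtain ⟨a, ha, h1, h2, h3, h4, h5, h6⟩ := h.tree v hv hvw hpv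
    refine ⟨a, ha, h1, h2, h3, Finset.mem_insert_of_mem h4, h5, fun hvS => ?_⟩
    rw [Function.update_of_ne (hne _ h4)]
    rcases Finset.mem_insert.1 hvS with rfl | hvS
    · simpa using h.ord_lt _ h4
    · rw [Function.update_of_ne (hne _ hvS)]
      exact h6 hvS
  · intro v hv
    rw [Finset.card_insert_of_notMem huS]
    rcases Finset.mem_insert.1 hv with rfl | hv
    · simp
    · rw [Function.update_of_ne (hne _ hv)]
      exact (h.ord_lt v hv).trans (Nat.lt_succ_self _)
  · exact fun a ha hd => Finset.mem_insert_of_mem (h.done_tl a ha hd)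
  · intro v hv
    by_cases e : v = u
    · simp [e]
    · simp [e, h.active v hv]
  · intro v hv
    by_cases e : v = u
    · simp [e]
    · simpa [e] using h.q_le v hv
  · intro v hv
    rcases Finset.mem_insert.1 hv with rfl | hv
    exacts [hpu, h.settled v hv]
  · exact h.nonneg.trans (h.mu_le u hu hq)
  · intro v hv
    rcases Finset.mem_insert.1 hv with rfl | hv
    exacts [le_rfl, (h.le_mu v hv).trans (h.mu_le u hu hq)]
  · intro v hv hqv
    by_cases e : v = u
    · simp [e] at hqv
    · exact hmin v hv (by simpa [e] using hqv)

theorem done_congr (h : DijInv n A w tl hd av c q par dist S Done ord μ)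
    (htl : ∀ a < A, Done' a → tl a ∈ S)
    (hD : ∀ a < A, Done' a → Done a ∨ (av a → par (hd a) ≠ 0 ∧ dist (hd a) ≤ dist (tl a) + c a)) :
    DijInv n A w tl hd av c q par dist S Done' ord μ :=
  { h with
    done_tl := htl
    done := fun a ha hd' hav => (hD a ha hd').elim (fun h' => h.done a ha h' hav) fun h' => h' hav }

/-- The new label is at least `dist (tl a) = μ`, whereas settled nodes have labels at most `μ`, and
`w` has label `0`. So a strict improvement never concerns a settled node or `w`, and the arcs
already done keep the labels of their tails. -/
theorem relax (h : DijInv n A w tl hd av c q par dist S Done ord μ) {a : ℕ} (ha : a < A)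
    (hav : av a) (htl : tl a ∈ S) (hmu : dist (tl a) = μ) (hc : 0 ≤ c a) (hhd : hd a < n)
    (hlt : par (hd a) = 0 ∨ dist (tl a) + c a < dist (hd a)) :
    hd a ∉ S ∧ (par (hd a) = 0 ∧ q (hd a) ≠ 0 ∨ dist (tl a) + c a < dist (hd a)) ∧
    DijInv n A w tl hd av c (Function.update q (hd a) 0) (Function.update par (hd a) (a + 1))
      (Function.update dist (hd a) (dist (tl a) + c a)) S (fun b => Done b ∨ b = a) ord μ := by
  have hvS : hd a ∉ S := fun hS => by
    rcases hlt with hlt | hlt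
    · exact h.settled _ hS hlt
    · have := h.le_mu _ hS
      linarith
  have hvw : hd a ≠ w := fun e => by
    have h0 := h.nonneg
    rw [e, h.par_w, h.dist_w] at hlt
    rcases hlt with hlt | hlt
    · omega
    · linarith
  have hne : ∀ v ∈ S, v ≠ hd a := fun v hv e => hvS (e ▸ hv)
  have hdone : ∀ b < A, Done b → av b →
      Function.update par (hd a) (a + 1) (hd b) ≠ 0 ∧
      Function.update dist (hd a) (dist (tl a) + c a) (hd b) ≤
        Function.update dist (hd a) (dist (tl a) + c a) (tl b) + c b := by
    intro b hb hbd hbav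
    obtain ⟨h1, h2⟩ := h.done b hb hbd hbav
    rw [Function.update_of_ne (hne _ (h.done_tl b hb hbd))]
    by_cases e : hd b = hd a
    · rw [e, Function.update_self, Function.update_self]
      rw [e] at h1 h2
      exact ⟨by omega, by linarith [hlt.resolve_left h1]⟩
    · rw [Function.update_of_ne e, Function.update_of_ne e]
      exact ⟨h1, h2⟩
  refine ⟨hvS, hlt.imp_left fun h0 => ⟨h0, fun hq => ((h.active _ hhd).1 hq).1 h0⟩,
    h.sub, ?_, ?_, ?_, ?_, h.ord_lt, ?_, ?_, ?_, ?_, ?_, h.nonneg, ?_, ?_⟩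
  · rw [Function.update_of_ne hvw.symm]; exact h.par_w
  · rw [Function.update_of_ne hvw.symm]; exact h.dist_w
  · intro v hv
    by_cases e : v = hd a
    · rw [e, Function.update_self]; omega
    · rw [Function.update_of_ne e]; exact h.par_le v hv
  · intro v hv hvw' hpv
    by_cases e : v = hd a
    · subst e
      refine ⟨a, ha, by simp, hav, rfl, htl, ?_, fun hS => absurd hS hvS⟩
      rw [Function.update_self, Function.update_of_ne (hne _ htl)]
    · rw [Function.update_of_ne e] at hpv
      obtain ⟨b, hb, h1, h2, h3, h4, h5, h6⟩ := h.tree v hv hvw' hpv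
      refine ⟨b, hb, ?_, h2, h3, h4, ?_, h6⟩
      · rw [Function.update_of_ne e]; exact h1
      · rw [Function.update_of_ne e, Function.update_of_ne (hne _ h4)]; exact h5
  · rintro b hb (hbd | rfl)
    exacts [h.done_tl b hb hbd, htl]
  · rintro b hb (hbd | rfl) hbav
    · exact hdone b hb hbd hbav
    · rw [Function.update_self, Function.update_self, Function.update_of_ne (hne _ htl)]
      exact ⟨by omega, le_rfl⟩
  · intro v hv
    by_cases e : v = hd a
    · rw [e]; simpa using hvS
    · rw [Function.update_of_ne e, Function.update_of_ne e]; exact h.active v hv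
  · intro v hv
    by_cases e : v = hd a
    · simp [e]
    · simpa [e] using h.q_le v hv
  · intro v hv
    rw [Function.update_of_ne (hne v hv)]; exact h.settled v hv
  · intro v hv
    rw [Function.update_of_ne (hne v hv)]; exact h.le_mu v hv
  · intro v hv hqv
    by_cases e : v = hd a
    · rw [e, Function.update_self]; linarith
    · rw [Function.update_of_ne e] at hqv ⊢
      exact h.mu_le v hv hqv

end DijInv

/-- The outcome of Dijkstra's algorithm from `w`. -/
structure DijResult (n A w : ℕ) (tl hd : ℕ → ℕ) (av : ℕ → Prop) (c : ℕ → ℝ) (par : ℕ → ℕ)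
    (dist : ℕ → ℝ) (ord : ℕ → ℕ) : Prop where
  par_w : par w ≠ 0
  par_le : ∀ v < n, par v ≤ A + 1
  dist_w : dist w = 0
  tree : ∀ v < n, v ≠ w → par v ≠ 0 → ord v < n ∧ ∃ a < A, par v = a + 1 ∧ av a ∧ hd a = v ∧
    par (tl a) ≠ 0 ∧ dist v = dist (tl a) + c a ∧ ord (tl a) < ord v
  closed : ∀ a < A, av a → par (tl a) ≠ 0 →
    par (hd a) ≠ 0 ∧ dist (hd a) ≤ dist (tl a) + c a

/-- With an empty queue every reached node is settled, so all available arcs out of reached nodes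
have been relaxed. The result records closedness under relaxation and a tight tree; that the labels
are shortest distances is not needed for the flow argument. -/
theorem DijInv.result {n A w : ℕ} {tl hd : ℕ → ℕ} {av : ℕ → Prop} {c : ℕ → ℝ} {q par : ℕ → ℕ}
    {dist : ℕ → ℝ} {S : Finset ℕ} {ord : ℕ → ℕ} {μ : ℝ}
    (h : DijInv n A w tl hd av c q par dist S (fun a => tl a ∈ S) ord μ)
    (htl : ∀ a < A, tl a < n) (hq : ∀ v < n, q v ≠ 0) :
    DijResult n A w tl hd av c par dist ord := by
  have hS : ∀ v < n, par v ≠ 0 → v ∈ S := fun v hv hp => by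
    by_contra hvS
    exact hq v hv ((h.active v hv).2 ⟨hp, hvS⟩)
  have hcard : S.card ≤ n := by
    simpa using Finset.card_le_card (t := Finset.range n) fun v hv => Finset.mem_range.2 (h.sub v hv)
  refine ⟨by rw [h.par_w]; omega, h.par_le, h.dist_w, fun v hv hvw hp => ?_,
    fun a ha hav hp => h.done a ha (hS _ (htl a ha) hp) hav⟩
  obtain ⟨a, ha, h1, h2, h3, h4, h5, h6⟩ := h.tree v hv hvw hp
  exact ⟨(h.ord_lt v (hS v hv hp)).trans_le hcard, a, ha, h1, h2, h3, h.settled _ h4, h5,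
    h6 (hS v hv hp)⟩

/-! ### The program -/

/-- Relaxes the arc before the number in register `12`, whose tail is in register `11`. -/
def relax : Cmd :=
  .ite (.nle (.lit 1) (.read 11 (.sub (.reg 12) (.lit 1))))
    (.seq (.setN 13 (.read 1 (.sub (.reg 12) (.lit 1)))) <|
     .seq (.setR 0 (.add (.read 3 (.reg 11)) (.read 2 (.sub (.reg 12) (.lit 1))))) <|
     .ite (.not (.and (.nle (.lit 1) (.read 13 (.reg 13))) (.rle (.read 3 (.reg 13)) (.reg 0))))
      (.seq (.seq (.storeR 3 (.reg 13) (.reg 0)) <|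
        .seq (.storeN 12 (.reg 13) (.lit 0)) <|
        .storeN 13 (.reg 13) (.reg 12)) bubble)
      .skip)
    .skip

/-- Relaxes all arcs whose tail is in register `11`. -/
def scan : Cmd :=
  .seq (.setN 12 (.read 7 (.reg 11)))
    (.loop (.nle (.lit 1) (.reg 12)) (.seq relax (.setN 12 (.read 6 (.sub (.reg 12) (.lit 1))))))

/-- Settles nodes until the queue is empty. -/
def settleAll : Cmd :=
  .loop (.nle (.read 12 (.read 14 (.lit 0))) (.lit 0))
    (.seq (.seq (.setN 11 (.read 14 (.lit 0))) (.storeN 12 (.reg 11) (.lit 1)))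
      (.seq rebuild scan))

/-- Empties the queue. -/
def clearQueue : Cmd :=
  .seq (.setN 8 (.lit 0)) <|
  .loop (.nle (.add (.reg 8) (.lit 1)) (.reg 0))
    (.seq (.storeN 12 (.reg 8) (.lit 1)) <|
     .seq (.storeN 13 (.reg 8) (.lit 0)) <|
     .seq (.storeN 14 (.reg 8) (.reg 8)) <|
     .setN 8 (.add (.reg 8) (.lit 1)))

/-- Enters the node in register `3` as the source of the search. -/
def enterSource : Cmd :=
  .seq (.seq (.setN 13 (.reg 3)) <|
    .seq (.storeR 3 (.reg 3) .zero) <|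
    .seq (.storeN 12 (.reg 3) (.lit 0)) <|
    .storeN 13 (.reg 3) (.add (.reg 19) (.lit 1))) bubble

/-- Dijkstra's algorithm from the node in register `3`, with the arcs marked in word array `11` and
the arc lengths in real array `2`. -/
def search : Cmd := .seq clearQueue (.seq enterSource settleAll)

/-- The input of Dijkstra's algorithm. -/
structure SearchInput (B n A w d : ℕ) (σ : State) : Prop where
  n_eq : σ.nreg 0 = n
  w_eq : σ.nreg 3 = w
  d_eq : σ.nreg 9 = d
  A_eq : σ.nreg 19 = A
  two_le : 2 ≤ d
  lt : n + d * n + d + 2 < B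
  A_lt : A + 2 < B
  w_lt : w < n
  tl_lt : ∀ a < A, σ.narr 0 a < n
  hd_lt : ∀ a < A, σ.narr 1 a < n
  head_eq : ∀ v < n, σ.narr 7 v = lastArc (σ.narr 0) v A
  next_eq : ∀ a < A, σ.narr 6 a = lastArc (σ.narr 0) (σ.narr 0 a) a
  av_le : ∀ a < A, σ.narr 11 a ≤ 1
  cost_nonneg : ∀ a < A, 1 ≤ σ.narr 11 a → 0 ≤ σ.rarr 2 a

/-- The program does not change the input of the search. -/
def KeepsInput (P : Cmd) : Bool :=
  !P.writesN 0 && !P.writesN 3 && !P.writesN 9 && !P.writesN 19 && !P.storesN 0 && !P.storesN 1 &&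
    !P.storesN 6 && !P.storesN 7 && !P.storesN 11 && !P.storesR 2

theorem SearchInput.of_frame {B n A w d : ℕ} {P : Cmd} {σ τ : State}
    (h : SearchInput B n A w d σ) (hF : Frame P σ τ) (hP : KeepsInput P = true) :
    SearchInput B n A w d τ := by
  simp only [KeepsInput, Bool.and_eq_true, Bool.not_eq_true'] at hP
  obtain ⟨⟨⟨⟨⟨⟨⟨⟨⟨h0, h3⟩, h9⟩, h19⟩, a0⟩, a1⟩, a6⟩, a7⟩, a11⟩, r2⟩ := hP
  exact ⟨(hF.nreg _ h0).trans h.n_eq, (hF.nreg _ h3).trans h.w_eq, (hF.nreg _ h9).trans h.d_eq,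
    (hF.nreg _ h19).trans h.A_eq, h.two_le, h.lt, h.A_lt, h.w_lt,
    by rw [hF.narr _ a0]; exact h.tl_lt, by rw [hF.narr _ a1]; exact h.hd_lt,
    by rw [hF.narr _ a0, hF.narr _ a7]; exact h.head_eq,
    by rw [hF.narr _ a0, hF.narr _ a6]; exact h.next_eq,
    by rw [hF.narr _ a11]; exact h.av_le,
    by rw [hF.narr _ a11, hF.rarr _ r2]; exact h.cost_nonneg⟩

/-- The state in the course of Dijkstra's algorithm. -/
structure SearchState (n A w d : ℕ) (σ : State) (S : Finset ℕ) (Done : ℕ → Prop) (ord : ℕ → ℕ)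
    (μ : ℝ) : Prop where
  inv : DijInv n A w (σ.narr 0) (σ.narr 1) (1 ≤ σ.narr 11 ·) (σ.rarr 2) (σ.narr 12)
    (σ.narr 13) (σ.rarr 3) S Done ord μ
  tour : Tour n d (σ.narr 12) (σ.rarr 3) (σ.narr 14) fun _ => False

theorem SearchState.of_setN {n A w d : ℕ} {σ : State} {S : Finset ℕ} {Done : ℕ → Prop}
    {ord : ℕ → ℕ} {μ : ℝ} (h : SearchState n A w d σ S Done ord μ) (x v : ℕ) :
    SearchState n A w d (σ.setN x v) S Done ord μ := ⟨h.inv, h.tour⟩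

/-! ### Correctness and cost of the search -/

theorem relax_runs {B n A w d p u : ℕ} {σ : State} {S : Finset ℕ} {Done : ℕ → Prop} {ord : ℕ → ℕ}
    {μ : ℝ} (hi : SearchInput B n A w d σ) (h : SearchState n A w d σ S Done ord μ) (hp : p < A)
    (h11 : σ.nreg 11 = u) (h12 : σ.nreg 12 = p + 1) (htl : σ.narr 0 p = u) (hu : u ∈ S)
    (hmu : σ.rarr 3 u = μ) :
    Runs B relax σ (150 * (height d n + 1)) fun τ =>
      τ.rarr 3 u = μ ∧ SearchState n A w d τ S (fun a => Done a ∨ a = p) ord μ := by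
  have hlt := hi.lt
  have hAlt := hi.A_lt
  have hun := h.inv.sub u hu
  have hhd := hi.hd_lt p hp
  have hav := hi.av_le p hp
  have hpar := h.inv.par_le _ hhd
  have hskip : (1 ≤ σ.narr 11 p → σ.narr 13 (σ.narr 1 p) ≠ 0 ∧
      σ.rarr 3 (σ.narr 1 p) ≤ σ.rarr 3 (σ.narr 0 p) + σ.rarr 2 p) →
      SearchState n A w d σ S (fun a => Done a ∨ a = p) ord μ := fun hh =>
    ⟨h.inv.done_congr (fun a ha hd => hd.elim (h.inv.done_tl a ha) fun e => by rw [e, htl]; exact hu)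
      fun a ha hd => hd.imp_right fun e => by rw [e]; exact hh, h.tour⟩
  have hkey := h.inv.relax (a := p) hp
  refine Runs.mono (Runs.ite (T := 40 + (20 + 100 * (height d n + 1))) ?_ (fun h1 => ?_)
    fun h1 => ?_) ?_ fun _ _ h => h
  rotate_right
  · simp only [BExpr.cost, NExpr.cost, height]; omega
  · simp [h12]; exact ⟨by omega, ⟨by omega, by omega⟩, by omega⟩
  rotate_left
  · refine (Runs.of_wp (P := .skip) ?_).mono (by simp only [Cmd.maxCost]; omega) fun _ _ h => h
    simp only [BExpr.Holds, NExpr.eval, h12, Nat.add_sub_cancel] at h1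
    exact ⟨hmu, hskip fun h' => absurd h' h1⟩
  simp only [BExpr.Holds, NExpr.eval, h12, Nat.add_sub_cancel] at h1
  set v := σ.narr 1 p with hv
  set r := σ.rarr 3 u + σ.rarr 2 p with hr
  refine Runs.mono (Runs.seq (Runs.of_wp (Q := fun τ => τ = σ.setN 13 v) ?_) fun τ _ hτ =>
    Runs.seq (Runs.of_wp (Q := fun τ => τ = (σ.setN 13 v).setR 0 r) ?_) fun τ' _ hτ' =>
    Runs.ite (T := 20 + 100 * (height d n + 1)) (Q := fun τ =>
      τ.rarr 3 u = μ ∧ SearchState n A w d τ S (fun a => Done a ∨ a = p) ord μ) ?_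
      (fun h2 => ?_) fun h2 => ?_) ?_ fun _ _ h => h
  · simp only [Cmd.wp, NExpr.Fits, NExpr.eval, h12, Nat.add_sub_cancel]
    exact ⟨⟨⟨by omega, by omega⟩, by omega⟩, rfl⟩
  · subst hτ; simp [h12, h11]
    exact ⟨⟨by omega, by omega, by omega⟩, rfl⟩
  · subst hτ'; simp; omega
  · subst hτ'
    have h2' : σ.narr 13 v = 0 ∨ r < σ.rarr 3 v := by
      simp only [BExpr.Holds, NExpr.eval, RExpr.eval, State.setR_nreg, State.setN_nreg,
        State.setR_rreg, State.setR_narr, State.setN_narr, State.setR_rarr, State.setN_rarr,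
        if_true, not_and_or, not_le] at h2
      exact h2.imp_left fun h => by omega
    obtain ⟨hvS, hq, hinv⟩ := hkey h1 (by rwa [htl]) (by rw [htl]; exact hmu) (hi.cost_nonneg p hp h1)
      hhd (by rw [htl]; exact h2')
    rw [htl] at hq hinv
    set q' := Function.update (σ.narr 12) v 0
    set d' := Function.update (σ.rarr 3) v r
    set p' := Function.update (σ.narr 13) v (p + 1)
    -- Either `v` enters the queue, where its key was `⊤`, or its label drops; both are decreases of
    -- the key.
    have hT := h.tour.decrease v r (by
      rcases hq with hq | hq
      · simp [key, hq.2]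
      · rw [key]
        split_ifs
        · exact_mod_cast hq.le
        · exact le_top)
    refine Runs.mono (Runs.seq (Runs.of_wp (Q := fun τ => τ.nreg 13 = v ∧ τ.narr 12 = q' ∧
      τ.rarr 3 = d' ∧ τ.narr 13 = p' ∧ τ.narr 14 = σ.narr 14 ∧ τ.narr 0 = σ.narr 0 ∧
      τ.narr 1 = σ.narr 1 ∧ τ.narr 11 = σ.narr 11 ∧ τ.rarr 2 = σ.rarr 2 ∧ τ.nreg 0 = σ.nreg 0 ∧
      τ.nreg 9 = σ.nreg 9) ?_) (Q' := fun τ =>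
      τ.rarr 3 u = μ ∧ SearchState n A w d τ S (fun a => Done a ∨ a = p) ord μ)
      fun ρ _ ⟨g13, f12, f3, f13, f14, f0, f1, f11, f2, g0, g9⟩ =>
      (bubble_runs (v := v) (n := n) (d := d) ?_ hhd g13 ?_).mono le_rfl fun υ hυ hT' => ?_) ?_
      fun _ _ h => h
    · simp [h12]
      exact ⟨by omega, by omega, by omega, by omega, rfl, rfl, rfl⟩
    · exact ⟨g0.trans hi.n_eq, g9.trans hi.d_eq, hi.two_le, hlt, by rw [f12]; exact hinv.q_le⟩
    · rw [f12, f3, f14]; exact hT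
    · refine ⟨?_, ?_, ?_⟩
      · rw [hυ.rarr 3 rfl, f3]
        exact (Function.update_of_ne (fun e : u = v => hvS (e ▸ hu)) _ _).trans hmu
      · rw [hυ.narr 0 rfl, hυ.narr 1 rfl, hυ.narr 11 rfl, hυ.narr 12 rfl, hυ.narr 13 rfl,
          hυ.rarr 2 rfl, hυ.rarr 3 rfl, f0, f1, f11, f12, f13, f2, f3]
        exact hinv
      · rw [hυ.narr 12 rfl, hυ.rarr 3 rfl]; exact hT'
    · simp only [Cmd.maxCost, NExpr.cost, RExpr.cost]; omega
  · subst hτ'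
    refine (Runs.of_wp (P := .skip) ?_).mono (by simp only [Cmd.maxCost]; omega) fun _ _ h => h
    simp only [BExpr.Holds, NExpr.eval, RExpr.eval, State.setR_nreg, State.setN_nreg,
        State.setR_rreg, State.setR_narr, State.setN_narr, State.setR_rarr, State.setN_rarr,
        if_true, not_not] at h2
    have := hskip fun _ => ⟨by omega, by rw [htl]; exact h2.2⟩
    exact ⟨hmu, this.inv, this.tour⟩
  · simp only [Cmd.maxCost, BExpr.cost, NExpr.cost, RExpr.cost]; omega

theorem scan_runs {B n A w d u : ℕ} {σ : State} {S : Finset ℕ} {ord : ℕ → ℕ}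
    {μ : ℝ} (hi : SearchInput B n A w d σ)
    (h : SearchState n A w d σ S (fun a => σ.narr 0 a ∈ S ∧ σ.narr 0 a ≠ u) ord μ)
    (h11 : σ.nreg 11 = u) (hu : u ∈ S) (hmu : σ.rarr 3 u = μ) :
    Runs B scan σ (numArcs (σ.narr 0) u A * (200 * (height d n + 1)) + 10) fun τ =>
      SearchState n A w d τ S (fun a => σ.narr 0 a ∈ S) ord μ := by
  have hlt := hi.lt
  have hAlt := hi.A_lt
  have hun := h.inv.sub u hu
  have hhead := hi.head_eq u hun
  have hle := lastArc_le (σ.narr 0) u A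
  refine Runs.mono (Runs.seq (Runs.of_wp
    (Q := fun τ => τ = σ.setN 12 (lastArc (σ.narr 0) u A)) ?_) fun τ hF hτ =>
    Runs.loop_const (fun k ρ => ∃ j ≤ A, ρ.nreg 12 = lastArc (σ.narr 0) u j ∧
        numArcs (σ.narr 0) u (lastArc (σ.narr 0) u j) ≤ k ∧ ρ.rarr 3 u = μ ∧
        -- The list runs downwards through the arc numbers. An entry `p + 1` means that `p` is next,
        -- so exactly the arcs of `u` numbered at least `p + 1` are done.
        SearchState n A w d ρ S (fun a => σ.narr 0 a ∈ S ∧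
          (σ.narr 0 a = u → lastArc (σ.narr 0) u j ≤ a)) ord μ)
      (Q := fun τ => SearchState n A w d τ S (fun a => σ.narr 0 a ∈ S) ord μ)
      (150 * (height d n + 1) + 5) (k := numArcs (σ.narr 0) u A) ?_ ?_) ?_ fun _ _ h => h
  · simp [h11, hhead]; omega
  · subst hτ
    rintro k ρ hρ ⟨j, hj, r12, hk, hmuρ, hS⟩
    have hjA := (lastArc_le (σ.narr 0) u j).trans hj
    have hiρ : SearchInput B n A w d ρ :=
      (hi.of_frame (hF) rfl).of_frame hρ rfl
    have e0 : ρ.narr 0 = σ.narr 0 := by rw [hρ.narr 0 rfl]; rfl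
    refine ⟨by simp [r12]; omega, fun hb => ?_, fun hb => ?_⟩
    · simp only [BExpr.Holds, NExpr.eval, r12] at hb
      obtain ⟨p, hp⟩ : ∃ p, lastArc (σ.narr 0) u j = p + 1 := ⟨_, (Nat.sub_add_cancel hb).symm⟩
      have htl := tl_of_lastArc hp
      rw [hp] at hS hk hjA r12
      refine Runs.mono (Runs.seq (relax_runs hiρ hS (p := p) (by omega) (u := u) ?_ r12
        (by rwa [e0]) hu hmuρ) (T' := 5) fun υ hυ ⟨hmuυ, hSυ⟩ => Runs.of_wp ?_) le_rfl
        (fun _ _ h => h)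
      · rw [hρ.nreg 11 rfl]; simpa using h11
      · have hiυ : SearchInput B n A w d υ := hiρ.of_frame hυ rfl
        have f0 : υ.narr 0 = σ.narr 0 := by rw [hυ.narr 0 rfl, e0]
        have f12 : υ.nreg 12 = p + 1 := by rw [hυ.nreg 12 rfl, r12]
        have f6 := hiυ.next_eq p (by omega)
        rw [f0, htl] at f6
        have hle' := lastArc_le (σ.narr 0) u p
        have hnum := numArcs_lastArc htl
        simp only [Cmd.wp, NExpr.Fits, NExpr.eval, f12, Nat.add_sub_cancel, f6]
        refine ⟨⟨⟨by omega, by omega⟩, by omega⟩, k - 1, by omega, p, by omega, by simp,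
          by omega, hmuυ, SearchState.of_setN ⟨?_, hSυ.tour⟩ _ _⟩
        refine hSυ.inv.done_congr (fun a ha hd => by rw [f0]; exact hd.1) fun a ha hd => .inl ?_
        by_cases ha' : a = p
        · exact .inr ha'
        · refine .inl ⟨hd.1, fun hau => ?_⟩
          by_contra hlt'
          exact tl_ne_of_lastArc_le (tl := σ.narr 0) (show a < p by omega) (hd.2 hau) hau
    · simp only [BExpr.Holds, NExpr.eval, r12] at hb
      exact ⟨hS.inv.done_congr (fun a ha hd => by rw [e0]; exact hd)
        fun a ha hd => .inl ⟨hd, fun _ => by omega⟩, hS.tour⟩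
  · subst hτ
    refine ⟨A, le_rfl, by simp, numArcs_mono _ _ hle, hmu,
      SearchState.of_setN ⟨?_, h.tour⟩ _ _⟩
    exact h.inv.done_congr (fun a ha hd => hd.1)
      fun a ha hd => .inl ⟨hd.1, fun hau => tl_ne_of_lastArc_le ha (hd.2 hau) hau⟩
  · simp only [Cmd.maxCost, BExpr.cost, NExpr.cost]
    nlinarith

/-- The number of arcs whose tail is not in `S`. -/
def openArcs (tl : ℕ → ℕ) (A : ℕ) (S : Finset ℕ) : ℕ :=
  ((Finset.range A).filter fun a => tl a ∉ S).card

theorem openArcs_insert (tl : ℕ → ℕ) (A : ℕ) {S : Finset ℕ} {u : ℕ} (hu : u ∉ S) :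
    numArcs tl u A + openArcs tl A (insert u S) = openArcs tl A S := by
  rw [numArcs, openArcs, openArcs, ← Finset.card_union_of_disjoint]
  · congr 1
    ext a
    simp only [Finset.mem_union, Finset.mem_filter, Finset.mem_range, Finset.mem_insert]
    by_cases e : tl a = u
    · simp [e, hu]
    · simp [e]
  · rw [Finset.disjoint_left]
    intro a h1 h2
    simp only [Finset.mem_filter, Finset.mem_insert, not_or] at h1 h2
    exact h2.2.1 h1.2

/-- The remaining time is charged to `(n - S.card) * (d + 1) + openArcs`, times a multiple of the
height: settling `u` pays for rebuilding the tournament from the first summand and for scanning the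
arcs of `u` from the second. -/
theorem settleAll_runs {B n A w d : ℕ} {σ : State} {ord : ℕ → ℕ}
    (hi : SearchInput B n A w d σ) (h : SearchState n A w d σ ∅ (fun _ => False) ord 0) :
    Runs B settleAll σ ((n * (d + 1) + A) * (300 * (height d n + 1)) + 10) fun τ =>
      ∃ ord, DijResult n A w (τ.narr 0) (τ.narr 1) (1 ≤ τ.narr 11 ·) (τ.rarr 2)
        (τ.narr 13) (τ.rarr 3) ord := by
  have hlt := hi.lt
  have hd := hi.two_le
  have hn : 0 < n := (Nat.zero_le _).trans_lt hi.w_lt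
  refine Runs.mono (Runs.loop (fun k τ => ∃ S ord μ,
    ((n - S.card) * (d + 1) + openArcs (σ.narr 0) A S) * (300 * (height d n + 1)) ≤ k ∧
      SearchState n A w d τ S (fun a => σ.narr 0 a ∈ S) ord μ) ?_
    (k := (n * (d + 1) + A) * (300 * (height d n + 1))) ?_) ?_ fun _ _ h => h
  · rintro k τ hτ ⟨S, ord, μ, hk, hS⟩
    have hiτ : SearchInput B n A w d τ := hi.of_frame hτ rfl
    have e0 : τ.narr 0 = σ.narr 0 := hτ.narr 0 rfl
    have hu := hS.tour.lt 0 hn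
    have hq := hS.inv.q_le _ hu
    have hmin := fun v (hv : v < n) => hS.tour.root_le hd hv
    set u := τ.narr 14 0 with hu_def
    refine ⟨by simp only [BExpr.Fits, NExpr.Fits, NExpr.eval, ← hu_def]; omega,
      fun hb => ?_, fun hb => ?_⟩
    · simp only [BExpr.Holds, NExpr.eval, ← hu_def, Nat.le_zero] at hb
      have hmin' : ∀ v < n, τ.narr 12 v = 0 → τ.rarr 3 u ≤ τ.rarr 3 v := fun v hv hqv => by
        have := hmin v hv
        simp only [key, hb, hqv, if_true] at this
        exact_mod_cast this
      have hinv := hS.inv.settle hu hb hmin'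
      have huS := ((hS.inv.active u hu).1 hb).2
      have hcard : S.card < n := by
        have := Finset.card_le_card (s := insert u S) (t := Finset.range n) fun v hv =>
          Finset.mem_range.2 (hinv.sub v hv)
        rw [Finset.card_insert_of_notMem huS, Finset.card_range] at this
        exact this
      refine ⟨10 + (200 * (d + 1) * (height d n + 1) +
        (numArcs (σ.narr 0) u A * (200 * (height d n + 1)) + 10)), Runs.mono (Runs.seq
        (Runs.of_wp (Q := fun υ => υ.nreg 11 = u ∧
          υ = (τ.setN 11 u).storeN 12 u 1) ?_) (fun υ hυ ⟨e11, hυ'⟩ => Runs.seq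
        (rebuild_runs (n := n) (d := d) (u := u) ?_ hu e11 ?_) fun ρ hρ hT =>
          (scan_runs (n := n) (A := A) (w := w) (d := d) (u := u) (S := insert u S)
            (ord := Function.update ord u S.card) (μ := τ.rarr 3 u) ?_ ?_ ?_ ?_ ?_).mono
          (Q' := fun υ => ∃ k', 1 + 4 + 1 + (10 + (200 * (d + 1) * (height d n + 1) +
            (numArcs (σ.narr 0) u A * (200 * (height d n + 1)) + 10))) + k' ≤ k ∧
            ∃ S ord μ, ((n - S.card) * (d + 1) + openArcs (σ.narr 0) A S) *
              (300 * (height d n + 1)) ≤ k' ∧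
            SearchState n A w d υ S (fun a => σ.narr 0 a ∈ S) ord μ)
          (T' := numArcs (σ.narr 0) u A * (200 * (height d n + 1)) + 10) ?_ ?_)) ?_ ?_⟩
      · simp only [Cmd.wp, NExpr.Fits, NExpr.eval, State.setN_nreg, if_true, ← hu_def,
          State.storeN_nreg]
        exact ⟨⟨by omega, by omega⟩, by omega, by omega, trivial, trivial⟩
      · subst hυ'
        refine ⟨by simpa using hiτ.n_eq, by simpa using hiτ.d_eq, hd, hlt, ?_⟩
        simpa using hinv.q_le
      · subst hυ'
        simpa using hS.tour.remove u
      · exact (hiτ.of_frame hυ rfl).of_frame hρ rfl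
      · subst hυ'
        constructor
        · rw [hρ.narr 0 rfl, hρ.narr 1 rfl, hρ.narr 11 rfl, hρ.narr 12 rfl, hρ.narr 13 rfl,
            hρ.rarr 2 rfl, hρ.rarr 3 rfl]
          refine DijInv.done_congr (Done := fun a => σ.narr 0 a ∈ S) ?_ (fun a ha hd => hd.1)
            fun a ha hd => .inl ?_
          · simpa using hinv
          · have := Finset.mem_insert.1 hd.1
            have h2 := this.resolve_left hd.2
            simpa [e0] using h2
        · rw [hρ.narr 12 rfl, hρ.rarr 3 rfl]; exact hT
      · rw [hρ.nreg 11 rfl]; exact e11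
      · exact Finset.mem_insert_self _ _
      · rw [hρ.rarr 3 rfl, hυ']; rfl
      · rw [hρ.narr 0 rfl, hυ']; simp [e0]
      · intro υ' _ hS'
        refine ⟨((n - (insert u S).card) * (d + 1) + openArcs (σ.narr 0) A (insert u S)) *
          (300 * (height d n + 1)), ?_, insert u S, Function.update ord u S.card, τ.rarr 3 u,
          le_rfl, ?_⟩
        · refine le_trans ?_ hk
          rw [Finset.card_insert_of_notMem huS, ← openArcs_insert (σ.narr 0) A huS]
          obtain ⟨e, he⟩ : ∃ e, n - S.card = e + 1 := ⟨n - S.card - 1, by omega⟩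
          rw [show n - (S.card + 1) = e by omega, he]
          generalize numArcs (σ.narr 0) u A = x
          generalize openArcs (σ.narr 0) A (insert u S) = y
          generalize height d n = H
          nlinarith [Nat.zero_le (x * H), Nat.zero_le (d * H)]
        · have e0ρ : ρ.narr 0 = σ.narr 0 := by rw [hρ.narr 0 rfl, hυ']; simp [e0]
          rwa [e0ρ] at hS'
      · simp only [Cmd.maxCost, NExpr.cost]
        omega
      · exact fun _ _ h => h
    · simp only [BExpr.Holds, NExpr.eval, ← hu_def, Nat.le_zero] at hb
      refine ⟨ord, DijInv.result (q := τ.narr 12) (S := S) (μ := μ) ?_ hiτ.tl_lt fun v hv hqv => ?_⟩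
      · rw [e0]; have := hS.inv; rwa [e0] at this
      · have := hmin v hv
        simp [key, hb, hqv] at this
  · refine ⟨∅, ord, 0, ?_, by simpa using h⟩
    simp only [Finset.card_empty, Nat.sub_zero]
    refine Nat.mul_le_mul_right _ (Nat.add_le_add_left ?_ _)
    rw [openArcs]
    exact (Finset.card_filter_le _ _).trans (by simp)
  · simp only [BExpr.cost, NExpr.cost]
    omega

theorem clearQueue_runs {B n : ℕ} {σ : State} (h0 : σ.nreg 0 = n) (hB : n + 2 < B) :
    Runs B clearQueue σ (30 * n + 10) fun τ =>
      ∀ v < n, τ.narr 12 v = 1 ∧ τ.narr 13 v = 0 ∧ τ.narr 14 v = v := by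
  refine Runs.mono (Runs.seq (Runs.of_wp (Q := fun τ => τ = σ.setN 8 0) ?_) fun τ hF hτ =>
    Runs.loop_const (fun k ρ => ρ.nreg 8 + k = n ∧
      ∀ v < ρ.nreg 8, ρ.narr 12 v = 1 ∧ ρ.narr 13 v = 0 ∧ ρ.narr 14 v = v)
      (Q := fun τ => ∀ v < n, τ.narr 12 v = 1 ∧ τ.narr 13 v = 0 ∧ τ.narr 14 v = v)
      15 (k := n) ?_ ?_) ?_ fun _ _ h => h
  · simp; omega
  · subst hτ
    rintro k ρ hρ ⟨hk, hv⟩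
    have r0 : ρ.nreg 0 = n := by rw [hρ.nreg 0 rfl]; simpa using h0
    refine ⟨by simp [r0]; omega, fun hb => ?_, fun hb => ?_⟩
    · simp only [BExpr.Holds, NExpr.eval, r0] at hb
      refine (Runs.of_wp ?_).mono (Q := fun υ => _) (show Cmd.maxCost _ ≤ 15 by decide)
        (fun _ _ h => h)
      simp
      refine ⟨by omega, by omega, by omega, by omega, by omega, ⟨by omega, by omega, by omega⟩,
        k - 1, by omega, by omega, fun v hv' => ?_⟩
      by_cases e : v = ρ.nreg 8
      · simp [e]
      · simpa [e] using hv v (by omega)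
    · simp only [BExpr.Holds, NExpr.eval, r0] at hb
      exact fun v hv' => hv v (by omega)
  · subst hτ; simp
  · simp only [Cmd.maxCost, BExpr.cost, NExpr.cost]
    omega

/-- The source receives `par w = A + 1`, which is nonzero, hence marks it as reached, but names no
arc. -/
theorem enterSource_runs {B n A w d : ℕ} {σ : State} (hi : SearchInput B n A w d σ)
    (h : ∀ v < n, σ.narr 12 v = 1 ∧ σ.narr 13 v = 0 ∧ σ.narr 14 v = v) :
    Runs B enterSource σ (150 * (height d n + 1)) fun τ =>
      ∃ ord, SearchState n A w d τ ∅ (fun _ => False) ord 0 := by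
  have hlt := hi.lt
  have hAlt := hi.A_lt
  have hw := hi.w_lt
  have e3 := hi.w_eq
  have e19 := hi.A_eq
  have e0 := hi.n_eq
  have e9 := hi.d_eq
  have hT : Tour n d (σ.narr 12) (σ.rarr 3) (σ.narr 14) fun _ => False := by
    have hk : ∀ v < n, key (σ.narr 12) (σ.rarr 3) v = ⊤ := fun v hv => by
      simp [key, (h v hv).1]
    refine ⟨fun x hx => ?_, fun x hx => ?_, fun x hx _ => ?_, fun x hx _ => ?_⟩
    · rw [(h x hx).2.2]; exact hx
    · rw [(h x hx).2.2]; exact Anc.refl _ _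
    · rw [hk x hx]; exact le_top
    · rw [(h x hx).2.2, hk x hx]; exact le_top
  have hT' := hT.decrease w 0 (by simp [key, (h w hw).1])
  refine Runs.mono (Runs.seq (Runs.of_wp (Q := fun τ => τ.nreg 13 = w ∧ τ.nreg 0 = n ∧
    τ.nreg 9 = d ∧ τ.narr 12 = Function.update (σ.narr 12) w 0 ∧
    τ.narr 13 = Function.update (σ.narr 13) w (A + 1) ∧ τ.narr 14 = σ.narr 14 ∧
    τ.rarr 3 = Function.update (σ.rarr 3) w 0) ?_) fun τ hτ ⟨r13, r0, r9, f12, f13, f14, f3⟩ =>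
    (bubble_runs (n := n) (d := d) (v := w) ?_ hw r13 ?_).mono
      (Q' := fun τ => ∃ ord, SearchState n A w d τ ∅ (fun _ => False) ord 0) le_rfl
      fun υ hυ hTυ => ⟨fun _ => 0, ?_, ?_⟩) ?_ fun _ _ h => h
  · simp [e3, e19, e0, e9]
    omega
  · refine ⟨r0, r9, hi.two_le, hlt, fun v hv => ?_⟩
    rw [f12]
    by_cases e : v = w
    · simp [e]
    · simp [e, (h v hv).1]
  · rw [f12, f14, f3]; exact hT'
  · rw [hυ.narr 12 rfl, hυ.narr 13 rfl, hυ.rarr 3 rfl, f12, f13, f3]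
    have hp : ∀ v < n, v ≠ w → Function.update (σ.narr 13) w (A + 1) v = 0 := fun v hv e => by
      simpa [e] using (h v hv).2.1
    refine ⟨by simp, by simp, by simp, fun v hv => ?_, fun v hv e hp' => absurd (hp v hv e) hp',
      by simp, by simp, by simp, fun v hv => ?_, fun v hv => ?_, by simp, le_rfl, by simp,
      fun v hv hq => ?_⟩
    · by_cases e : v = w
      · simp [e]
      · rw [hp v hv e]; omega
    · by_cases e : v = w
      · simp [e]
      · simp [e, h v hv]
    · by_cases e : v = w
      · simp [e]
      · simp [e, h v hv]
    · by_cases e : v = w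
      · simp [e]
      · simp [e, h v hv] at hq
  · rw [hυ.narr 12 rfl, hυ.rarr 3 rfl]; exact hTυ
  · simp only [Cmd.maxCost, NExpr.cost, RExpr.cost]
    omega

theorem search_runs {B n A w d : ℕ} {σ : State} (hi : SearchInput B n A w d σ) :
    Runs B search σ ((n * (d + 1) + A + 1) * (500 * (height d n + 1))) fun τ =>
      ∃ ord, DijResult n A w (σ.narr 0) (σ.narr 1) (1 ≤ σ.narr 11 ·) (σ.rarr 2)
        (τ.narr 13) (τ.rarr 3) ord := by
  refine Runs.mono (Runs.seq (clearQueue_runs hi.n_eq (by have := hi.lt; omega)) fun τ hτ h =>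
    Runs.seq (enterSource_runs (hi.of_frame hτ rfl) h) fun υ hυ ⟨ord, h'⟩ =>
    settleAll_runs ((hi.of_frame hτ rfl).of_frame hυ rfl) h') ?_ ?_
  · generalize height d n = H
    nlinarith [Nat.zero_le (n * d), Nat.zero_le (n * d * H), Nat.zero_le (A * H),
      Nat.zero_le (n * H)]
  · rintro τ hτ ⟨ord, h⟩
    rw [hτ.narr 0 rfl, hτ.narr 1 rfl, hτ.narr 11 rfl, hτ.rarr 2 rfl] at h
    exact ⟨ord, h⟩

/-! ## Flows of minimum cost -/

/-- An undirected network with `n` nodes, given by `A` arcs: the arcs `a` and `rv a` are the two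
directions of a link. -/
structure ArcNet (n A : ℕ) (tl hd rv : ℕ → ℕ) (cap wt : ℕ → ℝ) : Prop where
  tl_lt : ∀ a < A, tl a < n
  hd_lt : ∀ a < A, hd a < n
  rv_lt : ∀ a < A, rv a < A
  rv_rv : ∀ a < A, rv (rv a) = a
  rv_ne : ∀ a < A, rv a ≠ a
  tl_rv : ∀ a < A, tl (rv a) = hd a
  cap_rv : ∀ a < A, cap (rv a) = cap a
  wt_rv : ∀ a < A, wt (rv a) = wt a
  wt_nonneg : ∀ a < A, 0 ≤ wt a

theorem ArcNet.hd_rv {n A : ℕ} {tl hd rv : ℕ → ℕ} {cap wt : ℕ → ℝ}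
    (h : ArcNet n A tl hd rv cap wt) {a : ℕ} (ha : a < A) : hd (rv a) = tl a := by
  rw [← h.tl_rv _ (h.rv_lt a ha), h.rv_rv a ha]

/-- The change of the potential `φ` along the flow `g`. -/
noncomputable def flowSum (A : ℕ) (tl hd : ℕ → ℕ) (g : ℕ → ℕ) (φ : ℕ → ℝ) : ℝ :=
  ∑ a ∈ Finset.range A, (g a : ℝ) * (φ (hd a) - φ (tl a))

theorem flowSum_update (A : ℕ) (tl hd : ℕ → ℕ) (g : ℕ → ℕ) (φ : ℕ → ℝ) {b : ℕ} (hb : b < A)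
    (x : ℕ) : flowSum A tl hd (Function.update g b x) φ =
      flowSum A tl hd g φ + ((x : ℝ) - g b) * (φ (hd b) - φ (tl b)) := by
  rw [← sub_eq_iff_eq_add', flowSum, flowSum, ← Finset.sum_sub_distrib,
    Finset.sum_eq_single_of_mem b (Finset.mem_range.2 hb)]
  · simp; ring
  · intro a _ hab
    simp [hab]

/-- The cost, reduced by a difference `δ` of potentials, of sending `x` units along a link of weight
`W` and `y` units in the opposite direction. -/
def pairCost (W δ : ℝ) (x y : ℕ) : ℝ := W * (x + y) - δ * (x - y)

/-- For the weights reduced by the potential `π`, the flow `g` is of minimum cost on every single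
link. -/
def PairOpt (A : ℕ) (tl hd rv : ℕ → ℕ) (cap wt π : ℕ → ℝ) (g : ℕ → ℕ) : Prop :=
  ∀ a < A, ∀ x y : ℕ, (x + y : ℝ) ≤ cap a →
    pairCost (wt a) (π (hd a) - π (tl a)) (g a) (g (rv a)) ≤
      pairCost (wt a) (π (hd a) - π (tl a)) x y

/-- The arc `a` belongs to the residual network of the flow `g`. -/
def Avail (rv : ℕ → ℕ) (cap : ℕ → ℝ) (g : ℕ → ℕ) (a : ℕ) : Prop :=
  1 ≤ g (rv a) ∨ (g a : ℝ) + 1 ≤ cap a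

/-- The cost of the arc `a` in the residual network of `g`, reduced by the potential `π`. -/
noncomputable def redCost (tl hd rv : ℕ → ℕ) (wt π : ℕ → ℝ) (g : ℕ → ℕ) (a : ℕ) : ℝ :=
  (if 1 ≤ g (rv a) then -wt a else wt a) + π (tl a) - π (hd a)

section

/-! ### Optimality, cuts and augmentation of integral flows -/

variable {n A : ℕ} {tl hd rv : ℕ → ℕ} {cap wt π : ℕ → ℝ} {g : ℕ → ℕ}

/-- The argument treats each link alone. On an unused link that admits a unit, both directions have
nonnegative cost. If one direction is used, its cost per unit is at most zero; if it is negative, no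
further unit fits, so the link is saturated, and if it is zero, the capacity is irrelevant. If both
are used, the weight and the potential difference vanish. -/
theorem pairOpt_of_redCost_nonneg (hN : ArcNet n A tl hd rv cap wt)
    (h : ∀ a < A, Avail rv cap g a → 0 ≤ redCost tl hd rv wt π g a) :
    PairOpt A tl hd rv cap wt π g := by
  intro a ha x y hxy
  have h1 := h a ha
  have h2 := h (rv a) (hN.rv_lt a ha)
  have hW := hN.wt_nonneg a ha
  simp only [Avail, redCost, hN.rv_rv a ha, hN.cap_rv a ha, hN.wt_rv a ha, hN.tl_rv a ha,
    hN.hd_rv ha] at h1 h2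
  simp only [pairCost]
  set W := wt a
  set δ := π (hd a) - π (tl a) with hδ
  have hx : (0 : ℝ) ≤ x := Nat.cast_nonneg x
  have hy : (0 : ℝ) ≤ y := Nat.cast_nonneg y
  rcases Nat.eq_zero_or_pos (g a) with ha0 | ha1 <;>
    rcases Nat.eq_zero_or_pos (g (rv a)) with hr0 | hr1
  · simp only [ha0, hr0, Nat.cast_zero, zero_add, nonpos_iff_eq_zero, one_ne_zero, false_or,
      if_false] at h1 h2 ⊢
    by_cases hc : 1 ≤ cap a
    · have h1 := h1 hc
      have h2 := h2 hc
      nlinarith [mul_nonneg hx (show 0 ≤ W - δ by linarith),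
        mul_nonneg hy (show 0 ≤ W + δ by linarith)]
    · have hxy' : x + y < 1 := by exact_mod_cast hxy.trans_lt (not_le.1 hc)
      obtain ⟨rfl, rfl⟩ : x = 0 ∧ y = 0 := by omega
      simp
  · have h1 := h1 (.inl hr1)
    rw [if_pos (Nat.succ_le_of_lt hr1)] at h1
    rw [ha0, if_neg (by omega)] at h2
    rw [ha0, Nat.cast_zero]
    rcases eq_or_lt_of_le (show W ≤ -δ by linarith) with e | hlt
    · have : 0 ≤ x * W := mul_nonneg hx hW
      rw [show δ = -W by linarith]
      linarith
    · have hc : cap a < g (rv a) + 1 := by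
        by_contra hc
        have := h2 (.inr (not_lt.1 hc))
        linarith
      have hyg : (y : ℝ) ≤ g (rv a) := by
        have : y < g (rv a) + 1 := by exact_mod_cast (show (y : ℝ) < g (rv a) + 1 by linarith)
        exact_mod_cast Nat.lt_succ_iff.1 this
      nlinarith [mul_nonneg (sub_nonneg.2 hyg) (show 0 ≤ -δ - W by linarith),
        mul_nonneg hx (show 0 ≤ W - δ by linarith)]
  · have h2 := h2 (.inl ha1)
    rw [if_pos (Nat.succ_le_of_lt ha1)] at h2
    rw [hr0, if_neg (by omega)] at h1
    rw [hr0, Nat.cast_zero]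
    rcases eq_or_lt_of_le (show W ≤ δ by linarith) with e | hlt
    · have : 0 ≤ y * W := mul_nonneg hy hW
      rw [show δ = W by linarith]
      linarith
    · have hc : cap a < g a + 1 := by
        by_contra hc
        have := h1 (.inr (not_lt.1 hc))
        linarith
      have hyg : (x : ℝ) ≤ g a := by
        have : x < g a + 1 := by exact_mod_cast (show (x : ℝ) < g a + 1 by linarith)
        exact_mod_cast Nat.lt_succ_iff.1 this
      nlinarith [mul_nonneg (sub_nonneg.2 hyg) (show 0 ≤ δ - W by linarith),
        mul_nonneg hy (show 0 ≤ W + δ by linarith)]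
  · have h1 := h1 (.inl hr1)
    have h2 := h2 (.inl ha1)
    rw [if_pos (Nat.succ_le_of_lt hr1)] at h1
    rw [if_pos (Nat.succ_le_of_lt ha1)] at h2
    rw [show W = 0 by linarith, show δ = 0 by linarith]
    simp

/-- The competitor on the link is the flow after one more unit along `a`, which cancels a unit on
`rv a` if there is one. -/
theorem redCost_nonneg (h : PairOpt A tl hd rv cap wt π g)
    (hg : ∀ a < A, (g a + g (rv a) : ℝ) ≤ cap a) {a : ℕ} (ha : a < A) (hav : Avail rv cap g a) :
    0 ≤ redCost tl hd rv wt π g a := by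
  rw [redCost]
  by_cases hr : 1 ≤ g (rv a)
  · rw [if_pos hr]
    have e : ((g (rv a) - 1 : ℕ) : ℝ) = g (rv a) - 1 := by simp [Nat.cast_sub hr]
    have := h a ha (g a) (g (rv a) - 1) (by rw [e]; linarith [hg a ha])
    simp only [pairCost, e] at this
    linarith
  · rw [if_neg hr]
    have hr0 : g (rv a) = 0 := by omega
    have := h a ha (g a + 1) 0 (by
      rcases hav with hav | hav
      · exact absurd hav hr
      · push_cast; linarith)
    simp only [pairCost, hr0, Nat.cast_add, Nat.cast_one, Nat.cast_zero] at this
    linarith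

theorem sum_rv (hN : ArcNet n A tl hd rv cap wt) (F : ℕ → ℝ) :
    ∑ a ∈ Finset.range A, F (rv a) = ∑ a ∈ Finset.range A, F a := by
  refine Finset.sum_nbij' rv rv ?_ ?_ ?_ ?_ ?_ <;> intro a ha <;> rw [Finset.mem_range] at ha
  · exact Finset.mem_range.2 (hN.rv_lt a ha)
  · exact Finset.mem_range.2 (hN.rv_lt a ha)
  · exact hN.rv_rv a ha
  · exact hN.rv_rv a ha

/-- Summing the inequalities over all arcs treats each link twice, once from either side. If both
flows meet the same demands, their `flowSum` terms agree and the costs themselves are compared. -/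
theorem cost_le_of_pairOpt (hN : ArcNet n A tl hd rv cap wt) (h : PairOpt A tl hd rv cap wt π g)
    {y : ℕ → ℕ} (hy : ∀ a < A, (y a + y (rv a) : ℝ) ≤ cap a) :
    ∑ a ∈ Finset.range A, wt a * g a - flowSum A tl hd g π ≤
      ∑ a ∈ Finset.range A, wt a * y a - flowSum A tl hd y π := by
  have key : ∀ z : ℕ → ℕ, ∑ a ∈ Finset.range A,
      pairCost (wt a) (π (hd a) - π (tl a)) (z a) (z (rv a)) =
      2 * (∑ a ∈ Finset.range A, wt a * z a - flowSum A tl hd z π) := by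
    intro z
    have e := sum_rv hN fun a => wt a * z a - (z a : ℝ) * (π (hd a) - π (tl a))
    rw [flowSum, ← Finset.sum_sub_distrib, two_mul]
    nth_rewrite 2 [← e]
    rw [← Finset.sum_add_distrib]
    refine Finset.sum_congr rfl fun a ha => ?_
    have ha := Finset.mem_range.1 ha
    rw [hN.wt_rv a ha, hN.tl_rv a ha, hN.hd_rv ha, pairCost]
    ring
  have := Finset.sum_le_sum fun a ha => h a (Finset.mem_range.1 ha) (y a) (y (rv a))
    (hy a (Finset.mem_range.1 ha))
  rw [key, key] at this
  linarith

/-- If a node is not reachable in the residual network, then no flow has a larger value on the cut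
given by the reachable nodes. -/
theorem flowSum_le_of_unreachable (hN : ArcNet n A tl hd rv cap wt) {X : ℕ → Prop}
    [DecidablePred X] (hX : ∀ a < A, Avail rv cap g a → X (tl a) → X (hd a))
    {y : ℕ → ℕ} (hy : ∀ a < A, (y a + y (rv a) : ℝ) ≤ cap a) :
    flowSum A tl hd y (fun v => if X v then 0 else 1) ≤
      flowSum A tl hd g (fun v => if X v then 0 else 1) := by
  -- Max-flow min-cut as a special case of optimality: with zero weights and the potential that is
  -- `1` off `X`, an available arc has nonnegative reduced cost because none leaves `X`.
  have hN' : ArcNet n A tl hd rv cap 0 :=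
    ⟨hN.tl_lt, hN.hd_lt, hN.rv_lt, hN.rv_rv, hN.rv_ne, hN.tl_rv, hN.cap_rv, fun _ _ => rfl,
      fun _ _ => le_rfl⟩
  have := cost_le_of_pairOpt hN' (g := g) (π := fun v => if X v then 0 else 1)
    (pairOpt_of_redCost_nonneg hN' fun a ha hav => ?_) hy
  · simpa using this
  · have := hX a ha hav
    by_cases h1 : X (tl a)
    · simp [redCost, h1, this h1]
    · simp only [redCost, h1, Pi.zero_apply, neg_zero, ite_self, if_false, zero_add]
      split_ifs <;> norm_num

/-- Sends one unit along the residual arc `a`. -/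
def push (rv : ℕ → ℕ) (g : ℕ → ℕ) (a : ℕ) : ℕ → ℕ :=
  if 1 ≤ g (rv a) then Function.update g (rv a) (g (rv a) - 1) else Function.update g a (g a + 1)

theorem push_of_ne {a b : ℕ} (h : b ≠ a) (h' : b ≠ rv a) : push rv g a b = g b := by
  rw [push]; split_ifs
  · exact Function.update_of_ne h' _ _
  · exact Function.update_of_ne h _ _

theorem push_le (a b : ℕ) : push rv g a b ≤ g b + 1 := by
  rw [push]
  split_ifs
  · by_cases e : b = rv a
    · rw [e, Function.update_self]; omega
    · rw [Function.update_of_ne e]; omega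
  · by_cases e : b = a
    · rw [e, Function.update_self]
    · rw [Function.update_of_ne e]; omega

theorem flowSum_push (hN : ArcNet n A tl hd rv cap wt) {a : ℕ} (ha : a < A) (φ : ℕ → ℝ) :
    flowSum A tl hd (push rv g a) φ = flowSum A tl hd g φ + (φ (hd a) - φ (tl a)) := by
  rw [push]
  split_ifs with hr
  · rw [flowSum_update A tl hd g φ (hN.rv_lt a ha), hN.tl_rv a ha, hN.hd_rv ha, Nat.cast_sub hr]
    simp
  · rw [flowSum_update A tl hd g φ ha]
    simp

/-- A property of the values on the two directions of a link carries over to the changed flow if it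
does so for the link of the arc `a`. -/
theorem forall_push (hN : ArcNet n A tl hd rv cap wt) {a : ℕ} (ha : a < A)
    {R : ℕ → ℕ → ℕ → Prop} (hsymm : ∀ b < A, ∀ x y, R b x y → R (rv b) y x)
    (h : ∀ b < A, R b (g b) (g (rv b))) (h' : R a (push rv g a a) (push rv g a (rv a))) :
    ∀ b < A, R b (push rv g a b) (push rv g a (rv b)) := by
  intro b hb
  by_cases e : b = a
  · rw [e]; exact h'
  · by_cases e' : b = rv a
    · have := hsymm a ha _ _ h'
      rw [e', hN.rv_rv a ha]
      exact this
    · rw [push_of_ne e e', push_of_ne]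
      · exact h b hb
      · intro e''
        exact e' (by rw [← e'', hN.rv_rv b hb])
      · intro e''
        exact e (by rw [← hN.rv_rv b hb, e'', hN.rv_rv a ha])

theorem push_cap (hN : ArcNet n A tl hd rv cap wt) {a : ℕ} (ha : a < A)
    (hav : Avail rv cap g a) (hg : ∀ a < A, (g a + g (rv a) : ℝ) ≤ cap a) :
    ∀ b < A, (push rv g a b + push rv g a (rv b) : ℝ) ≤ cap b := by
  refine forall_push hN ha (R := fun b x y => (x + y : ℝ) ≤ cap b) (fun b hb x y hxy => ?_) hg ?_
  · rw [hN.cap_rv b hb]; linarith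
  · rw [push]
    split_ifs with hr
    · rw [Function.update_self, Function.update_of_ne (hN.rv_ne a ha).symm, Nat.cast_sub hr]
      push_cast
      linarith [hg a ha]
    · rw [Function.update_self, Function.update_of_ne (hN.rv_ne a ha), show g (rv a) = 0 by omega]
      push_cast
      linarith [hav.resolve_left hr]

/-- A unit pushed at reduced cost zero does not change the cost on its link, which therefore stays
minimal. -/
theorem push_pairOpt (hN : ArcNet n A tl hd rv cap wt) {a : ℕ} (ha : a < A)
    (hc : redCost tl hd rv wt π g a = 0) (hg : PairOpt A tl hd rv cap wt π g) :
    PairOpt A tl hd rv cap wt π (push rv g a) := by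
  refine forall_push hN ha (R := fun b u v => ∀ x y : ℕ, (x + y : ℝ) ≤ cap b →
    pairCost (wt b) (π (hd b) - π (tl b)) u v ≤ pairCost (wt b) (π (hd b) - π (tl b)) x y)
    (fun b hb u v huv x y hxy => ?_) hg fun x y hxy => le_trans (le_of_eq ?_) (hg a ha x y hxy)
  · have := huv y x (by rw [← hN.cap_rv b hb]; linarith)
    rw [hN.wt_rv b hb, hN.tl_rv b hb, hN.hd_rv hb]
    simp only [pairCost] at this ⊢
    linarith
  · rw [redCost] at hc
    rw [push, pairCost, pairCost]
    split_ifs at hc ⊢ with hr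
    · rw [Function.update_self, Function.update_of_ne (hN.rv_ne a ha).symm, Nat.cast_sub hr]
      push_cast
      linarith
    · rw [Function.update_self, Function.update_of_ne (hN.rv_ne a ha), show g (rv a) = 0 by omega]
      push_cast
      linarith

/-! ### Potentials after a search, and augmentation along the tree path -/

/-- The potential after a search with the given distances, capped at `D`. -/
noncomputable def newPot (π : ℕ → ℝ) (par : ℕ → ℕ) (dist : ℕ → ℝ) (D : ℝ) (v : ℕ) : ℝ :=
  π v + if 1 ≤ par v ∧ dist v ≤ D then dist v else D

theorem newPot_le (π : ℕ → ℝ) (par : ℕ → ℕ) (dist : ℕ → ℝ) (D : ℝ) (v : ℕ) :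
    newPot π par dist D v ≤ π v + D := by
  rw [newPot]
  split_ifs with h
  · linarith [h.2]
  · exact le_rfl

variable {w : ℕ} {par ord : ℕ → ℕ} {dist : ℕ → ℝ}

/-- For an arc with uncapped tail this is closedness under relaxation. For a capped or unreached
tail the potential rises by `D`, at the head by at most `D`, and the old reduced cost was
nonnegative. -/
theorem redCost_newPot_nonneg
    (hD : DijResult n A w tl hd (Avail rv cap g) (redCost tl hd rv wt π g) par dist ord) (D : ℝ)
    {a : ℕ} (ha : a < A) (hav : Avail rv cap g a) (h0 : 0 ≤ redCost tl hd rv wt π g a) :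
    0 ≤ redCost tl hd rv wt (newPot π par dist D) g a := by
  have key : redCost tl hd rv wt (newPot π par dist D) g a = redCost tl hd rv wt π g a +
      (newPot π par dist D (tl a) - π (tl a)) - (newPot π par dist D (hd a) - π (hd a)) := by
    simp only [redCost]; ring
  rw [key]
  by_cases h : 1 ≤ par (tl a) ∧ dist (tl a) ≤ D
  · obtain ⟨h1, h2⟩ := hD.closed a ha hav (by omega)
    have e : newPot π par dist D (tl a) = π (tl a) + dist (tl a) := by rw [newPot, if_pos h]
    have e' : newPot π par dist D (hd a) ≤ π (hd a) + dist (hd a) := by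
      rw [newPot]
      split_ifs with h'
      · exact le_rfl
      · have : ¬ dist (hd a) ≤ D := fun h'' => h' ⟨by omega, h''⟩
        linarith
    linarith
  · have e : newPot π par dist D (tl a) = π (tl a) + D := by rw [newPot, if_neg h]
    have := newPot_le π par dist D (hd a)
    linarith

/-- As `dist (tl a) ≤ dist (hd a) ≤ D`, neither label is capped, and tightness of the tree arc
becomes reduced cost zero. -/
theorem redCost_newPot_tree {D : ℝ} {a : ℕ} (hpar : par (tl a) ≠ 0) (hpar' : par (hd a) ≠ 0)
    (htight : dist (hd a) = dist (tl a) + redCost tl hd rv wt π g a)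
    (h0 : 0 ≤ redCost tl hd rv wt π g a) (hD : dist (hd a) ≤ D) :
    redCost tl hd rv wt (newPot π par dist D) g a = 0 := by
  have e : newPot π par dist D (tl a) = π (tl a) + dist (tl a) := by
    rw [newPot, if_pos ⟨by omega, by linarith⟩]
  have e' : newPot π par dist D (hd a) = π (hd a) + dist (hd a) := by
    rw [newPot, if_pos ⟨by omega, hD⟩]
  rw [redCost] at htight ⊢
  rw [e, e']
  linarith

/-- The flow `g` in the course of the augmentation of `g₀` along the path to `x`, from `v` on. -/
structure TraceInv (A : ℕ) (tl hd rv : ℕ → ℕ) (cap wt π : ℕ → ℝ) (ord : ℕ → ℕ) (g₀ : ℕ → ℕ)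
    (x v : ℕ) (g : ℕ → ℕ) : Prop where
  cap_le : ∀ a < A, (g a + g (rv a) : ℝ) ≤ cap a
  opt : PairOpt A tl hd rv cap wt π g
  flow : ∀ φ, flowSum A tl hd g φ = flowSum A tl hd g₀ φ + (φ x - φ v)
  same : ∀ a < A, ord (tl a) ≤ ord v → ord (hd a) ≤ ord v → g a = g₀ a
  le : ∀ a < A, g a ≤ g₀ a + 1

/-- Since `ord` strictly decreases along the traced path, no link occurs twice: the next arc and its
reversal still carry the flow `g₀`, so its availability and reduced cost may be read off `g₀`, and
no arc gains more than one unit. -/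
theorem TraceInv.push {g₀ : ℕ → ℕ} {x : ℕ} (hN : ArcNet n A tl hd rv cap wt)
    {a : ℕ} (ha : a < A)
    (h : TraceInv A tl hd rv cap wt π ord g₀ x (hd a) g) (hord : ord (tl a) < ord (hd a))
    (hav : Avail rv cap g₀ a) (hc : redCost tl hd rv wt π g₀ a = 0) :
    TraceInv A tl hd rv cap wt π ord g₀ x (tl a) (push rv g a) := by
  have e1 : g a = g₀ a := h.same a ha hord.le le_rfl
  have e2 : g (rv a) = g₀ (rv a) :=
    h.same _ (hN.rv_lt a ha) (by rw [hN.tl_rv a ha]) (by rw [hN.hd_rv ha]; exact hord.le)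
  have hav' : Avail rv cap g a := by rw [Avail, e1, e2]; exact hav
  have hc' : redCost tl hd rv wt π g a = 0 := by rw [redCost, e2]; exact hc
  refine ⟨push_cap hN ha hav' h.cap_le, push_pairOpt hN ha hc' h.opt, fun φ => ?_,
    fun b hb h1 h2 => ?_, fun b hb => ?_⟩
  · rw [flowSum_push hN ha, h.flow]; ring
  · rw [push_of_ne]
    · exact h.same b hb (by omega) (by omega)
    · rintro rfl; omega
    · rintro rfl
      rw [hN.tl_rv a ha] at h1; omega
  · by_cases hb' : b = a ∨ b = rv a
    · refine (push_le a b).trans ?_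
      rcases hb' with rfl | rfl <;> omega
    · rw [push_of_ne (fun e => hb' (.inl e)) fun e => hb' (.inr e)]
      exact h.le b hb

end

/-! ### The program -/

/-- Computes the residual network and its reduced costs. -/
def residual : Cmd :=
  .seq (.setN 8 (.lit 0)) <|
  .loop (.nle (.add (.reg 8) (.lit 1)) (.reg 19)) <|
    .seq (.ite (.rle .one (.read 5 (.read 5 (.reg 8))))
      (.seq (.storeN 11 (.reg 8) (.lit 1)) <|
       .storeR 2 (.reg 8) (.sub (.sub (.read 4 (.read 0 (.reg 8))) (.read 4 (.read 1 (.reg 8))))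
        (.read 1 (.reg 8))))
      (.ite (.rle (.add (.read 5 (.reg 8)) .one) (.read 0 (.reg 8)))
        (.seq (.storeN 11 (.reg 8) (.lit 1)) <|
         .storeR 2 (.reg 8) (.sub (.add (.read 1 (.reg 8)) (.read 4 (.read 0 (.reg 8))))
          (.read 4 (.read 1 (.reg 8)))))
        (.storeN 11 (.reg 8) (.lit 0)))) <|
    .setN 8 (.add (.reg 8) (.lit 1))

/-- Sends one unit of flow along the path found to the node in register `10`. -/
def trace : Cmd :=
  .seq (.setN 13 (.reg 10)) <|
  .loop (.not (.and (.nle (.reg 13) (.reg 3)) (.nle (.reg 3) (.reg 13)))) <|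
    .seq (.setN 18 (.sub (.read 13 (.reg 13)) (.lit 1))) <|
    .seq (.ite (.rle .one (.read 5 (.read 5 (.reg 18))))
      (.storeR 5 (.read 5 (.reg 18)) (.sub (.read 5 (.read 5 (.reg 18))) .one))
      (.storeR 5 (.reg 18) (.add (.read 5 (.reg 18)) .one))) <|
    .setN 13 (.read 0 (.reg 18))

/-- Adds the distances, capped at that of the node in register `10`, to the potential. -/
def updatePot : Cmd :=
  .seq (.setR 0 (.read 3 (.reg 10))) <|
  .seq (.setN 8 (.lit 0)) <|
  .loop (.nle (.add (.reg 8) (.lit 1)) (.reg 0)) <|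
    .seq (.ite (.and (.nle (.lit 1) (.read 13 (.reg 8))) (.rle (.read 3 (.reg 8)) (.reg 0)))
      (.storeR 4 (.reg 8) (.add (.read 4 (.reg 8)) (.read 3 (.reg 8))))
      (.storeR 4 (.reg 8) (.add (.read 4 (.reg 8)) (.reg 0)))) <|
    .setN 8 (.add (.reg 8) (.lit 1))

/-! ### Correctness and cost of one round of augmentation -/

/-- The network as stored in the memory. -/
structure NetState (B n A w d : ℕ) (σ : State) : Prop where
  n_eq : σ.nreg 0 = n
  w_eq : σ.nreg 3 = w
  d_eq : σ.nreg 9 = d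
  A_eq : σ.nreg 19 = A
  two_le : 2 ≤ d
  lt : n + d * n + d + 2 < B
  A_lt : A + 2 < B
  w_lt : w < n
  net : ArcNet n A (σ.narr 0) (σ.narr 1) (σ.narr 5) (σ.rarr 0) (σ.rarr 1)
  head_eq : ∀ v < n, σ.narr 7 v = lastArc (σ.narr 0) v A
  next_eq : ∀ a < A, σ.narr 6 a = lastArc (σ.narr 0) (σ.narr 0 a) a

/-- The program does not change the network. -/
def KeepsNet (P : Cmd) : Bool :=
  !P.writesN 0 && !P.writesN 3 && !P.writesN 9 && !P.writesN 19 && !P.storesN 0 && !P.storesN 1 &&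
    !P.storesN 5 && !P.storesN 6 && !P.storesN 7 && !P.storesR 0 && !P.storesR 1

theorem NetState.of_frame {B n A w d : ℕ} {P : Cmd} {σ τ : State}
    (h : NetState B n A w d σ) (hF : Frame P σ τ) (hP : KeepsNet P = true) :
    NetState B n A w d τ := by
  simp only [KeepsNet, Bool.and_eq_true, Bool.not_eq_true'] at hP
  obtain ⟨⟨⟨⟨⟨⟨⟨⟨⟨⟨h0, h3⟩, h9⟩, h19⟩, a0⟩, a1⟩, a5⟩, a6⟩, a7⟩, r0⟩, r1⟩ := hP
  exact ⟨(hF.nreg _ h0).trans h.n_eq, (hF.nreg _ h3).trans h.w_eq, (hF.nreg _ h9).trans h.d_eq,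
    (hF.nreg _ h19).trans h.A_eq, h.two_le, h.lt, h.A_lt, h.w_lt,
    by rw [hF.narr _ a0, hF.narr _ a1, hF.narr _ a5, hF.rarr _ r0, hF.rarr _ r1]; exact h.net,
    by rw [hF.narr _ a0, hF.narr _ a7]; exact h.head_eq,
    by rw [hF.narr _ a0, hF.narr _ a6]; exact h.next_eq⟩

/-- Real array `5` holds the feasible flow `g`, which is of minimum cost, as witnessed by the
potential in real array `4`. -/
structure FlowState (A : ℕ) (σ : State) (g : ℕ → ℕ) : Prop where
  flow_eq : ∀ a < A, σ.rarr 5 a = g a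
  cap_le : ∀ a < A, (g a + g (σ.narr 5 a) : ℝ) ≤ σ.rarr 0 a
  opt : PairOpt A (σ.narr 0) (σ.narr 1) (σ.narr 5) (σ.rarr 0) (σ.rarr 1) (σ.rarr 4) g

/-- The flow is stored in a real array because it must be compared with real capacities and words
cannot be converted; the proof keeps it tied to natural numbers `g a`. -/
theorem residual_runs {B n A w d : ℕ} {σ : State} {g : ℕ → ℕ} (hN : NetState B n A w d σ)
    (hg : ∀ a < A, σ.rarr 5 a = g a) :
    Runs B residual σ (80 * A + 10) fun τ => ∀ a < A, τ.narr 11 a ≤ 1 ∧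
      (1 ≤ τ.narr 11 a ↔ Avail (σ.narr 5) (σ.rarr 0) g a) ∧
      (1 ≤ τ.narr 11 a →
        τ.rarr 2 a = redCost (σ.narr 0) (σ.narr 1) (σ.narr 5) (σ.rarr 1) (σ.rarr 4) g a) := by
  have hlt := hN.lt
  have hAlt := hN.A_lt
  refine Runs.mono (Runs.seq (Runs.of_wp (Q := fun τ => τ = σ.setN 8 0) ?_) fun τ hF hτ =>
    Runs.loop_const (fun k ρ => ρ.nreg 8 + k = A ∧
      ∀ a < ρ.nreg 8, ρ.narr 11 a ≤ 1 ∧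
      (1 ≤ ρ.narr 11 a ↔ Avail (σ.narr 5) (σ.rarr 0) g a) ∧
      (1 ≤ ρ.narr 11 a →
        ρ.rarr 2 a = redCost (σ.narr 0) (σ.narr 1) (σ.narr 5) (σ.rarr 1) (σ.rarr 4) g a))
      (Q := fun τ => ∀ a < A, τ.narr 11 a ≤ 1 ∧
      (1 ≤ τ.narr 11 a ↔ Avail (σ.narr 5) (σ.rarr 0) g a) ∧
      (1 ≤ τ.narr 11 a →
        τ.rarr 2 a = redCost (σ.narr 0) (σ.narr 1) (σ.narr 5) (σ.rarr 1) (σ.rarr 4) g a))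
      60 (k := A) ?_ ?_) ?_ fun _ _ h => h
  · simp; omega
  · subst hτ
    rintro k ρ hρ ⟨hk, hv⟩
    have r19 : ρ.nreg 19 = A := by rw [hρ.nreg 19 rfl]; simpa using hN.A_eq
    refine ⟨by simp [r19]; omega, fun hb => ?_, fun hb => ?_⟩
    · simp only [BExpr.Holds, NExpr.eval, r19] at hb
      set a := ρ.nreg 8 with ha_def
      have ha : a < A := hb
      have e0 : ρ.narr 0 = σ.narr 0 := by rw [hρ.narr 0 rfl]; rfl
      have e1 : ρ.narr 1 = σ.narr 1 := by rw [hρ.narr 1 rfl]; rfl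
      have e5 : ρ.narr 5 = σ.narr 5 := by rw [hρ.narr 5 rfl]; rfl
      have f0 : ρ.rarr 0 = σ.rarr 0 := by rw [hρ.rarr 0 rfl]; rfl
      have f1 : ρ.rarr 1 = σ.rarr 1 := by rw [hρ.rarr 1 rfl]; rfl
      have f4 : ρ.rarr 4 = σ.rarr 4 := by rw [hρ.rarr 4 rfl]; rfl
      have f5 : ρ.rarr 5 = σ.rarr 5 := by rw [hρ.rarr 5 rfl]; rfl
      have h1 := hN.net.tl_lt a ha
      have h2 := hN.net.hd_lt a ha
      have h3 := hN.net.rv_lt a ha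
      refine (Runs.of_wp ?_).mono (Q := fun υ => ∃ k', k' + 1 ≤ k ∧ υ.nreg 8 + k' = A ∧
        ∀ a < υ.nreg 8, υ.narr 11 a ≤ 1 ∧
        (1 ≤ υ.narr 11 a ↔ Avail (σ.narr 5) (σ.rarr 0) g a) ∧
        (1 ≤ υ.narr 11 a →
          υ.rarr 2 a = redCost (σ.narr 0) (σ.narr 1) (σ.narr 5) (σ.rarr 1) (σ.rarr 4) g a))
        (show Cmd.maxCost _ ≤ 60 by decide) (fun _ _ h => h)
      simp only [Cmd.wp, BExpr.Fits, NExpr.Fits, RExpr.Fits, BExpr.Holds, NExpr.eval, RExpr.eval,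
        State.setN_nreg, State.setN_narr, State.setN_rarr, State.storeN_nreg, State.storeN_narr,
        State.storeN_rarr, State.storeR_nreg, State.storeR_narr, State.storeR_rarr,
        ← ha_def, e0, e1, e5, f0, f1, f4, f5, if_true, hg _ h3, hg a ha, Nat.one_le_cast,
        OfNat.zero_ne_ofNat, OfNat.one_ne_ofNat, if_false]
      have hB : a < B := by omega
      have hB1 : a + 1 < B := by omega
      have hfin : ∀ (x : ℕ) (arr : ℕ → ℝ), x ≤ 1 →
          (1 ≤ x ↔ Avail (σ.narr 5) (σ.rarr 0) g a) →
          (1 ≤ x → arr a = redCost (σ.narr 0) (σ.narr 1) (σ.narr 5) (σ.rarr 1) (σ.rarr 4) g a) →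
          (∀ b, b ≠ a → arr b = ρ.rarr 2 b) →
          ∃ k', k' + 1 ≤ k ∧ a + 1 + k' = A ∧ ∀ b < a + 1,
            Function.update (ρ.narr 11) a x b ≤ 1 ∧
            (1 ≤ Function.update (ρ.narr 11) a x b ↔ Avail (σ.narr 5) (σ.rarr 0) g b) ∧
            (1 ≤ Function.update (ρ.narr 11) a x b → arr b =
              redCost (σ.narr 0) (σ.narr 1) (σ.narr 5) (σ.rarr 1) (σ.rarr 4) g b) := by
        intro x arr hx hx1 hx2 harr
        refine ⟨k - 1, by omega, by omega, fun b hb' => ?_⟩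
        by_cases e : b = a
        · subst e; simp only [Function.update_self]; exact ⟨hx, hx1, hx2⟩
        · simp only [Function.update_of_ne e, harr b e]
          exact hv b (by omega)
      refine ⟨⟨trivial, hB, by omega⟩, fun hr => ⟨hB, by omega, hB,
        ⟨⟨⟨hB, by omega⟩, hB, by omega⟩, hB⟩, ⟨hB, by omega, hB1⟩, hfin _ _ le_rfl ?_ ?_ ?_⟩,
        fun hr => ⟨⟨⟨hB, trivial⟩, hB⟩, fun hc => ⟨hB, by omega, hB,
          ⟨⟨hB, hB, by omega⟩, hB, by omega⟩, ⟨hB, by omega, hB1⟩, hfin _ _ le_rfl ?_ ?_ ?_⟩,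
          fun hc => ⟨hB, by omega, ⟨hB, by omega, hB1⟩, hfin _ _ (by omega) ?_ ?_ ?_⟩⟩⟩
      · simp [Avail, hr]
      · intro _; simp [redCost, hr]; ring
      · intro b hb; simp [hb]
      · simp [Avail, hc]
      · intro _; simp [redCost, hr]
      · intro b hb; simp [hb]
      · simp [Avail, hc]; omega
      · intro h; omega
      · intro b hb; rfl
    · simp only [BExpr.Holds, NExpr.eval, r19] at hb
      exact fun v hv' => hv v (by omega)
  · subst hτ; simp
  · simp only [Cmd.maxCost, BExpr.cost, NExpr.cost]
    omega

theorem trace_runs {B n A w d x : ℕ} {σ : State} {g : ℕ → ℕ} {ord : ℕ → ℕ} {π : ℕ → ℝ}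
    (hN : NetState B n A w d σ) (hg : ∀ a < A, σ.rarr 5 a = g a) (h10 : σ.nreg 10 = x)
    (hx : x < n) (hpx : σ.narr 13 x ≠ 0)
    (hD : DijResult n A w (σ.narr 0) (σ.narr 1) (Avail (σ.narr 5) (σ.rarr 0) g)
      (redCost (σ.narr 0) (σ.narr 1) (σ.narr 5) (σ.rarr 1) π g) (σ.narr 13) (σ.rarr 3) ord)
    (h0 : ∀ a < A, Avail (σ.narr 5) (σ.rarr 0) g a →
      0 ≤ redCost (σ.narr 0) (σ.narr 1) (σ.narr 5) (σ.rarr 1) π g a)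
    (hT : TraceInv A (σ.narr 0) (σ.narr 1) (σ.narr 5) (σ.rarr 0) (σ.rarr 1)
      (newPot π (σ.narr 13) (σ.rarr 3) (σ.rarr 3 x)) ord g x x g) :
    Runs B trace σ (60 * n + 20) fun τ => ∃ g', (∀ a < A, τ.rarr 5 a = g' a) ∧
      TraceInv A (σ.narr 0) (σ.narr 1) (σ.narr 5) (σ.rarr 0) (σ.rarr 1)
        (newPot π (σ.narr 13) (σ.rarr 3) (σ.rarr 3 x)) ord g x w g' := by
  have hlt := hN.lt
  have hAlt := hN.A_lt
  have hw := hN.w_lt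
  refine Runs.mono (Runs.seq (Runs.of_wp (Q := fun τ => τ = σ.setN 13 x) ?_) fun τ hF hτ =>
    -- `ord` is below `n` at every reached node other than `w` and drops at each step, which bounds
    -- the rounds; at `w` the loop stops anyway.
    Runs.loop_const (fun k ρ => ∃ v g', ρ.nreg 13 = v ∧ v < n ∧ (v = w ∨ ord v < k) ∧
      σ.narr 13 v ≠ 0 ∧ σ.rarr 3 v ≤ σ.rarr 3 x ∧ (∀ a < A, ρ.rarr 5 a = g' a) ∧
      TraceInv A (σ.narr 0) (σ.narr 1) (σ.narr 5) (σ.rarr 0) (σ.rarr 1)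
        (newPot π (σ.narr 13) (σ.rarr 3) (σ.rarr 3 x)) ord g x v g')
      (Q := fun τ => ∃ g', (∀ a < A, τ.rarr 5 a = g' a) ∧
      TraceInv A (σ.narr 0) (σ.narr 1) (σ.narr 5) (σ.rarr 0) (σ.rarr 1)
        (newPot π (σ.narr 13) (σ.rarr 3) (σ.rarr 3 x)) ord g x w g')
      40 (k := n) ?_ ?_) ?_ fun _ _ h => h
  · simp [h10]; omega
  · subst hτ
    rintro k ρ hρ ⟨v, g', r13, hv, hk, hpv, hdv, hg', hT'⟩
    have r3 : ρ.nreg 3 = w := by rw [hρ.nreg 3 rfl]; simpa using hN.w_eq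
    refine ⟨by simp [r13, r3]; omega, fun hb => ?_, fun hb => ?_⟩
    · simp only [BExpr.Holds, NExpr.eval, r13, r3] at hb
      have hvw : v ≠ w := by rintro rfl; exact hb ⟨le_rfl, le_rfl⟩
      have hk := hk.resolve_left hvw
      obtain ⟨hov, a, ha, hpa, hav, hhd, hptl, hdist, hord⟩ := hD.tree v hv hvw hpv
      have e0 : ρ.narr 0 = σ.narr 0 := by rw [hρ.narr 0 rfl]; rfl
      have e5 : ρ.narr 5 = σ.narr 5 := by rw [hρ.narr 5 rfl]; rfl
      have e13 : ρ.narr 13 = σ.narr 13 := by rw [hρ.narr 13 rfl]; rfl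
      have h1 := hN.net.tl_lt a ha
      have h3 := hN.net.rv_lt a ha
      have hred := h0 a ha hav
      have htight := redCost_newPot_tree (D := σ.rarr 3 x) hptl (by rwa [hhd]) (by rwa [hhd])
        hred (by rwa [hhd])
      have hT'' := TraceInv.push hN.net ha (by rwa [hhd]) (by rwa [hhd]) hav htight
      refine (Runs.of_wp ?_).mono (Q := fun υ => ∃ k', k' + 1 ≤ k ∧ ∃ v g', υ.nreg 13 = v ∧
        v < n ∧ (v = w ∨ ord v < k') ∧ σ.narr 13 v ≠ 0 ∧ σ.rarr 3 v ≤ σ.rarr 3 x ∧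
        (∀ a < A, υ.rarr 5 a = g' a) ∧
        TraceInv A (σ.narr 0) (σ.narr 1) (σ.narr 5) (σ.rarr 0) (σ.rarr 1)
        (newPot π (σ.narr 13) (σ.rarr 3) (σ.rarr 3 x)) ord g x v g')
        (show Cmd.maxCost _ ≤ 40 by decide) (fun _ _ h => h)
      simp only [Cmd.wp, BExpr.Fits, NExpr.Fits, RExpr.Fits, BExpr.Holds, NExpr.eval, RExpr.eval,
        State.setN_nreg, State.setN_narr, State.setN_rarr, State.storeR_nreg, State.storeR_narr,
        State.storeR_rarr, e0, e5, e13, if_true, r13, hpa, Nat.add_sub_cancel, hg' _ h3, hg' a ha,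
        Nat.one_le_cast, Nat.reduceEqDiff, if_false]
      have hfin : ∀ arr : ℕ → ℝ, (∀ b < A, arr b = push (σ.narr 5) g' a b) →
          ∃ k', k' + 1 ≤ k ∧ ∃ v g', σ.narr 0 a = v ∧
        v < n ∧ (v = w ∨ ord v < k') ∧ σ.narr 13 v ≠ 0 ∧ σ.rarr 3 v ≤ σ.rarr 3 x ∧
        (∀ a < A, arr a = (g' a : ℝ)) ∧
        TraceInv A (σ.narr 0) (σ.narr 1) (σ.narr 5) (σ.rarr 0) (σ.rarr 1)
        (newPot π (σ.narr 13) (σ.rarr 3) (σ.rarr 3 x)) ord g x v g' := fun arr harr =>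
        ⟨k - 1, by omega, _, _, rfl, h1, .inr (by omega), hptl, by linarith, harr, hT''⟩
      refine ⟨⟨⟨by omega, by omega⟩, by omega⟩, ⟨trivial, by omega, by omega⟩,
        fun hr => ⟨⟨by omega, by omega⟩, ⟨⟨by omega, by omega⟩, trivial⟩, ⟨by omega, by omega⟩,
          hfin _ fun b hb => ?_⟩,
        fun hr => ⟨by omega, ⟨by omega, trivial⟩, ⟨by omega, by omega⟩, hfin _ fun b hb => ?_⟩⟩
      · rw [push, if_pos hr]
        by_cases e : b = σ.narr 5 a
        · rw [e, Function.update_self, Function.update_self, Nat.cast_sub hr, Nat.cast_one]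
        · rw [Function.update_of_ne e, Function.update_of_ne e, hg' b hb]
      · rw [push, if_neg hr]
        by_cases e : b = a
        · rw [e, Function.update_self, Function.update_self]; push_cast; rfl
        · rw [Function.update_of_ne e, Function.update_of_ne e, hg' b hb]
    · simp only [BExpr.Holds, NExpr.eval, r13, r3, not_not] at hb
      obtain rfl : v = w := le_antisymm hb.1 hb.2
      exact ⟨g', hg', hT'⟩
  · subst hτ
    refine ⟨x, g, by simp, hx, ?_, hpx, le_rfl, hg, hT⟩
    by_cases e : x = w
    · exact .inl e
    · exact .inr (hD.tree x hx e hpx).1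
  · simp only [Cmd.maxCost, BExpr.cost, NExpr.cost]
    omega

theorem updatePot_runs {B n A x : ℕ} {σ : State} (h0 : σ.nreg 0 = n) (hB : n + A + 2 < B)
    (h10 : σ.nreg 10 = x) (hx : x < n) (hpar : ∀ v < n, σ.narr 13 v ≤ A + 1) :
    Runs B updatePot σ (40 * n + 20) fun τ => ∀ v < n,
      τ.rarr 4 v = newPot (σ.rarr 4) (σ.narr 13) (σ.rarr 3) (σ.rarr 3 x) v := by
  refine Runs.mono (Runs.seq (Runs.of_wp (Q := fun τ => τ = σ.setR 0 (σ.rarr 3 x)) ?_)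
    fun τ hF hτ => Runs.seq (Runs.of_wp (Q := fun τ => τ = (σ.setR 0 (σ.rarr 3 x)).setN 8 0) ?_)
    fun τ' hF' hτ' =>
    -- `Frame` does not cover real registers, so the invariant itself carries the value of the cap.
    Runs.loop_const (fun k ρ => ρ.rreg 0 = σ.rarr 3 x ∧ ρ.nreg 8 + k = n ∧ ∀ v < n, ρ.rarr 4 v =
      if v < ρ.nreg 8 then newPot (σ.rarr 4) (σ.narr 13) (σ.rarr 3) (σ.rarr 3 x) v
        else σ.rarr 4 v)
      (Q := fun τ => ∀ v < n,
        τ.rarr 4 v = newPot (σ.rarr 4) (σ.narr 13) (σ.rarr 3) (σ.rarr 3 x) v)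
      30 (k := n) ?_ ?_) ?_ fun _ _ h => h
  · simp [h10]; omega
  · subst hτ; simp; omega
  · subst hτ'
    rintro k ρ hρ ⟨hr0, hk, hv⟩
    have r0 : ρ.nreg 0 = n := by rw [hρ.nreg 0 rfl]; simpa using h0
    refine ⟨by simp [r0]; omega, fun hb => ?_, fun hb => ?_⟩
    · simp only [BExpr.Holds, NExpr.eval, r0] at hb
      set i := ρ.nreg 8 with hi_def
      have e13 : ρ.narr 13 = σ.narr 13 := by rw [hρ.narr 13 rfl]; rfl
      have e3 : ρ.rarr 3 = σ.rarr 3 := by rw [hρ.rarr 3 rfl]; rfl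
      have h4 : ρ.rarr 4 i = σ.rarr 4 i := by rw [hv i hb, if_neg (lt_irrefl _)]
      have hp := hpar i hb
      refine (Runs.of_wp ?_).mono (Q := fun υ => ∃ k', k' + 1 ≤ k ∧ υ.rreg 0 = σ.rarr 3 x ∧
        υ.nreg 8 + k' = n ∧ ∀ v < n, υ.rarr 4 v =
        if v < υ.nreg 8 then newPot (σ.rarr 4) (σ.narr 13) (σ.rarr 3) (σ.rarr 3 x) v
        else σ.rarr 4 v)
        (show Cmd.maxCost _ ≤ 30 by decide) (fun _ _ h => h)
      simp only [Cmd.wp, BExpr.Fits, NExpr.Fits, RExpr.Fits, BExpr.Holds, NExpr.eval, RExpr.eval,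
        State.setN_nreg, State.setN_rreg, State.setN_rarr, State.storeR_nreg, State.storeR_rreg,
        State.storeR_rarr, ← hi_def, e13, e3, h4, hr0, if_true]
      have hfin : ∀ r : ℝ, r = newPot (σ.rarr 4) (σ.narr 13) (σ.rarr 3) (σ.rarr 3 x) i →
          ∃ k', k' + 1 ≤ k ∧ True ∧
        i + 1 + k' = n ∧ ∀ v < n, Function.update (ρ.rarr 4) i r v =
        if v < i + 1 then newPot (σ.rarr 4) (σ.narr 13) (σ.rarr 3) (σ.rarr 3 x) v
        else σ.rarr 4 v := by
        intro r hr
        refine ⟨k - 1, by omega, trivial, by omega, fun v hvn => ?_⟩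
        by_cases e : v = i
        · rw [e, Function.update_self, if_pos (Nat.lt_succ_self _), hr]
        · rw [Function.update_of_ne e, hv v hvn]
          by_cases e' : v < i
          · rw [if_pos e', if_pos (by omega)]
          · rw [if_neg e', if_neg (by omega)]
      refine ⟨⟨⟨by omega, by omega, by omega⟩, by omega, trivial⟩,
        fun h => ⟨by omega, ⟨by omega, by omega⟩, ⟨by omega, by omega, by omega⟩, hfin _ ?_⟩,
        fun h => ⟨by omega, ⟨by omega, trivial⟩, ⟨by omega, by omega, by omega⟩, hfin _ ?_⟩⟩
      · rw [newPot, if_pos h]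
      · rw [newPot, if_neg h]
    · simp only [BExpr.Holds, NExpr.eval, r0] at hb
      exact fun v hv' => by rw [hv v hv', if_pos (by omega)]
  · subst hτ'; simp
  · simp only [Cmd.maxCost, BExpr.cost, NExpr.cost, RExpr.cost]
    omega

/-- Finds shortest paths from the node in register `3` in the residual network. -/
def findPaths : Cmd := .seq residual search

theorem findPaths_runs {B n A w d : ℕ} {σ : State} {g : ℕ → ℕ} (hN : NetState B n A w d σ)
    (hg : FlowState A σ g) :
    Runs B findPaths σ ((n * (d + 1) + A + 1) * (600 * (height d n + 1))) fun τ =>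
      ∃ ord, DijResult n A w (σ.narr 0) (σ.narr 1) (Avail (σ.narr 5) (σ.rarr 0) g)
        (redCost (σ.narr 0) (σ.narr 1) (σ.narr 5) (σ.rarr 1) (σ.rarr 4) g)
        (τ.narr 13) (τ.rarr 3) ord := by
  refine Runs.mono (Runs.seq (residual_runs hN hg.flow_eq) fun τ hτ h =>
    (search_runs (n := n) (A := A) (w := w) (d := d) ?_).mono le_rfl fun υ _ ⟨ord, hD⟩ => ?_) ?_
    fun _ _ h => h
  · have hN' := hN.of_frame hτ rfl
    exact ⟨hN'.n_eq, hN'.w_eq, hN'.d_eq, hN'.A_eq, hN'.two_le, hN'.lt, hN'.A_lt, hN'.w_lt,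
      hN'.net.tl_lt, hN'.net.hd_lt, hN'.head_eq, hN'.next_eq, fun a ha => (h a ha).1,
      fun a ha hav => by
        rw [(h a ha).2.2 hav]
        exact redCost_nonneg hg.opt hg.cap_le ha ((h a ha).2.1.1 hav)⟩
  · generalize height d n = H
    nlinarith [Nat.zero_le (n * d), Nat.zero_le (n * d * H), Nat.zero_le (A * H),
      Nat.zero_le (n * H)]
  · rw [hτ.narr 0 rfl, hτ.narr 1 rfl] at hD
    refine ⟨ord, hD.par_w, hD.par_le, hD.dist_w, fun v hv hvw hp => ?_, fun a ha hav hp => ?_⟩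
    · obtain ⟨ho, a, ha, h1, h2, h3, h4, h5, h6⟩ := hD.tree v hv hvw hp
      exact ⟨ho, a, ha, h1, (h a ha).2.1.1 h2, h3, h4, by rw [← (h a ha).2.2 h2]; exact h5, h6⟩
    · have hav' := (h a ha).2.1.2 hav
      rw [← (h a ha).2.2 hav']
      exact hD.closed a ha hav' hp

/-- Augments the flow along the path found to the node in register `10`. -/
def augment : Cmd := .seq trace updatePot

theorem augment_runs {B n A w d x : ℕ} {σ : State} {g : ℕ → ℕ} {ord : ℕ → ℕ}
    (hN : NetState B n A w d σ) (hB : n + A + 2 < B) (hg : FlowState A σ g) (h10 : σ.nreg 10 = x)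
    (hx : x < n) (hpx : σ.narr 13 x ≠ 0)
    (hD : DijResult n A w (σ.narr 0) (σ.narr 1) (Avail (σ.narr 5) (σ.rarr 0) g)
      (redCost (σ.narr 0) (σ.narr 1) (σ.narr 5) (σ.rarr 1) (σ.rarr 4) g)
      (σ.narr 13) (σ.rarr 3) ord) :
    Runs B augment σ (100 * n + 40) fun τ => ∃ g', FlowState A τ g' ∧ (∀ a < A, g' a ≤ g a + 1) ∧
      ∀ φ, flowSum A (σ.narr 0) (σ.narr 1) g' φ =
        flowSum A (σ.narr 0) (σ.narr 1) g φ + (φ x - φ w) := by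
  have h0 := fun a (ha : a < A) hav => redCost_nonneg hg.opt hg.cap_le ha hav
  refine Runs.mono (Runs.seq (trace_runs hN hg.flow_eq h10 hx hpx hD h0
    -- The old flow is already optimal for the new potential, and tracing preserves this; the memory
    -- receives the new potential only afterwards.
    ⟨hg.cap_le, pairOpt_of_redCost_nonneg hN.net fun a ha hav =>
      redCost_newPot_nonneg hD _ ha hav (h0 a ha hav), fun φ => by simp, fun _ _ _ _ => rfl,
      fun _ _ => Nat.le_succ _⟩) fun τ hτ ⟨g', hg', hT⟩ =>
    (updatePot_runs (n := n) (A := A) (x := x) ?_ hB ?_ hx ?_).mono le_rfl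
      fun υ hυ hpot => ⟨g', ⟨fun a ha => ?_, fun a ha => ?_, ?_⟩, hT.le, hT.flow⟩) ?_
    fun _ _ h => h
  · rw [hτ.nreg 0 rfl]; exact hN.n_eq
  · rw [hτ.nreg 10 rfl]; exact h10
  · rw [hτ.narr 13 rfl]; exact hD.par_le
  · omega
  · rw [hυ.rarr 5 rfl]; exact hg' a ha
  · rw [hυ.narr 5 rfl, hυ.rarr 0 rfl, hτ.narr 5 rfl, hτ.rarr 0 rfl]; exact hT.cap_le a ha
  · rw [hυ.narr 0 rfl, hυ.narr 1 rfl, hυ.narr 5 rfl, hυ.rarr 0 rfl, hυ.rarr 1 rfl,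
      hτ.narr 0 rfl, hτ.narr 1 rfl, hτ.narr 5 rfl, hτ.rarr 0 rfl, hτ.rarr 1 rfl]
    rw [hτ.rarr 4 rfl, hτ.narr 13 rfl, hτ.rarr 3 rfl] at hpot
    intro a ha y z hyz
    rw [hpot _ (hN.net.hd_lt a ha), hpot _ (hN.net.tl_lt a ha)]
    exact hT.opt a ha y z hyz

/-! ## Routes and lists of arcs -/

/-- The arcs of the list lead from `x` to `v`. -/
def ArcPath (tl hd : ℕ → ℕ) : ℕ → List ℕ → ℕ → Prop
  | x, [], v => x = v
  | x, a :: l, v => tl a = x ∧ ArcPath tl hd (hd a) l v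

/-- The `i`-th node on the path which starts in `x` and consists of the arcs `l`. -/
def pathVert (hd : ℕ → ℕ) (x : ℕ) (l : List ℕ) (i : ℕ) : ℕ := (x :: l.map hd).getD i 0

section

variable {tl hd : ℕ → ℕ}

theorem ArcPath.snoc {x v a : ℕ} {l : List ℕ} (h : ArcPath tl hd x l v) (ha : tl a = v) :
    ArcPath tl hd x (l ++ [a]) (hd a) := by
  induction l generalizing x with
  | nil => exact ⟨ha.trans (Eq.symm h), rfl⟩
  | cons b l ih => exact ⟨h.1, ih h.2⟩

theorem ArcPath.sum {x v : ℕ} {l : List ℕ} (h : ArcPath tl hd x l v) (φ : ℕ → ℝ) :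
    (l.map fun a => φ (hd a) - φ (tl a)).sum = φ v - φ x := by
  induction l generalizing x with
  | nil => rw [show x = v from h]; simp
  | cons b l ih => rw [List.map_cons, List.sum_cons, ih h.2, h.1]; ring

theorem pathVert_snoc_of_le {x a i : ℕ} {l : List ℕ} (hi : i ≤ l.length) :
    pathVert hd x (l ++ [a]) i = pathVert hd x l i := by
  rw [pathVert, pathVert, List.map_append, ← List.cons_append, List.getD_append]
  simp; omega

theorem pathVert_snoc {x a : ℕ} {l : List ℕ} :
    pathVert hd x (l ++ [a]) (l.length + 1) = hd a := by
  rw [pathVert, List.map_append, ← List.cons_append, List.getD_append_right] <;> simp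

end

theorem sum_count_mul {R : Type*} [CommSemiring R] {A : ℕ} {l : List ℕ} (hl : ∀ a ∈ l, a < A)
    (F : ℕ → R) : ∑ a ∈ Finset.range A, (l.count a : R) * F a = (l.map F).sum := by
  induction l with
  | nil => simp
  | cons b l ih =>
    have hb : b < A := hl b (by simp)
    rw [List.map_cons, List.sum_cons, ← ih fun a ha => hl a (by simp [ha])]
    simp only [List.count_cons, Nat.cast_add, add_mul, Finset.sum_add_distrib]
    rw [add_comm]
    congr 1
    rw [Finset.sum_eq_single_of_mem b (Finset.mem_range.2 hb)]
    · simp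
    · intro a _ hab
      simp [hab.symm]

theorem flowSum_count {A : ℕ} {tl hd : ℕ → ℕ} {l : List ℕ} (hl : ∀ a ∈ l, a < A) {x v : ℕ}
    (h : ArcPath tl hd x l v) (φ : ℕ → ℝ) :
    flowSum A tl hd (fun a => l.count a) φ = φ v - φ x := by
  rw [flowSum, sum_count_mul hl, h.sum]

theorem flowSum_add (A : ℕ) (tl hd : ℕ → ℕ) (g g' : ℕ → ℕ) (φ : ℕ → ℝ) :
    flowSum A tl hd (fun a => g a + g' a) φ = flowSum A tl hd g φ + flowSum A tl hd g' φ := by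
  simp only [flowSum, Nat.cast_add, add_mul, Finset.sum_add_distrib]

theorem flowSum_congr {A : ℕ} {tl hd : ℕ → ℕ} {g g' : ℕ → ℕ} (h : ∀ a < A, g a = g' a)
    (φ : ℕ → ℝ) : flowSum A tl hd g φ = flowSum A tl hd g' φ :=
  Finset.sum_congr rfl fun a ha => by rw [h a (Finset.mem_range.1 ha)]

theorem flowSum_rv {n A : ℕ} {tl hd rv : ℕ → ℕ} {cap wt : ℕ → ℝ}
    (hN : ArcNet n A tl hd rv cap wt) (g : ℕ → ℕ) (φ : ℕ → ℝ) :
    flowSum A tl hd (fun a => g (rv a)) φ = -flowSum A tl hd g φ := by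
  rw [flowSum, flowSum, ← sum_rv hN, ← Finset.sum_neg_distrib]
  refine Finset.sum_congr rfl fun a ha => ?_
  have ha := Finset.mem_range.1 ha
  rw [hN.tl_rv a ha, hN.hd_rv ha, hN.rv_rv a ha]
  ring

/-- A flow which does not leave `v` has a nonnegative balance there. -/
theorem flowSum_nonneg {A : ℕ} {tl hd : ℕ → ℕ} {g : ℕ → ℕ} {v : ℕ}
    (h : ∀ a < A, tl a = v → g a = 0) :
    0 ≤ flowSum A tl hd g (fun x => if x = v then 1 else 0) := by
  refine Finset.sum_nonneg fun a ha => ?_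
  by_cases e : tl a = v
  · simp [h a (Finset.mem_range.1 ha) e]
  · simp only [e, if_false, sub_zero]
    split_ifs <;> simp

/-- The arcs are the two directions of the links of `N`. -/
structure Models {n : ℕ} (N : Network (Fin n)) (A : ℕ) (tl hd : ℕ → ℕ) (cap wt : ℕ → ℝ) :
    Prop where
  adj : ∀ a < A, ∃ u v : Fin n, tl a = u ∧ hd a = v ∧ N.graph.Adj u v ∧
    cap a = N.cap s(u, v) ∧ wt a = N.weight s(u, v)
  exists_arc : ∀ u v : Fin n, N.graph.Adj u v → ∃ a < A, tl a = u ∧ hd a = v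
  inj : ∀ a < A, ∀ b < A, tl a = tl b → hd a = hd b → a = b

section

variable {n : ℕ} {N : Network (Fin n)} {A : ℕ} {tl hd rv : ℕ → ℕ} {cap wt : ℕ → ℝ}

theorem Models.exists_arcPath (hM : Models N A tl hd cap wt) {x v : Fin n}
    (p : N.graph.Walk x v) : ∃ l : List ℕ, (∀ a ∈ l, a < A) ∧ ArcPath tl hd x l v ∧
      p.edges.map (Sym2.map Fin.val) = l.map (fun a => s(tl a, hd a)) ∧
      ((p.edges.map N.weight).sum : ℝ) = (l.map wt).sum := by
  induction p with
  | nil => exact ⟨[], by simp, rfl, rfl, by simp⟩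
  | @cons u v' v h p ih =>
    obtain ⟨l, h1, h2, h3, h4⟩ := ih
    obtain ⟨a, ha, htl, hhd⟩ := hM.exists_arc _ _ h
    refine ⟨a :: l, by simpa using ⟨ha, h1⟩, ⟨htl, by rwa [hhd]⟩, ?_, ?_⟩
    · simp [h3, htl, hhd]
    · obtain ⟨u', v'', e1, e2, -, -, e3⟩ := hM.adj a ha
      obtain rfl : u = u' := Fin.ext (htl.symm.trans e1)
      obtain rfl : v' = v'' := Fin.ext (hhd.symm.trans e2)
      simp [e3, h4]

theorem Models.exists_walk (hM : Models N A tl hd cap wt) {l : List ℕ} (hl : ∀ a ∈ l, a < A)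
    {x v : Fin n} (h : ArcPath tl hd x l v) : ∃ p : N.graph.Walk x v,
      p.edges.map (Sym2.map Fin.val) = l.map (fun a => s(tl a, hd a)) ∧
      ((p.edges.map N.weight).sum : ℝ) = (l.map wt).sum ∧ p.length = l.length ∧
      ∀ i ≤ l.length, (p.getVert i : ℕ) = pathVert hd x l i := by
  induction l generalizing x with
  | nil =>
    obtain rfl : x = v := Fin.ext h
    exact ⟨.nil, rfl, by simp, rfl, fun i hi => by
      obtain rfl : i = 0 := by simpa using hi
      simp [pathVert]⟩
  | cons a l ih =>
    obtain ⟨htl, h⟩ := h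
    obtain ⟨u, v', e1, e2, hadj, -, e3⟩ := hM.adj a (hl a (by simp))
    obtain rfl : x = u := Fin.ext (htl.symm.trans e1)
    rw [e2] at h
    obtain ⟨p, h1, h2, h3, h4⟩ := ih (fun b hb => hl b (by simp [hb])) h
    refine ⟨.cons hadj p, by simp [h1, e1, e2], by simp [h2, e3], by simp [h3], fun i hi => ?_⟩
    cases i with
    | zero => simp [pathVert]
    | succ i =>
      rw [SimpleGraph.Walk.getVert_cons_succ, h4 i (by simpa using hi)]
      simp [pathVert, e2]

/-- By injectivity of the arcs, only `a` and `rv a` lie over the link of `a`, so its traversals are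
those of the two arcs. -/
theorem count_links (hN : ArcNet n A tl hd rv cap wt) (hM : Models N A tl hd cap wt)
    {l : List ℕ} (hl : ∀ a ∈ l, a < A) {a : ℕ} (ha : a < A) :
    (l.map fun b => s(tl b, hd b)).count s(tl a, hd a) = l.count a + l.count (rv a) := by
  induction l with
  | nil => simp
  | cons b l ih =>
    have hb : b < A := hl b (by simp)
    have e : s(tl b, hd b) = s(tl a, hd a) ↔ b = a ∨ b = rv a := by
      rw [Sym2.eq_iff]
      constructor
      · rintro (⟨h1, h2⟩ | ⟨h1, h2⟩)
        · exact .inl (hM.inj b hb a ha h1 h2)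
        · exact .inr (hM.inj b hb _ (hN.rv_lt a ha) (by rw [h1, hN.tl_rv a ha])
            (by rw [h2, hN.hd_rv ha]))
      · rintro (rfl | rfl)
        · exact .inl ⟨rfl, rfl⟩
        · exact .inr ⟨hN.tl_rv a ha, hN.hd_rv ha⟩
    have hne := hN.rv_ne a ha
    rw [List.map_cons, List.count_cons, ih fun c hc => hl c (by simp [hc]), List.count_cons,
      List.count_cons]
    simp only [beq_iff_eq, e]
    by_cases h1 : b = a
    · simp [h1, hne.symm]; omega
    · by_cases h2 : b = rv a
      · simp [h2, hne]; omega
      · simp [h1, h2]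

/-- The arcs of a feasible route, with the first segment reversed. -/
theorem exists_flow_of_feasible (hN : ArcNet n A tl hd rv cap wt) (hM : Models N A tl hd cap wt)
    {s w t : Fin n} {R : Route N s w t} (hR : R.Feasible) : ∃ y : ℕ → ℕ,
      (∀ a < A, (y a + y (rv a) : ℝ) ≤ cap a) ∧
      (∀ φ, flowSum A tl hd y φ = (φ s - φ w) + (φ t - φ w)) ∧
      ∑ a ∈ Finset.range A, wt a * y a = R.length := by
  obtain ⟨l, h1, h2, h3, h4⟩ := hM.exists_arcPath R.first.reverse
  obtain ⟨l', h1', h2', h3', h4'⟩ := hM.exists_arcPath R.second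
  refine ⟨fun a => l.count a + l'.count a, fun a ha => ?_, fun φ => ?_, ?_⟩
  · obtain ⟨u, v, e1, e2, hadj, e3, -⟩ := hM.adj a ha
    have hf := hR s(u, v) (by simpa using hadj)
    have hc : R.links.count s(u, v) = l.count a + l.count (rv a) +
        (l'.count a + l'.count (rv a)) := by
      rw [← count_links hN hM h1 ha, ← count_links hN hM h1' ha, ← h3, ← h3', Route.links,
        List.count_append, ← List.count_reverse (l := R.first.edges),
        ← SimpleGraph.Walk.edges_reverse]
      have hinj : Function.Injective (Sym2.map (Fin.val : Fin n → ℕ)) :=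
        Sym2.map.injective Fin.val_injective
      have he : s(tl a, hd a) = Sym2.map Fin.val s(u, v) := by rw [e1, e2]; rfl
      rw [he, List.count_map_of_injective _ _ hinj, List.count_map_of_injective _ _ hinj]
    rw [hc] at hf
    have hf' : ((l.count a + l.count (rv a) + (l'.count a + l'.count (rv a)) : ℕ) : ℝ) ≤
        N.cap s(u, v) := by exact_mod_cast hf
    rw [e3]
    push_cast at hf' ⊢
    linarith
  · rw [flowSum_add, flowSum_count h1 h2, flowSum_count h1' h2']
  · have e : ∀ a ∈ Finset.range A, wt a * ((l.count a + l'.count a : ℕ) : ℝ) =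
        l.count a * wt a + l'.count a * wt a := fun a _ => by push_cast; ring
    rw [Finset.sum_congr rfl e, Finset.sum_add_distrib, sum_count_mul h1, sum_count_mul h1', ← h4,
      ← h4', Route.length, Route.links, List.map_append, List.sum_append,
      SimpleGraph.Walk.edges_reverse, List.map_reverse, List.sum_reverse]
    push_cast
    rfl

/-- The hypothesis on `g` leaves room for a further unit to `x`. For `φ` the indicator of the
unreached nodes, `φ w = 0` and `φ x = 1`: a feasible route would give a flow with value `φ s + φ t`
on the cut, but the cut admits at most `φ s + φ t - 1`. -/
theorem not_feasible_of_unreachable (hN : ArcNet n A tl hd rv cap wt)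
    (hM : Models N A tl hd cap wt) {s w t x : Fin n} {g : ℕ → ℕ} {par ord : ℕ → ℕ}
    {dist c : ℕ → ℝ} (hD : DijResult n A w tl hd (Avail rv cap g) c par dist ord)
    (hx : par x = 0)
    (hg : ∀ φ : ℕ → ℝ, (∀ v, 0 ≤ φ v) → φ w = 0 → flowSum A tl hd g φ + φ x ≤ φ s + φ t) :
    ¬ ∃ R : Route N s w t, R.Feasible := by
  rintro ⟨R, hR⟩
  obtain ⟨y, hy, hflow, -⟩ := exists_flow_of_feasible hN hM hR
  have h1 := flowSum_le_of_unreachable hN (g := g) (X := fun v => par v ≠ 0)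
    (fun a ha hav h => (hD.closed a ha hav h).1) hy
  have h2 := hg (fun v => if par v ≠ 0 then 0 else 1)
    (fun v => by split_ifs <;> norm_num) (by simp [hD.par_w])
  rw [hflow] at h1
  simp only [hx, hD.par_w, ne_eq, not_true, not_false_iff, if_true, if_false] at h1 h2
  linarith

/-- The route along two lists of arcs which are part of a flow of minimum cost is shortest. -/
theorem exists_isShortest (hN : ArcNet n A tl hd rv cap wt) (hM : Models N A tl hd cap wt)
    {s w t : Fin n} {g : ℕ → ℕ} {π : ℕ → ℝ} (hopt : PairOpt A tl hd rv cap wt π g)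
    (hcap : ∀ a < A, (g a + g (rv a) : ℝ) ≤ cap a)
    (hflow : ∀ φ, flowSum A tl hd g φ = (φ s - φ w) + (φ t - φ w))
    {l l' : List ℕ} (hl : ∀ a ∈ l, a < A) (hl' : ∀ a ∈ l', a < A)
    (h : ArcPath tl hd s l w) (h' : ArcPath tl hd w l' t)
    (hle : ∀ a < A, l.count (rv a) + l'.count a ≤ g a) :
    ∃ R : Route N s w t, R.IsShortest ∧ R.first.length = l.length ∧
      R.second.length = l'.length ∧
      (∀ i ≤ l.length, (R.first.getVert i : ℕ) = pathVert hd s l i) ∧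
      ∀ i ≤ l'.length, (R.second.getVert i : ℕ) = pathVert hd w l' i := by
  obtain ⟨p, h1, h2, h3, h4⟩ := hM.exists_walk hl h
  obtain ⟨p', h1', h2', h3', h4'⟩ := hM.exists_walk hl' h'
  refine ⟨⟨p, p'⟩, ⟨?_, fun R' hR' => ?_⟩, h3, h3', h4, h4'⟩
  · intro e he
    induction e with
    | _ u v =>
      obtain ⟨a, ha, e1, e2⟩ := hM.exists_arc u v (by simpa using he)
      obtain ⟨u', v', e1', e2', -, e3, -⟩ := hM.adj a ha
      obtain rfl : u = u' := Fin.ext (e1.symm.trans e1')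
      obtain rfl : v = v' := Fin.ext (e2.symm.trans e2')
      have hinj : Function.Injective (Sym2.map (Fin.val : Fin n → ℕ)) :=
        Sym2.map.injective Fin.val_injective
      have he : s(tl a, hd a) = Sym2.map Fin.val s(u, v) := by rw [e1, e2]; rfl
      have hc : (Route.mk p p').links.count s(u, v) = l.count a + l.count (rv a) +
          (l'.count a + l'.count (rv a)) := by
        rw [← count_links hN hM hl ha, ← count_links hN hM hl' ha, ← h1, ← h1', Route.links,
          List.count_append, he, List.count_map_of_injective _ _ hinj,
          List.count_map_of_injective _ _ hinj]
      have i1 := hle a ha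
      have i2 := hle (rv a) (hN.rv_lt a ha)
      rw [hN.rv_rv a ha] at i2
      have i3 : ((g a + g (rv a) : ℕ) : ℝ) ≤ N.cap s(u, v) := by
        rw [← e3]; exact_mod_cast hcap a ha
      have i4 : (((Route.mk p p').links.count s(u, v) : ℕ) : ℝ) ≤ N.cap s(u, v) :=
        le_trans (by rw [hc]; exact_mod_cast (by omega)) i3
      exact_mod_cast i4
  · obtain ⟨y, hy, hyflow, hlen⟩ := exists_flow_of_feasible hN hM hR'
    have hcost := cost_le_of_pairOpt hN hopt hy
    rw [hflow, hyflow, hlen] at hcost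
    -- An inequality suffices: flow that the route does not use has nonnegative weight.
    have hlen' : (((Route.mk p p').length : ℝ≥0) : ℝ) ≤ ∑ a ∈ Finset.range A, wt a * g a := by
      rw [Route.length, Route.links, List.map_append, List.sum_append, NNReal.coe_add]
      refine le_trans (le_of_eq (b := ∑ a ∈ Finset.range A,
        wt a * ((l.count (rv a) + l'.count a : ℕ) : ℝ)) ?_) (Finset.sum_le_sum fun a ha =>
        mul_le_mul_of_nonneg_left (by exact_mod_cast hle a (Finset.mem_range.1 ha))
          (hN.wt_nonneg a (Finset.mem_range.1 ha)))
      have e : ∀ a ∈ Finset.range A, wt a * ((l.count (rv a) + l'.count a : ℕ) : ℝ) =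
          l.count (rv a) * wt (rv a) + l'.count a * wt a := fun a ha => by
        rw [hN.wt_rv a (Finset.mem_range.1 ha)]; push_cast; ring
      rw [Finset.sum_congr rfl e, Finset.sum_add_distrib, sum_rv hN fun a => l.count a * wt a,
        sum_count_mul hl, sum_count_mul hl', ← h2, ← h2']
    have : (((Route.mk p p').length : ℝ≥0) : ℝ) ≤ R'.length := by linarith
    exact_mod_cast this

end

/-! ## Extracting the route from the flow -/

/-- Follows the flow from the node in register `11` as long as possible, and records the nodes in
word array `2` from the index in register `17` on. The arcs not yet tried are given by the word
array `c`, and `idx` is the index of the flow on the arc before the number in register `12`. -/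
def follow (c : ℕ) (idx : NExpr) : Cmd :=
  .seq (.storeN 2 (.reg 17) (.reg 11)) <|
  .loop (.nle (.lit 1) (.read c (.reg 11))) <|
    .seq (.setN 12 (.read c (.reg 11))) <|
    .ite (.rle .one (.read 5 idx))
      (.seq (.storeR 5 idx (.sub (.read 5 idx) .one)) <|
       .seq (.setN 11 (.read 1 (.sub (.reg 12) (.lit 1)))) <|
       .seq (.setN 17 (.add (.reg 17) (.lit 1))) <|
       .storeN 2 (.reg 17) (.reg 11))
      (.storeN c (.reg 11) (.read 6 (.sub (.reg 12) (.lit 1))))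

/-- The number of arcs still to be tried. -/
def untried (tl : ℕ → ℕ) (A : ℕ) (cur : ℕ → ℕ) : ℕ :=
  ((Finset.range A).filter fun a => a < cur (tl a)).card

theorem untried_le (tl : ℕ → ℕ) (A : ℕ) (cur : ℕ → ℕ) : untried tl A cur ≤ A :=
  (Finset.card_filter_le _ _).trans (by simp)

theorem untried_update {tl : ℕ → ℕ} {A : ℕ} {cur : ℕ → ℕ} {p v q : ℕ} (hp : p < A)
    (htl : tl p = v) (hcur : cur v = p + 1) (hq : q ≤ p) :
    untried tl A (Function.update cur v q) + 1 ≤ untried tl A cur := by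
  refine Nat.succ_le_of_lt (Finset.card_lt_card ?_)
  rw [Finset.ssubset_iff_of_subset]
  · refine ⟨p, ?_, ?_⟩
    · simp [hp, htl, hcur]
    · simp [htl, hq]
  · intro a ha
    simp only [Finset.mem_filter, Finset.mem_range] at ha ⊢
    by_cases e : tl a = v
    · rw [e, Function.update_self] at ha
      rw [e, hcur]
      omega
    · rwa [Function.update_of_ne e] at ha

/-- The result of following the flow `g` from `x`: a path along the arcs `l`, which ends in `v`,
and the remaining flow `g'`. -/
structure Followed (n A : ℕ) (tl hd : ℕ → ℕ) (g : ℕ → ℕ) (x v : ℕ) (l : List ℕ) (g' : ℕ → ℕ) :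
    Prop where
  lt : v < n
  arcs : ∀ a ∈ l, a < A
  path : ArcPath tl hd x l v
  rest : ∀ a < A, g' a + l.count a = g a

theorem Followed.length_le {n A : ℕ} {tl hd : ℕ → ℕ} {g : ℕ → ℕ} {x v : ℕ} {l : List ℕ}
    {g' : ℕ → ℕ} (h : Followed n A tl hd g x v l g') :
    ∑ a ∈ Finset.range A, g' a + l.length = ∑ a ∈ Finset.range A, g a := by
  have := sum_count_mul (R := ℕ) h.arcs fun _ => 1
  simp only [Nat.cast_id, mul_one, List.map_const', List.sum_replicate, smul_eq_mul] at this
  rw [← this, ← Finset.sum_add_distrib]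
  exact Finset.sum_congr rfl fun a ha => h.rest a (Finset.mem_range.1 ha)

theorem Followed.flowSum_eq {n A : ℕ} {tl hd : ℕ → ℕ} {g : ℕ → ℕ} {x v : ℕ} {l : List ℕ}
    {g' : ℕ → ℕ} (h : Followed n A tl hd g x v l g') (φ : ℕ → ℝ) :
    flowSum A tl hd g' φ = flowSum A tl hd g φ - (φ v - φ x) := by
  rw [← flowSum_congr h.rest, flowSum_add, flowSum_count h.arcs h.path]
  ring

/-- Each round uses up a unit of flow or moves a cursor past an arc without remaining flow. Flow
never increases, so skipped arcs stay empty, and at a node with exhausted cursor no flow leaves. The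
map `f`, computed by `idx`, lets the same code follow the flow or its reversal. -/
theorem follow_runs {B n A w d c x k₀ : ℕ} {idx : NExpr} {σ : State} {g f : ℕ → ℕ}
    (hN : NetState B n A w d σ) (hc : c = 8 ∨ c = 9)
    (hidx : ∀ (τ : State) (p : ℕ), τ.narr 5 = σ.narr 5 → τ.nreg 12 = p + 1 → p < A →
      idx.eval τ = f p ∧ idx.Fits B τ)
    (hf : ∀ a < A, ∀ b < A, f a = f b → a = b)
    (hg : ∀ a < A, σ.rarr 5 (f a) = g a)
    (hcur : ∀ v < n, σ.narr c v = lastArc (σ.narr 0) v A)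
    (h11 : σ.nreg 11 = x) (hx : x < n) (h17 : σ.nreg 17 = k₀)
    (hB : k₀ + ∑ a ∈ Finset.range A, g a + 2 < B) :
    Runs B (follow c idx) σ
      ((A + ∑ a ∈ Finset.range A, g a) * (4 * idx.cost + 50) + 20) fun τ =>
      ∃ v l g', Followed n A (σ.narr 0) (σ.narr 1) g x v l g' ∧ τ.nreg 11 = v ∧
        τ.nreg 17 = k₀ + l.length ∧ (∀ a < A, τ.rarr 5 (f a) = g' a) ∧
        (∀ a < A, σ.narr 0 a = v → g' a = 0) ∧
        (∀ i ≤ l.length, τ.narr 2 (k₀ + i) = pathVert (σ.narr 1) x l i) ∧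
        ∀ i < k₀, τ.narr 2 i = σ.narr 2 i := by
  have hlt := hN.lt
  have hAlt := hN.A_lt
  have h2c : (2 : ℕ) ≠ c := by omega
  have hc2 : c ≠ 2 := by omega
  refine Runs.mono (Runs.seq (Runs.of_wp (Q := fun τ => τ = σ.storeN 2 k₀ x) ?_) fun τ hF hτ =>
    Runs.loop_const (fun k ρ => ∃ v l g', Followed n A (σ.narr 0) (σ.narr 1) g x v l g' ∧
        ρ.nreg 11 = v ∧ ρ.nreg 17 = k₀ + l.length ∧ (∀ a < A, ρ.rarr 5 (f a) = g' a) ∧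
        (∀ i ≤ l.length, ρ.narr 2 (k₀ + i) = pathVert (σ.narr 1) x l i) ∧
        (∀ i < k₀, ρ.narr 2 i = σ.narr 2 i) ∧
        (∀ v < n, ∃ j ≤ A, ρ.narr c v = lastArc (σ.narr 0) v j) ∧
        (∀ a < A, ρ.narr c (σ.narr 0 a) ≤ a → g' a = 0) ∧
        untried (σ.narr 0) A (ρ.narr c) + ∑ a ∈ Finset.range A, g' a ≤ k)
      (Q := fun τ => ∃ v l g', Followed n A (σ.narr 0) (σ.narr 1) g x v l g' ∧ τ.nreg 11 = v ∧
        τ.nreg 17 = k₀ + l.length ∧ (∀ a < A, τ.rarr 5 (f a) = g' a) ∧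
        (∀ a < A, σ.narr 0 a = v → g' a = 0) ∧
        (∀ i ≤ l.length, τ.narr 2 (k₀ + i) = pathVert (σ.narr 1) x l i) ∧
        ∀ i < k₀, τ.narr 2 i = σ.narr 2 i)
      (4 * idx.cost + 40) (k := A + ∑ a ∈ Finset.range A, g a) ?_ ?_) ?_ fun _ _ h => h
  · simp [h11, h17]; omega
  · subst hτ
    rintro k ρ hρ ⟨v, l, g', hfol, r11, r17, hg', hout, hout', hptr, hdead, hk⟩
    have e0 : ρ.narr 0 = σ.narr 0 := by
      rw [hρ.narr 0 (by rcases hc with rfl | rfl <;> rfl)]; rfl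
    have e1 : ρ.narr 1 = σ.narr 1 := by
      rw [hρ.narr 1 (by rcases hc with rfl | rfl <;> rfl)]; rfl
    have e5 : ρ.narr 5 = σ.narr 5 := by
      rw [hρ.narr 5 (by rcases hc with rfl | rfl <;> rfl)]; rfl
    have e6 : ρ.narr 6 = σ.narr 6 := by
      rw [hρ.narr 6 (by rcases hc with rfl | rfl <;> rfl)]; rfl
    have hv := hfol.lt
    have hlen := hfol.length_le
    obtain ⟨j, hj, hjv⟩ := hptr v hv
    have hjA := (lastArc_le (σ.narr 0) v j).trans hj
    refine ⟨by simp [r11, hjv]; omega, fun hb => ?_, fun hb => ?_⟩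
    · simp only [BExpr.Holds, NExpr.eval, r11, hjv] at hb
      obtain ⟨p, hp⟩ : ∃ p, lastArc (σ.narr 0) v j = p + 1 := ⟨_, (Nat.sub_add_cancel hb).symm⟩
      have htl := tl_of_lastArc hp
      rw [hp] at hjv hjA
      have hpA : p < A := by omega
      have h1 := hN.net.hd_lt p hpA
      have h6 := hN.next_eq p hpA
      have h6' := lastArc_le (σ.narr 0) v p
      rw [htl] at h6
      obtain ⟨i1, f1⟩ := hidx (ρ.setN 12 (p + 1)) p e5 (by simp) hpA
      refine (Runs.of_wp ?_).mono (Q := fun υ => ∃ k', k' + 1 ≤ k ∧ ∃ v l g',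
        Followed n A (σ.narr 0) (σ.narr 1) g x v l g' ∧
        υ.nreg 11 = v ∧ υ.nreg 17 = k₀ + l.length ∧ (∀ a < A, υ.rarr 5 (f a) = g' a) ∧
        (∀ i ≤ l.length, υ.narr 2 (k₀ + i) = pathVert (σ.narr 1) x l i) ∧
        (∀ i < k₀, υ.narr 2 i = σ.narr 2 i) ∧
        (∀ v < n, ∃ j ≤ A, υ.narr c v = lastArc (σ.narr 0) v j) ∧
        (∀ a < A, υ.narr c (σ.narr 0 a) ≤ a → g' a = 0) ∧
        untried (σ.narr 0) A (υ.narr c) + ∑ a ∈ Finset.range A, g' a ≤ k')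
        (by simp only [Cmd.maxCost, BExpr.cost, NExpr.cost, RExpr.cost]; omega) (fun _ _ h => h)
      simp only [Cmd.wp, BExpr.Fits, NExpr.Fits, RExpr.Fits, BExpr.Holds, NExpr.eval, RExpr.eval,
        State.setN_nreg, State.setN_narr, State.setN_rarr, State.storeN_nreg, State.storeN_narr,
        State.storeN_rarr, State.storeR_nreg, State.storeR_narr, State.storeR_rarr,
        if_true, r11, r17, hjv, i1, f1, hg' p hpA, Nat.one_le_cast, Nat.add_sub_cancel,
        Nat.reduceEqDiff, if_false, if_neg h2c, if_neg hc2, e1, e6]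
      refine ⟨⟨by omega, by omega⟩, ⟨trivial, trivial⟩, fun hpos => ⟨trivial, ⟨trivial, trivial⟩,
        ⟨⟨by omega, by omega⟩, by omega⟩, ⟨by omega, by omega, by omega⟩, by omega, by omega, ?_⟩,
        fun hzero => ⟨by omega, ⟨⟨by omega, by omega⟩, by omega⟩, ?_⟩⟩
      · have hfol' : Followed n A (σ.narr 0) (σ.narr 1) g x (σ.narr 1 p) (l ++ [p])
            (Function.update g' p (g' p - 1)) := by
          refine ⟨h1, ?_, hfol.path.snoc htl, fun a ha => ?_⟩
          · intro a ha
            rcases List.mem_append.1 ha with ha | ha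
            · exact hfol.arcs a ha
            · rw [List.mem_singleton.1 ha]; exact hpA
          · have := hfol.rest a ha
            rw [List.count_append]
            by_cases e : a = p
            · subst e; simp; omega
            · simp [e, Ne.symm e]; omega
        have hlen' := hfol'.length_le
        rw [List.length_append, List.length_singleton] at hlen'
        refine ⟨k - 1, by omega, _, l ++ [p], _, hfol', rfl, by simp; omega, fun a ha => ?_,
          fun i hi => ?_, fun i hi => ?_, hptr, fun a ha hle => ?_, by omega⟩
        · by_cases e : a = p
          · rw [e, Function.update_self, Function.update_self, Nat.cast_sub hpos, Nat.cast_one]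
          · rw [Function.update_of_ne e, Function.update_of_ne fun h => e (hf a ha p hpA h)]
            exact hg' a ha
        · rw [List.length_append, List.length_singleton] at hi
          by_cases e : i = l.length + 1
          · rw [e, pathVert_snoc, ← add_assoc, Function.update_self]
          · rw [pathVert_snoc_of_le (by omega), Function.update_of_ne (by omega)]
            exact hout i (by omega)
        · rw [Function.update_of_ne (by omega)]
          exact hout' i hi
        · have := hdead a ha hle
          by_cases e : a = p
          · subst e; omega
          · rw [Function.update_of_ne e]; exact this
      · have hunt := untried_update (cur := ρ.narr c) hpA htl hjv
          (show σ.narr 6 p ≤ p by omega)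
        refine ⟨k - 1, by omega, v, l, g', hfol, rfl, rfl, hg', hout, hout', fun u hu => ?_,
          fun a ha hle => ?_, by omega⟩
        · by_cases e : u = v
          · rw [e, Function.update_self]; exact ⟨p, hpA.le, h6⟩
          · rw [Function.update_of_ne e]; exact hptr u hu
        · by_cases e : σ.narr 0 a = v
          · rw [e, Function.update_self, h6] at hle
            rcases lt_trichotomy a p with hap | rfl | hap
            · exact absurd e (tl_ne_of_lastArc_le hap hle)
            · omega
            · exact hdead a ha (by rw [e, hjv]; omega)
          · rw [Function.update_of_ne e] at hle
            exact hdead a ha hle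
    · simp only [BExpr.Holds, NExpr.eval, r11, hjv] at hb
      refine ⟨v, l, g', hfol, r11, r17, hg', fun a ha e => hdead a ha ?_, hout, hout'⟩
      rw [e, hjv]; omega
  · subst hτ
    have hunt := untried_le (σ.narr 0) A (σ.narr c)
    refine ⟨x, [], g, ⟨hx, by simp, rfl, by simp⟩, h11, h17, hg, fun i hi => ?_,
      fun i hi => ?_, fun v hv => ⟨A, le_rfl, ?_⟩, fun a ha hle => ?_, ?_⟩
    · obtain rfl : i = 0 := by simpa using hi
      simp [pathVert]
    · simp [hi.ne]
    · simpa [hc2] using hcur v hv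
    · simp only [State.storeN_narr, if_neg hc2] at hle
      rw [hcur _ (hN.net.tl_lt a ha)] at hle
      exact absurd rfl (tl_ne_of_lastArc_le ha hle)
    · simp only [State.storeN_narr, if_neg hc2]
      omega
  · have := Nat.mul_le_mul_left (A + ∑ a ∈ Finset.range A, g a)
      (show 1 + (1 + 1) + 1 + 1 + (4 * idx.cost + 40) ≤ 4 * idx.cost + 50 by omega)
    simp only [Cmd.maxCost, BExpr.cost, NExpr.cost]
    omega

/-- Writes a route along the flow to the output: backwards from the node in register `2`, then
forwards from where this ends. -/
def extract : Cmd :=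
  .seq (.seq (.setN 11 (.reg 2)) (.setN 17 (.lit 0))) <|
  .seq (follow 8 (.read 5 (.sub (.reg 12) (.lit 1)))) <|
  .seq (.setN 6 (.reg 17)) <|
  .seq (follow 9 (.sub (.reg 12) (.lit 1))) <|
  .seq (.setN 7 (.sub (.reg 17) (.reg 6))) (.setN 5 (.lit 1))

theorem extract_runs {B n A d : ℕ} {N : Network (Fin n)} {s w t : Fin n} {σ : State} {g : ℕ → ℕ}
    (hN : NetState B n A w d σ)
    (hM : Models N A (σ.narr 0) (σ.narr 1) (σ.rarr 0) (σ.rarr 1)) (hg : FlowState A σ g)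
    (hflow : ∀ φ, flowSum A (σ.narr 0) (σ.narr 1) g φ = (φ s - φ w) + (φ t - φ w))
    (hle : ∀ a < A, g a ≤ 2) (hB : 4 * A + 2 < B) (h2 : σ.nreg 2 = s)
    (h8 : ∀ v < n, σ.narr 8 v = lastArc (σ.narr 0) v A)
    (h9 : ∀ v < n, σ.narr 9 v = lastArc (σ.narr 0) v A) :
    Runs B extract σ (500 * A + 100) fun τ => SolvesShortestRoute N s w t τ := by
  have hlt := hN.lt
  have hs := s.isLt
  -- Two augmentations put at most two units on an arc, so each of the two walks has at most `2 * A`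
  -- steps.
  have hsum : ∑ a ∈ Finset.range A, g (σ.narr 5 a) ≤ 2 * A := by
    calc ∑ a ∈ Finset.range A, g (σ.narr 5 a) ≤ ∑ a ∈ Finset.range A, 2 :=
          Finset.sum_le_sum fun a ha => hle _ (hN.net.rv_lt a (Finset.mem_range.1 ha))
      _ = 2 * A := by simp [mul_comm]
  have hsum' : ∀ (g' : ℕ → ℕ) (l : List ℕ),
      (∀ a < A, g' a + l.count a = g (σ.narr 5 a)) →
      ∑ a ∈ Finset.range A, g' (σ.narr 5 a) ≤ 2 * A := by
    intro g' l h
    calc ∑ a ∈ Finset.range A, g' (σ.narr 5 a) ≤ ∑ a ∈ Finset.range A, 2 :=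
          Finset.sum_le_sum fun a ha => by
            have ha := Finset.mem_range.1 ha
            have h1 := h _ (hN.net.rv_lt a ha)
            have h2 := hle a ha
            rw [hN.net.rv_rv a ha] at h1
            omega
      _ = 2 * A := by simp [mul_comm]
  have hAlt := hN.A_lt
  refine Runs.mono (Runs.seq (Runs.of_wp (Q := fun τ => τ = (σ.setN 11 s).setN 17 0) ?_)
    fun τ hτ eτ => Runs.seq (follow_runs (n := n) (A := A) (w := w) (d := d) (c := 8) (x := s)
      (k₀ := 0) (g := fun a => g (σ.narr 5 a)) (f := σ.narr 5)
      (hN.of_frame hτ rfl) (.inl rfl) ?_ ?_ ?_ ?_ ?_ hs ?_ ?_)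
    fun υ hυ ⟨v, l, g', hfol, r11, r17, hg', hstuck, hout, _⟩ =>
    Runs.seq (Runs.of_wp (Q := fun τ => τ = υ.setN 6 l.length) ?_)
    fun υ' hυ' eυ => Runs.seq (Runs.mono (T' := 200 * A + 20) (follow_runs (n := n) (A := A) (w := w) (d := d) (c := 9) (x := v)
      (k₀ := l.length) (g := fun a => g' (σ.narr 5 a)) (f := fun a => a)
      (((hN.of_frame hτ rfl).of_frame hυ rfl).of_frame hυ' rfl) (.inr rfl)
      ?_ ?_ ?_ ?_ ?_ hfol.lt ?_ ?_) ?_ fun _ _ h => h)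
    fun ρ hρ ⟨v', l', g'', hfol', s11, s17, hg'', hstuck', hout', hkeep⟩ =>
    Runs.of_wp (Q := fun τ => SolvesShortestRoute N s w t τ) ?_) ?_ fun _ _ h => h
  · simp [h2]; omega
  · subst eτ
    intro τ p e5 e12 hp
    have := hN.net.rv_lt p hp
    have e5 : τ.narr 5 = σ.narr 5 := e5
    simp [e5, e12]; omega
  · intro a ha b hb e
    rw [← hN.net.rv_rv a ha, e, hN.net.rv_rv b hb]
  · subst eτ
    exact fun a ha => hg.flow_eq _ (hN.net.rv_lt a ha)
  · subst eτ; exact h8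
  · subst eτ; simp
  · subst eτ; simp
  · simp only [zero_add]; omega
  · subst eτ
    have := hfol.length_le
    simp [r17]; omega
  · intro τ p e5 e12 hp
    simp [e12]; omega
  · exact fun a _ b _ e => e
  · subst eυ eτ
    intro a ha
    have := hg' (σ.narr 5 a) (hN.net.rv_lt a ha)
    rwa [hN.net.rv_rv a ha] at this
  · subst eυ eτ
    intro u hu
    simp only [State.setN_narr]
    rw [hυ.narr 9 rfl, hυ.narr 0 rfl]
    exact h9 u hu
  · subst eυ; simpa using r11
  · subst eυ; simp [r17]
  · subst eτ
    have := hfol.length_le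
    have h' := hsum' g' l (fun a ha => hfol.rest a ha)
    omega
  · have := hsum' g' l (fun a ha => hfol.rest a ha)
    simp only [NExpr.cost]
    nlinarith
  · have hle' := hfol'.length_le
    subst eυ eτ
    have f0 : υ.narr 0 = σ.narr 0 := by rw [hυ.narr 0 rfl]; rfl
    have f1 : υ.narr 1 = σ.narr 1 := by rw [hυ.narr 1 rfl]; rfl
    simp only [State.setN_narr, f0, f1] at hfol hfol' hstuck hstuck' hout hout' hkeep
    -- No remaining reversed flow leaves `v`, so its balance there is nonnegative. With `φ` the
    -- indicator of `v` this balance is `2 * φ w - φ t - 1`, which is negative unless `v = w`.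
    have hvw : v = w := by
      have h1 := hfol.flowSum_eq fun x => if x = v then 1 else 0
      have h2 := flowSum_nonneg (hd := σ.narr 1) hstuck
      rw [flowSum_rv hN.net, hflow] at h1
      rw [h1] at h2
      by_contra hne
      simp only [if_true, if_neg (Ne.symm hne)] at h2
      split_ifs at h2 <;> norm_num at h2
    have hflow' : ∀ φ, flowSum A (σ.narr 0) (σ.narr 1) (fun a => g' (σ.narr 5 a)) φ =
        φ t - φ w := fun φ => by
      rw [flowSum_rv hN.net, hfol.flowSum_eq, flowSum_rv hN.net, hflow, hvw]
      ring
    -- The same argument for the remaining flow: its balance at `v'` is `φ t - 1` with `φ` the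
    -- indicator of `v'`, which is negative unless `v' = t`.
    have hvt : v' = t := by
      have h1 := hfol'.flowSum_eq fun x => if x = v' then 1 else 0
      have h2 := flowSum_nonneg (hd := σ.narr 1) hstuck'
      rw [hflow'] at h1
      rw [h1, hvw] at h2
      by_contra hne
      simp only [if_true, if_neg (Ne.symm hne)] at h2
      split_ifs at h2 <;> norm_num at h2
    subst hvw hvt
    obtain ⟨R, hR, e1, e2, e3, e4⟩ := exists_isShortest hN.net hM hg.opt hg.cap_le hflow hfol.arcs
      hfol'.arcs hfol.path hfol'.path (fun a ha => by
        have h1 := hfol.rest _ (hN.net.rv_lt a ha)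
        have h2 := hfol'.rest a ha
        simp only [hN.net.rv_rv a ha] at h1
        omega)
    have r6 : ρ.nreg 6 = l.length := by rw [hρ.nreg 6 rfl]; simp
    have hl : l.length + l'.length < B := by
      have h1 := hfol.length_le
      have h3 := hsum' g' l (fun a ha => hfol.rest a ha)
      omega
    simp only [Cmd.wp, NExpr.Fits, NExpr.eval, s17, r6]
    refine ⟨⟨hl, by omega⟩, by omega, .inl ⟨R, hR, by simp, ?_, ?_, fun i hi => ?_,
      fun i hi => ?_⟩⟩
    · simp [r6, e1]
    · simp [e2]
    · rw [e1] at hi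
      simp only [State.setN_narr]
      rw [e3 i hi]
      rcases hi.lt_or_eq with hi' | hi'
      · rw [hkeep i hi']
        simpa using hout i hi
      -- The second walk rewrites index `l.length` with its starting node, which is also the end of
      -- the first walk.
      · have h0 := hout' 0 (Nat.zero_le _)
        rw [add_zero, ← hi'] at h0
        rw [h0, ← e3 i hi, hi', ← e1, SimpleGraph.Walk.getVert_length]
        simp [pathVert]
    · rw [e2] at hi
      simp only [State.setN_narr]
      rw [e4 i hi, e1]
      exact hout' i hi
  · simp only [Cmd.maxCost, NExpr.cost]
    nlinarith

/-! ## The algorithm -/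

/-- Creates the arcs: the links themselves, followed by their reversals. -/
def makeArcs : Cmd :=
  .seq (.setN 8 (.lit 0)) <|
  .loop (.nle (.add (.reg 8) (.lit 1)) (.reg 1)) <|
    .seq (.storeN 0 (.add (.reg 1) (.reg 8)) (.read 1 (.reg 8))) <|
    .seq (.storeN 1 (.add (.reg 1) (.reg 8)) (.read 0 (.reg 8))) <|
    .seq (.storeN 5 (.reg 8) (.add (.reg 1) (.reg 8))) <|
    .seq (.storeN 5 (.add (.reg 1) (.reg 8)) (.reg 8)) <|
    .seq (.storeR 0 (.add (.reg 1) (.reg 8)) (.read 0 (.reg 8))) <|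
    .seq (.storeR 1 (.add (.reg 1) (.reg 8)) (.read 1 (.reg 8))) <|
    .setN 8 (.add (.reg 8) (.lit 1))

/-- Creates the linked lists of the arcs with the same tail. -/
def makeLists : Cmd :=
  .seq (.setN 8 (.lit 0)) <|
  .loop (.nle (.add (.reg 8) (.lit 1)) (.reg 19)) <|
    .seq (.storeN 6 (.reg 8) (.read 7 (.read 0 (.reg 8)))) <|
    .seq (.storeN 7 (.read 0 (.reg 8)) (.add (.reg 8) (.lit 1))) <|
    .seq (.storeN 8 (.read 0 (.reg 8)) (.add (.reg 8) (.lit 1))) <|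
    .seq (.storeN 9 (.read 0 (.reg 8)) (.add (.reg 8) (.lit 1))) <|
    .setN 8 (.add (.reg 8) (.lit 1))

/-- Prepares the data structures. -/
def setup : Cmd :=
  .seq (.seq (.setN 9 (.add (.div (.reg 1) (.reg 0)) (.lit 2)))
    (.setN 19 (.add (.reg 1) (.reg 1)))) <|
  .seq makeArcs makeLists

/-- Tests whether the node in register `10` has been reached. -/
def reached : BExpr := .nle (.lit 1) (.read 13 (.reg 10))

/-- Routes the second unit of flow, and outputs a route. -/
def secondUnit : Cmd :=
  .seq (.setN 10 (.reg 4)) <|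
  .seq findPaths <|
  .ite reached (.seq augment extract) .skip

/-- Routes the first unit of flow, and continues with the second. -/
def firstUnit : Cmd :=
  .seq (.setN 10 (.reg 2)) <|
  .seq findPaths <|
  .ite reached (.seq augment secondUnit) .skip

/-- Solves the shortest waypoint routing problem. -/
def shortestRoute : Cmd := .seq setup firstUnit

/-- The arrays hold the `m` links and their reversals. -/
structure IsDoubled (m : ℕ) (σ τ : State) : Prop where
  tl : ∀ j < m, τ.narr 0 j = σ.narr 0 j ∧ τ.narr 0 (m + j) = σ.narr 1 j
  hd : ∀ j < m, τ.narr 1 j = σ.narr 1 j ∧ τ.narr 1 (m + j) = σ.narr 0 j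
  rv : ∀ j < m, τ.narr 5 j = m + j ∧ τ.narr 5 (m + j) = j
  cap : ∀ j < m, τ.rarr 0 j = σ.rarr 0 j ∧ τ.rarr 0 (m + j) = σ.rarr 0 j
  wt : ∀ j < m, τ.rarr 1 j = σ.rarr 1 j ∧ τ.rarr 1 (m + j) = σ.rarr 1 j

theorem makeArcs_runs {B n m : ℕ} {σ : State} (h1 : σ.nreg 1 = m) (hB : n + 2 * m + 2 < B)
    (htl : ∀ j < m, σ.narr 0 j < n) (hhd : ∀ j < m, σ.narr 1 j < n) :
    Runs B makeArcs σ (60 * m + 10) fun τ => IsDoubled m σ τ := by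
  refine Runs.mono (Runs.seq (Runs.of_wp (Q := fun τ => τ = σ.setN 8 0) ?_) fun τ hF hτ =>
    Runs.loop_const (fun k ρ => ∃ i, ρ.nreg 8 = i ∧ i + k = m ∧
      (∀ j < m, ρ.narr 0 j = σ.narr 0 j ∧ ρ.narr 1 j = σ.narr 1 j ∧ ρ.rarr 0 j = σ.rarr 0 j ∧
        ρ.rarr 1 j = σ.rarr 1 j) ∧
      ∀ j < i, ρ.narr 0 (m + j) = σ.narr 1 j ∧ ρ.narr 1 (m + j) = σ.narr 0 j ∧
        ρ.narr 5 j = m + j ∧ ρ.narr 5 (m + j) = j ∧ ρ.rarr 0 (m + j) = σ.rarr 0 j ∧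
        ρ.rarr 1 (m + j) = σ.rarr 1 j)
      (Q := fun τ => IsDoubled m σ τ) 40 (k := m) ?_ ?_) ?_ fun _ _ h => h
  · simp; omega
  · subst hτ
    rintro k ρ hρ ⟨i, r8, hk, hold, hnew⟩
    have r1 : ρ.nreg 1 = m := by rw [hρ.nreg 1 rfl]; simpa using h1
    refine ⟨by simp [r1, r8]; omega, fun hb => ?_, fun hb => ?_⟩
    · simp only [BExpr.Holds, NExpr.eval, r1, r8] at hb
      have hi : i < m := hb
      obtain ⟨o0, o1, o2, o3⟩ := hold i hi
      have b0 := htl i hi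
      have b1 := hhd i hi
      refine (Runs.of_wp ?_).mono (Q := fun υ => ∃ k', k' + 1 ≤ k ∧ ∃ i, υ.nreg 8 = i ∧
        i + k' = m ∧
        (∀ j < m, υ.narr 0 j = σ.narr 0 j ∧ υ.narr 1 j = σ.narr 1 j ∧ υ.rarr 0 j = σ.rarr 0 j ∧
          υ.rarr 1 j = σ.rarr 1 j) ∧
        ∀ j < i, υ.narr 0 (m + j) = σ.narr 1 j ∧ υ.narr 1 (m + j) = σ.narr 0 j ∧
          υ.narr 5 j = m + j ∧ υ.narr 5 (m + j) = j ∧ υ.rarr 0 (m + j) = σ.rarr 0 j ∧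
          υ.rarr 1 (m + j) = σ.rarr 1 j)
        (show Cmd.maxCost _ ≤ 40 by decide) (fun _ _ h => h)
      have hne : i ≠ m + i := by omega
      have hup : Function.update (ρ.narr 0) (m + i) (σ.narr 1 i) i = σ.narr 0 i := by
        rw [Function.update_of_ne hne, o0]
      simp [r1, r8, o1, o2, o3, hup]
      refine ⟨by omega, by omega, by omega, by omega, by omega, by omega, by omega, by omega,
        by omega, by omega, by omega, by omega, k - 1, by omega, by omega, fun j hj => ?_, fun j hj => ?_⟩
      · have : j ≠ m + i := by omega
        simpa [this] using hold j hj
      · by_cases e : j = i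
        · subst e; simp [Function.update_of_ne hne]
        · have e1 : j ≠ m + i := by omega
          have e2 : m + j ≠ i := by omega
          simpa [e, e1, e2] using hnew j (by omega)
    · simp only [BExpr.Holds, NExpr.eval, r1, r8] at hb
      obtain rfl : i = m := by omega
      exact ⟨fun j hj => ⟨(hold j hj).1, (hnew j hj).1⟩,
        fun j hj => ⟨(hold j hj).2.1, (hnew j hj).2.1⟩,
        fun j hj => ⟨(hnew j hj).2.2.1, (hnew j hj).2.2.2.1⟩,
        fun j hj => ⟨(hold j hj).2.2.1, (hnew j hj).2.2.2.2.1⟩,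
        fun j hj => ⟨(hold j hj).2.2.2, (hnew j hj).2.2.2.2.2⟩⟩
  · subst hτ
    exact ⟨0, by simp, by simp, fun j hj => by simp, fun j hj => by omega⟩
  · simp only [Cmd.maxCost, BExpr.cost, NExpr.cost]
    omega

/-- Three copies of the list heads are made: array `7` serves the searches, while `8` and `9` are
consumed as cursors by the two walks of the extraction. -/
theorem makeLists_runs {B n A : ℕ} {σ : State} (h19 : σ.nreg 19 = A) (hB : n + A + 2 < B)
    (htl : ∀ j < A, σ.narr 0 j < n)
    (h0 : ∀ v < n, σ.narr 7 v = 0 ∧ σ.narr 8 v = 0 ∧ σ.narr 9 v = 0) :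
    Runs B makeLists σ (60 * A + 10) fun τ =>
      (∀ v < n, τ.narr 7 v = lastArc (σ.narr 0) v A ∧ τ.narr 8 v = lastArc (σ.narr 0) v A ∧
        τ.narr 9 v = lastArc (σ.narr 0) v A) ∧
      ∀ a < A, τ.narr 6 a = lastArc (σ.narr 0) (σ.narr 0 a) a := by
  refine Runs.mono (Runs.seq (Runs.of_wp (Q := fun τ => τ = σ.setN 8 0) ?_) fun τ hF hτ =>
    Runs.loop_const (fun k ρ => ∃ i, ρ.nreg 8 = i ∧ i + k = A ∧
      (∀ v < n, ρ.narr 7 v = lastArc (σ.narr 0) v i ∧ ρ.narr 8 v = lastArc (σ.narr 0) v i ∧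
        ρ.narr 9 v = lastArc (σ.narr 0) v i) ∧
      ∀ a < i, ρ.narr 6 a = lastArc (σ.narr 0) (σ.narr 0 a) a)
      (Q := fun τ => (∀ v < n, τ.narr 7 v = lastArc (σ.narr 0) v A ∧
        τ.narr 8 v = lastArc (σ.narr 0) v A ∧ τ.narr 9 v = lastArc (σ.narr 0) v A) ∧
        ∀ a < A, τ.narr 6 a = lastArc (σ.narr 0) (σ.narr 0 a) a)
      40 (k := A) ?_ ?_) ?_ fun _ _ h => h
  · simp; omega
  · subst hτ
    rintro k ρ hρ ⟨i, r8, hk, hhead, hnext⟩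
    have r19 : ρ.nreg 19 = A := by rw [hρ.nreg 19 rfl]; simpa using h19
    have e0 : ρ.narr 0 = σ.narr 0 := by rw [hρ.narr 0 rfl]; rfl
    refine ⟨by simp [r19, r8]; omega, fun hb => ?_, fun hb => ?_⟩
    · simp only [BExpr.Holds, NExpr.eval, r19, r8] at hb
      have hi : i < A := hb
      have b0 := htl i hi
      have hh := (hhead _ b0).1
      have hle := lastArc_le (σ.narr 0) (σ.narr 0 i) i
      refine (Runs.of_wp ?_).mono (Q := fun υ => ∃ k', k' + 1 ≤ k ∧ ∃ i, υ.nreg 8 = i ∧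
        i + k' = A ∧
        (∀ v < n, υ.narr 7 v = lastArc (σ.narr 0) v i ∧ υ.narr 8 v = lastArc (σ.narr 0) v i ∧
          υ.narr 9 v = lastArc (σ.narr 0) v i) ∧
        ∀ a < i, υ.narr 6 a = lastArc (σ.narr 0) (σ.narr 0 a) a)
        (show Cmd.maxCost _ ≤ 40 by decide) (fun _ _ h => h)
      simp [r8, e0, hh]
      refine ⟨by omega, by omega, by omega, by omega, by omega, by omega, by omega, by omega,
        k - 1, by omega, by omega, fun v hv => ?_, fun j hj => ?_⟩
      · by_cases e : v = σ.narr 0 i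
        · simp [e, lastArc]
        · simpa [e, Ne.symm e, lastArc] using hhead v hv
      · by_cases e : j = i
        · subst e; simp
        · simpa [e] using hnext j (by omega)
    · simp only [BExpr.Holds, NExpr.eval, r19, r8] at hb
      obtain rfl : i = A := by omega
      exact ⟨hhead, hnext⟩
  · subst hτ
    exact ⟨0, by simp, by simp, fun v hv => by simpa [lastArc] using h0 v hv,
      fun j hj => by omega⟩
  · simp only [Cmd.maxCost, BExpr.cost, NExpr.cost]
    omega

/-! ### The arc network built from the input -/

theorem exists_lt_or_add {m a : ℕ} (h : a < 2 * m) : ∃ j < m, a = j ∨ a = m + j := by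
  by_cases h' : a < m
  · exact ⟨a, h', .inl rfl⟩
  · exact ⟨a - m, by omega, .inr (by omega)⟩

section

variable {n m : ℕ} {N : Network (Fin n)} {ends : Fin m → Fin n × Fin n} {s w t : Fin n}
  {τ : State}

theorem isDoubled_input (h : IsDoubled m (inputState N ends s w t) τ) (j : Fin m) :
    τ.narr 0 j = (ends j).1 ∧ τ.narr 0 (m + j) = (ends j).2 ∧
    τ.narr 1 j = (ends j).2 ∧ τ.narr 1 (m + j) = (ends j).1 ∧
    τ.narr 5 j = m + j ∧ τ.narr 5 (m + j) = j ∧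
    τ.rarr 0 j = N.cap s((ends j).1, (ends j).2) ∧
    τ.rarr 0 (m + j) = N.cap s((ends j).1, (ends j).2) ∧
    τ.rarr 1 j = N.weight s((ends j).1, (ends j).2) ∧
    τ.rarr 1 (m + j) = N.weight s((ends j).1, (ends j).2) := by
  obtain ⟨h1, h2⟩ := h.tl j j.2
  obtain ⟨h3, h4⟩ := h.hd j j.2
  obtain ⟨h5, h6⟩ := h.rv j j.2
  obtain ⟨h7, h8⟩ := h.cap j j.2
  obtain ⟨h9, h10⟩ := h.wt j j.2
  refine ⟨h1.trans ?_, h2.trans ?_, h3.trans ?_, h4.trans ?_, h5, h6, h7.trans ?_, h8.trans ?_,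
    h9.trans ?_, h10.trans ?_⟩ <;> simp [inputState]

theorem IsDoubled.arcNet (h : IsDoubled m (inputState N ends s w t) τ) :
    ArcNet n (2 * m) (τ.narr 0) (τ.narr 1) (τ.narr 5) (τ.rarr 0) (τ.rarr 1) := by
  have key := isDoubled_input h
  constructor <;> intro a ha <;> obtain ⟨j, hj, e⟩ := exists_lt_or_add ha <;>
    obtain ⟨h1, h2, h3, h4, h5, h6, h7, h8, h9, h10⟩ := key ⟨j, hj⟩ <;>
    simp only at h1 h2 h3 h4 h5 h6 h7 h8 h9 h10 <;> rcases e with rfl | rfl <;>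
    simp only [h1, h2, h3, h4, h5, h6, h7, h8, h9, h10]
  all_goals first | exact Fin.isLt _ | omega | exact NNReal.coe_nonneg _

theorem IsDoubled.models (hl : IsLinkList N ends) (h : IsDoubled m (inputState N ends s w t) τ) :
    Models N (2 * m) (τ.narr 0) (τ.narr 1) (τ.rarr 0) (τ.rarr 1) := by
  have key := isDoubled_input h
  have hadj : ∀ j, N.graph.Adj (ends j).1 (ends j).2 := fun j => by
    have : s((ends j).1, (ends j).2) ∈ N.graph.edgeSet := hl.range_eq ▸ ⟨j, rfl⟩
    simpa using this
  refine ⟨fun a ha => ?_, fun u v huv => ?_, fun a ha b hb htl hhd => ?_⟩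
  · obtain ⟨j, hj, e⟩ := exists_lt_or_add ha
    obtain ⟨h1, h2, h3, h4, h5, h6, h7, h8, h9, h10⟩ := key ⟨j, hj⟩
    rcases e with rfl | rfl
    · exact ⟨_, _, h1, h3, hadj _, h7, h9⟩
    · refine ⟨_, _, h2, h4, (hadj _).symm, ?_, ?_⟩
      · rw [Sym2.eq_swap]; exact h8
      · rw [Sym2.eq_swap]; exact h10
  · have : s(u, v) ∈ Set.range fun i => s((ends i).1, (ends i).2) := by
      rw [hl.range_eq]; simpa using huv
    obtain ⟨j, hj⟩ := this
    obtain ⟨h1, h2, h3, h4, -⟩ := key j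
    have hlt := j.2
    rcases Sym2.eq_iff.1 hj with ⟨e1, e2⟩ | ⟨e1, e2⟩
    · exact ⟨j, by omega, by rw [h1, e1], by rw [h3, e2]⟩
    · exact ⟨m + j, by omega, by rw [h2, e2], by rw [h4, e1]⟩
  · obtain ⟨j, hj, e⟩ := exists_lt_or_add ha
    obtain ⟨k, hk, e'⟩ := exists_lt_or_add hb
    obtain ⟨h1, h2, h3, h4, -⟩ := key ⟨j, hj⟩
    obtain ⟨h1', h2', h3', h4', -⟩ := key ⟨k, hk⟩
    simp only at h1 h2 h3 h4 h1' h2' h3' h4'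
    have hjk : s((ends ⟨j, hj⟩).1, (ends ⟨j, hj⟩).2) = s((ends ⟨k, hk⟩).1, (ends ⟨k, hk⟩).2) →
        j = k := fun he => congrArg Fin.val (hl.injective he)
    rcases e with rfl | rfl <;> rcases e' with rfl | rfl
    · rw [h1, h1'] at htl
      rw [h3, h3'] at hhd
      exact hjk (by rw [Fin.ext htl, Fin.ext hhd])
    -- A link and a reversed link with equal ends come from the same link, which would then be a
    -- loop.
    · rw [h1, h2'] at htl
      rw [h3, h4'] at hhd
      obtain rfl := hjk (by rw [Fin.ext htl, Fin.ext hhd, Sym2.eq_swap])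
      exact absurd (Fin.ext htl) (hadj _).ne
    · rw [h2, h1'] at htl
      rw [h4, h3'] at hhd
      obtain rfl := hjk (by rw [Fin.ext htl, Fin.ext hhd, Sym2.eq_swap])
      exact absurd (Fin.ext hhd) (hadj _).ne
    · rw [h2, h2'] at htl
      rw [h4, h4'] at hhd
      rw [hjk (by rw [Fin.ext htl, Fin.ext hhd])]

end

/-! ### The two units of flow and the total cost -/

/-- The state of the memory after the preparations. -/
structure Ready (B n A d : ℕ) (N : Network (Fin n)) (s w t : Fin n) (σ : State) : Prop where
  net : NetState B n A w d σ
  models : Models N A (σ.narr 0) (σ.narr 1) (σ.rarr 0) (σ.rarr 1)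
  s_eq : σ.nreg 2 = s
  t_eq : σ.nreg 4 = t
  answer : σ.nreg 5 = 0
  cur_eq : ∀ v < n, σ.narr 8 v = lastArc (σ.narr 0) v A
  cur_eq' : ∀ v < n, σ.narr 9 v = lastArc (σ.narr 0) v A
  lt : 4 * A + n + 2 < B

/-- The program keeps what has been prepared. -/
def KeepsReady (P : Cmd) : Bool :=
  KeepsNet P && (!P.writesN 2 && !P.writesN 4 && !P.writesN 5 && !P.storesN 0 && !P.storesN 1 &&
    !P.storesN 8 && !P.storesN 9 && !P.storesR 0 && !P.storesR 1)

theorem Ready.of_frame {B n A d : ℕ} {N : Network (Fin n)} {s w t : Fin n} {P : Cmd}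
    {σ τ : State} (h : Ready B n A d N s w t σ) (hF : Frame P σ τ) (hP : KeepsReady P = true) :
    Ready B n A d N s w t τ := by
  rw [KeepsReady, Bool.and_eq_true] at hP
  obtain ⟨hP, hP'⟩ := hP
  simp only [Bool.and_eq_true, Bool.not_eq_true'] at hP'
  obtain ⟨⟨⟨⟨⟨⟨⟨⟨h2, h4⟩, h5⟩, a0⟩, a1⟩, a8⟩, a9⟩, r0⟩, r1⟩ := hP'
  exact ⟨h.net.of_frame hF hP,
    by rw [hF.narr _ a0, hF.narr _ a1, hF.rarr _ r0, hF.rarr _ r1]; exact h.models,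
    (hF.nreg _ h2).trans h.s_eq, (hF.nreg _ h4).trans h.t_eq, (hF.nreg _ h5).trans h.answer,
    by rw [hF.narr _ a0, hF.narr _ a8]; exact h.cur_eq,
    by rw [hF.narr _ a0, hF.narr _ a9]; exact h.cur_eq', h.lt⟩

theorem FlowState.of_frame {A : ℕ} {P : Cmd} {σ τ : State} {g : ℕ → ℕ} (h : FlowState A σ g)
    (hF : Frame P σ τ) (a0 : P.storesN 0 = false) (a1 : P.storesN 1 = false)
    (a5 : P.storesN 5 = false) (r0 : P.storesR 0 = false) (r1 : P.storesR 1 = false)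
    (r4 : P.storesR 4 = false) (r5 : P.storesR 5 = false) : FlowState A τ g :=
  ⟨by rw [hF.rarr _ r5]; exact h.flow_eq, by rw [hF.narr _ a5, hF.rarr _ r0]; exact h.cap_le,
    by rw [hF.narr _ a0, hF.narr _ a1, hF.narr _ a5, hF.rarr _ r0, hF.rarr _ r1, hF.rarr _ r4]
       exact h.opt⟩

/-- A bound for the running time of the search for shortest paths. -/
def searchTime (n A d : ℕ) : ℕ := (n * (d + 1) + A + 1) * (600 * (height d n + 1))

theorem secondUnit_runs {B n A d : ℕ} {N : Network (Fin n)} {s w t : Fin n} {σ : State}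
    {g : ℕ → ℕ} (h : Ready B n A d N s w t σ) (hg : FlowState A σ g) (hle : ∀ a < A, g a ≤ 1)
    (hflow : ∀ φ, flowSum A (σ.narr 0) (σ.narr 1) g φ = φ s - φ w) :
    Runs B secondUnit σ (searchTime n A d + 100 * n + 500 * A + 200)
      fun τ => SolvesShortestRoute N s w t τ := by
  have hlt := h.lt
  have ht := t.isLt
  refine Runs.mono (Runs.seq (Runs.of_wp (Q := fun τ => τ = σ.setN 10 t) ?_) fun τ hτ eτ =>
    Runs.seq (findPaths_runs (h.net.of_frame hτ rfl)
      (hg.of_frame hτ rfl rfl rfl rfl rfl rfl rfl)) fun υ hυ ⟨ord, hD⟩ =>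
    Runs.ite (T := 100 * n + 40 + (500 * A + 100))
      (Q := fun τ => SolvesShortestRoute N s w t τ) ?_ (fun hb => ?_) fun hb => ?_) ?_
      fun _ _ h => h
  · simp [h.t_eq]; omega
  · have r10 : υ.nreg 10 = t := by rw [hυ.nreg 10 rfl, eτ]; simp
    have hpar := hD.par_le t ht
    simp [reached, r10]; omega
  · have r10 : υ.nreg 10 = t := by rw [hυ.nreg 10 rfl, eτ]; simp
    simp only [reached, BExpr.Holds, NExpr.eval, r10] at hb
    have hR : Ready B n A d N s w t υ := (h.of_frame hτ rfl).of_frame hυ rfl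
    have hg' : FlowState A υ g :=
      (hg.of_frame hτ rfl rfl rfl rfl rfl rfl rfl).of_frame hυ rfl rfl rfl rfl rfl rfl rfl
    rw [← hυ.narr 0 rfl, ← hυ.narr 1 rfl, ← hυ.narr 5 rfl, ← hυ.rarr 0 rfl, ← hυ.rarr 1 rfl,
      ← hυ.rarr 4 rfl] at hD
    have e0 : υ.narr 0 = σ.narr 0 := by rw [hυ.narr 0 rfl, eτ]; rfl
    have e1 : υ.narr 1 = σ.narr 1 := by rw [hυ.narr 1 rfl, eτ]; rfl
    refine Runs.seq (augment_runs hR.net (by omega) hg' r10 ht (by omega) hD)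
      fun ρ hρ ⟨g', hgρ, hle', hflow'⟩ => ?_
    have hRρ := hR.of_frame hρ rfl
    refine extract_runs hRρ.net hRρ.models hgρ (fun φ => ?_) (fun a ha => ?_) (by omega) hRρ.s_eq
      hRρ.cur_eq hRρ.cur_eq'
    · rw [hρ.narr 0 rfl, hρ.narr 1 rfl, hflow', e0, e1, hflow]
    · have := hle a ha
      have := hle' a ha
      omega
  · have r10 : υ.nreg 10 = t := by rw [hυ.nreg 10 rfl, eτ]; simp
    simp only [reached, BExpr.Holds, NExpr.eval, r10] at hb
    refine (Runs.of_wp (P := .skip) ?_).mono (by simp only [Cmd.maxCost]; omega) fun _ _ h => h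
    subst eτ
    -- Register `5` still holds its initial `0`, which is the answer that no route exists.
    refine .inr ⟨not_feasible_of_unreachable h.net.net h.models hD (x := t) (by omega)
      fun φ _ hw => ?_, ((h.of_frame hτ rfl).of_frame hυ rfl).answer⟩
    rw [hflow, hw, sub_zero]
  · simp only [Cmd.maxCost, reached, BExpr.cost, NExpr.cost, searchTime]
    omega

theorem firstUnit_runs {B n A d : ℕ} {N : Network (Fin n)} {s w t : Fin n} {σ : State}
    (h : Ready B n A d N s w t σ) (hg : FlowState A σ fun _ => 0) :
    Runs B firstUnit σ (2 * searchTime n A d + 200 * n + 500 * A + 300)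
      fun τ => SolvesShortestRoute N s w t τ := by
  have hlt := h.lt
  have hs := s.isLt
  refine Runs.mono (Runs.seq (Runs.of_wp (Q := fun τ => τ = σ.setN 10 s) ?_) fun τ hτ eτ =>
    Runs.seq (findPaths_runs (h.net.of_frame hτ rfl)
      (hg.of_frame hτ rfl rfl rfl rfl rfl rfl rfl)) fun υ hυ ⟨ord, hD⟩ =>
    Runs.ite (T := 100 * n + 40 + (searchTime n A d + 100 * n + 500 * A + 200))
      (Q := fun τ => SolvesShortestRoute N s w t τ) ?_ (fun hb => ?_) fun hb => ?_) ?_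
      fun _ _ h => h
  · simp [h.s_eq]; omega
  · have r10 : υ.nreg 10 = s := by rw [hυ.nreg 10 rfl, eτ]; simp
    have hpar := hD.par_le s hs
    simp [reached, r10]; omega
  · have r10 : υ.nreg 10 = s := by rw [hυ.nreg 10 rfl, eτ]; simp
    simp only [reached, BExpr.Holds, NExpr.eval, r10] at hb
    have hR : Ready B n A d N s w t υ := (h.of_frame hτ rfl).of_frame hυ rfl
    have hg' : FlowState A υ fun _ => 0 :=
      (hg.of_frame hτ rfl rfl rfl rfl rfl rfl rfl).of_frame hυ rfl rfl rfl rfl rfl rfl rfl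
    rw [← hυ.narr 0 rfl, ← hυ.narr 1 rfl, ← hυ.narr 5 rfl, ← hυ.rarr 0 rfl, ← hυ.rarr 1 rfl,
      ← hυ.rarr 4 rfl] at hD
    refine Runs.seq (augment_runs hR.net (by omega) hg' r10 hs (by omega) hD)
      fun ρ hρ ⟨g', hgρ, hle', hflow'⟩ => ?_
    refine secondUnit_runs (hR.of_frame hρ rfl) hgρ (fun a ha => by simpa using hle' a ha)
      fun φ => ?_
    rw [hρ.narr 0 rfl, hρ.narr 1 rfl, hflow']
    simp [flowSum]
  · have r10 : υ.nreg 10 = s := by rw [hυ.nreg 10 rfl, eτ]; simp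
    simp only [reached, BExpr.Holds, NExpr.eval, r10] at hb
    refine (Runs.of_wp (P := .skip) ?_).mono (by simp only [Cmd.maxCost]; omega) fun _ _ h => h
    subst eτ
    refine .inr ⟨not_feasible_of_unreachable h.net.net h.models hD (x := s) (by omega)
      fun φ hφ _ => ?_, ((h.of_frame hτ rfl).of_frame hυ rfl).answer⟩
    simpa [flowSum] using hφ t
  · simp only [Cmd.maxCost, reached, BExpr.cost, NExpr.cost, searchTime]
    omega

theorem setup_runs {B n m : ℕ} {N : Network (Fin n)} {ends : Fin m → Fin n × Fin n}
    (hl : IsLinkList N ends) (s w t : Fin n) (hB : 8 * m + 3 * n + 6 < B) :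
    Runs B setup (inputState N ends s w t) (200 * m + 50) fun τ =>
      Ready B n (2 * m) (m / n + 2) N s w t τ ∧ FlowState (2 * m) τ fun _ => 0 := by
  set σ := inputState N ends s w t with hσ
  have hn : 0 < n := (Nat.zero_le _).trans_lt s.isLt
  -- The summand `2` ensures arity at least two even when `m < n`; the product with `n` stays
  -- linear, for the running time as well as for the word size.
  have hdn : (m / n + 2) * n ≤ m + 2 * n := by
    rw [add_mul]; exact Nat.add_le_add_right (Nat.div_mul_le_self m n) _
  have hd : m / n ≤ m := Nat.div_le_self m n
  have htl : ∀ j < m, σ.narr 0 j < n := fun j hj => by simp [hσ, inputState, hj]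
  have hhd : ∀ j < m, σ.narr 1 j < n := fun j hj => by simp [hσ, inputState, hj]
  refine Runs.mono (Runs.seq (Runs.of_wp
    (Q := fun τ => τ = (σ.setN 9 (m / n + 2)).setN 19 (2 * m)) ?_) fun τ hτ eτ =>
    Runs.seq (makeArcs_runs (n := n) (m := m) ?_ (by omega) ?_ ?_) fun υ hυ hdbl =>
    (makeLists_runs (n := n) (A := 2 * m) ?_ (by omega) ?_ ?_).mono
    (Q' := fun τ => Ready B n (2 * m) (m / n + 2) N s w t τ ∧ FlowState (2 * m) τ fun _ => 0)
    le_rfl fun ρ hρ ⟨hheads, hnext⟩ => ?_) ?_ fun _ _ h => h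
  · simp [hσ, inputState, two_mul]; omega
  · subst eτ; simp [hσ, inputState]
  · subst eτ; exact htl
  · subst eτ; exact hhd
  · rw [hυ.nreg 19 rfl, eτ]; simp
  · subst eτ
    have hdbl' : IsDoubled m (inputState N ends s w t) υ := ⟨hdbl.1, hdbl.2, hdbl.3, hdbl.4, hdbl.5⟩
    exact hdbl'.arcNet.tl_lt
  · subst eτ
    intro v _
    rw [hυ.narr 7 rfl, hυ.narr 8 rfl, hυ.narr 9 rfl]
    simp [hσ, inputState]
  · subst eτ
    have hdbl' : IsDoubled m (inputState N ends s w t) ρ := by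
      constructor <;> simp only [hρ.narr 0 rfl, hρ.narr 1 rfl, hρ.narr 5 rfl, hρ.rarr 0 rfl,
        hρ.rarr 1 rfl]
      exacts [hdbl.1, hdbl.2, hdbl.3, hdbl.4, hdbl.5]
    rw [← hρ.narr 0 rfl] at hheads hnext
    have hreg : ∀ x, makeLists.writesN x = false → makeArcs.writesN x = false →
        x ≠ 9 → x ≠ 19 → ρ.nreg x = σ.nreg x := fun x h1 h2 h3 h4 => by
      rw [hρ.nreg x h1, hυ.nreg x h2]; simp [h3, h4]
    refine ⟨⟨⟨?_, ?_, ?_, ?_, Nat.le_add_left _ _, by omega, by omega, w.isLt, hdbl'.arcNet,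
      fun v hv => (hheads v hv).1, hnext⟩, hdbl'.models hl, ?_, ?_, ?_,
      fun v hv => (hheads v hv).2.1, fun v hv => (hheads v hv).2.2, by omega⟩, ?_, ?_, ?_⟩
    · rw [hreg 0 rfl rfl (by omega) (by omega)]; rfl
    · rw [hreg 3 rfl rfl (by omega) (by omega)]; rfl
    · rw [hρ.nreg 9 rfl, hυ.nreg 9 rfl]; simp
    · rw [hρ.nreg 19 rfl, hυ.nreg 19 rfl]; simp
    · rw [hreg 2 rfl rfl (by omega) (by omega)]; rfl
    · rw [hreg 4 rfl rfl (by omega) (by omega)]; rfl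
    · rw [hreg 5 rfl rfl (by omega) (by omega)]; rfl
    -- The zero-initialised arrays hold the zero flow and the zero potential, which certifies
    -- optimality because weights are nonnegative.
    · intro a _
      rw [hρ.rarr 5 rfl, hυ.rarr 5 rfl]
      simp [hσ, inputState]
    · intro a ha
      obtain ⟨u, v, -, -, -, e, -⟩ := (hdbl'.models hl).adj a ha
      rw [e]; simp
    · have hpot : ∀ v, ρ.rarr 4 v = 0 := fun v => by
        rw [hρ.rarr 4 rfl, hυ.rarr 4 rfl]
        simp [hσ, inputState]
      intro a ha x y _
      have hw := hdbl'.arcNet.wt_nonneg a ha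
      simp only [pairCost, hpot, Nat.cast_zero]
      have : 0 ≤ ρ.rarr 1 a * (x + y) := by positivity
      linarith
  · simp only [Cmd.maxCost, NExpr.cost]
    omega

theorem shortestRoute_runs {n m : ℕ} {N : Network (Fin n)} {ends : Fin m → Fin n × Fin n}
    (hl : IsLinkList N ends) (s w t : Fin n) :
    Runs ((n + m + 2) ^ 4) shortestRoute (inputState N ends s w t)
      (10000 * ((n + m) * (Nat.log (m / n + 2) n + 2)))
      fun τ => SolvesShortestRoute N s w t τ := by
  have hn : 0 < n := (Nat.zero_le _).trans_lt s.isLt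
  have hdn : (m / n) * n ≤ m := Nat.div_mul_le_self m n
  -- As `n` is positive, the base is at least `3`, so the fourth power is at least `27` times the
  -- base.
  have hB : 8 * m + 3 * n + 6 < (n + m + 2) ^ 4 := by
    have : 3 ^ 3 * (n + m + 2) ≤ (n + m + 2) ^ 3 * (n + m + 2) :=
      Nat.mul_le_mul_right _ (Nat.pow_le_pow_left (by omega) 3)
    rw [pow_succ]
    omega
  refine Runs.mono (Runs.seq (setup_runs hl s w t hB) fun τ _ h => firstUnit_runs h.1 h.2) ?_
    fun _ _ h => h
  rw [searchTime, height]
  generalize Nat.log (m / n + 2) n = H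
  have h1 : n * (m / n + 2 + 1) + 2 * m + 1 ≤ 4 * (n + m) := by nlinarith
  have h2 := Nat.mul_le_mul_right (600 * (H + 1 + 1)) h1
  nlinarith [Nat.zero_le (n * H), Nat.zero_le (m * H)]

end RAM

/-! ## The running time -/

/-- For `n ≤ m` the arity is at least `1 + m / n`, and `1 + m / n ≤ n ^ 2` makes the logarithm at
least `1 / 2`, which absorbs additive constants. For `m < n` the arity is `2`, and `log (1 + x) ≤ x`
gives `n * log n ≤ m * logb (1 + m / n) n`; so the claimed bound pays for work on all nodes even
when links are few. -/
theorem add_mul_natLog_le {n m : ℕ} (hn : 2 ≤ n) (hm : 1 ≤ m) (hmn : m ≤ n * n) :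
    (((n + m) * (Nat.log (m / n + 2) n + 2) : ℕ) : ℝ) ≤
      12 * (m * Real.logb (1 + m / n) n) := by
  have hnR : (2 : ℝ) ≤ n := by exact_mod_cast hn
  have hmR : (1 : ℝ) ≤ m := by exact_mod_cast hm
  have hn0 : (0 : ℝ) < n := by linarith
  have hx : (0 : ℝ) < m / n := by positivity
  have hlogn : 0 < Real.log n := Real.log_pos (by linarith)
  have hlogx : 0 < Real.log (1 + m / n) := Real.log_pos (by linarith)
  have hL : Real.logb (1 + m / n) n = Real.log n / Real.log (1 + m / n) := rfl
  push_cast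
  rcases le_or_gt n m with h | h
  · have hd : (1 + m / n : ℝ) ≤ ((m / n + 2 : ℕ) : ℝ) := by
      have : (m : ℝ) / n < (m / n : ℕ) + 1 := by
        rw [div_lt_iff₀ hn0]
        exact_mod_cast (by rw [mul_comm]; exact Nat.lt_mul_div_succ m (by omega))
      push_cast
      linarith
    have h1 : (Nat.log (m / n + 2) n : ℝ) ≤ Real.logb (1 + m / n) n := by
      refine (Real.natLog_le_logb n (m / n + 2)).trans ?_
      rw [Real.logb, Real.logb]
      exact div_le_div_of_nonneg_left hlogn.le hlogx (Real.log_le_log (by linarith) hd)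
    have h2 : 1 / 2 ≤ Real.logb (1 + m / n) n := by
      rw [hL, div_le_div_iff₀ (by norm_num) hlogx]
      have hle : (1 + m / n : ℝ) ≤ (n : ℝ) ^ 2 := by
        have : (m : ℝ) / n ≤ n := by
          rw [div_le_iff₀ hn0]; exact_mod_cast hmn
        nlinarith
      have := Real.log_le_log (by linarith) hle
      rw [Real.log_pow] at this
      push_cast at this
      linarith
    have hnm : (n : ℝ) ≤ m := by exact_mod_cast h
    set L := Real.logb (1 + m / n) n
    calc ((n : ℝ) + m) * (Nat.log (m / n + 2) n + 2) ≤ (2 * m) * (L + 4 * L) := by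
          apply mul_le_mul <;> first | positivity | linarith
      _ ≤ 12 * (m * L) := by nlinarith
  · have hd : m / n = 0 := Nat.div_eq_of_lt h
    rw [hd]
    have h1 : (Nat.log (0 + 2) n : ℝ) ≤ Real.log n / Real.log 2 := by
      simpa [Real.logb] using Real.natLog_le_logb n 2
    have hl2 : 1 / 2 < Real.log 2 := by linarith [Real.log_two_gt_d9]
    have h2 : 1 ≤ Real.log n / Real.log 2 := by
      rw [le_div_iff₀ (by linarith), one_mul]
      exact Real.log_le_log (by norm_num) hnR
    have h3 : Real.log n / Real.log 2 ≤ 2 * Real.log n := by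
      rw [div_le_iff₀ (by linarith)]
      nlinarith
    have h4 : n * Real.log n ≤ m * Real.logb (1 + m / n) n := by
      have hle : Real.log (1 + m / n) ≤ m / n := by
        have := Real.log_le_sub_one_of_pos (show (0 : ℝ) < 1 + m / n by linarith)
        linarith
      rw [le_div_iff₀ hn0] at hle
      rw [hL, ← mul_div_assoc, le_div_iff₀ hlogx]
      nlinarith
    have hnm : (m : ℝ) ≤ n := by exact_mod_cast h.le
    calc ((n : ℝ) + m) * (Nat.log (0 + 2) n + 2) ≤ (2 * n) * (6 * Real.log n) := by
          apply mul_le_mul <;> first | positivity | linarith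
      _ = 12 * (n * Real.log n) := by ring
      _ ≤ _ := by linarith

/-- One program solves the shortest waypoint routing problem with a single waypoint on every
undirected network with `n` nodes and `m` links, on words of `O(log (n + m))` bits, within
`O(m log_{1 + m / n} n)` steps (the logarithm being defined for `m ≥ 1`). -/
theorem theorem1 :
    ∃ (P : RAM.Cmd) (K : ℕ) (C : ℝ),
      ∀ (n m : ℕ) (N : Network (Fin n)) (ends : Fin m → Fin n × Fin n) (_ : IsLinkList N ends)
        (s w t : Fin n),
        ∃ (T : ℕ) (σ : RAM.State),
          RAM.Exec ((n + m + 2) ^ K) P (inputState N ends s w t) T σ ∧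
          SolvesShortestRoute N s w t σ ∧
          (1 ≤ m → (T : ℝ) ≤ C * (m * Real.logb (1 + m / n) n)) := by
  refine ⟨RAM.shortestRoute, 4, 120000, fun n m N ends hl s w t => ?_⟩
  obtain ⟨T, hT, σ, he, hσ⟩ := RAM.shortestRoute_runs hl s w t
  refine ⟨T, σ, he, hσ, fun hm => ?_⟩
  have hinj : Function.Injective ends := fun i j hij => hl.injective (by simp only [hij])
  have hmn : m ≤ n * n := by simpa using Fintype.card_le_of_injective ends hinj
  have hadj : N.graph.Adj (ends ⟨0, hm⟩).1 (ends ⟨0, hm⟩).2 := by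
    have : s((ends ⟨0, hm⟩).1, (ends ⟨0, hm⟩).2) ∈ N.graph.edgeSet := hl.range_eq ▸ ⟨_, rfl⟩
    simpa using this
  have hn : 2 ≤ n := by
    have h1 := (ends ⟨0, hm⟩).1.isLt
    have h2 := (ends ⟨0, hm⟩).2.isLt
    have h3 : ((ends ⟨0, hm⟩).1 : ℕ) ≠ (ends ⟨0, hm⟩).2 := fun e => hadj.ne (Fin.ext e)
    omega
  have hle := add_mul_natLog_le hn hm hmn
  calc (T : ℝ) ≤ ((10000 * ((n + m) * (Nat.log (m / n + 2) n + 2)) : ℕ) : ℝ) := by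
        exact_mod_cast hT
    _ ≤ 120000 * (m * Real.logb (1 + m / n) n) := by
        rw [Nat.cast_mul]
        push_cast at hle ⊢
        linarith
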